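/- **Conventions.** All Lie superalgebras and modules are finite dimensional, modules are $\mathbb Z/2$-graded, morphisms are even, and $\Pi$ denotes parity change (the same space with the same action and with the two graded parts exchanged). Let $\mathfrak h=\mathfrak h_{\bar 0}\oplus\mathfrak h_{\bar 1}$ be a complex Lie superalgebra with $[\mathfrak h_{\bar 0},\mathfrak h]=0$, let $\tau:\mathfrak h\to\mathfrak h$ be an antilinear involution (even, bracket preserving, $\tau^2=1$), and let $\mathfrak h^{\mathbb R}=\mathfrak h^{\tau}$ be the corresponding real form. For an irreducible $\mathfrak h$-module $W$, let $V$ be an irreducible real $\mathfrak h^{\mathbb R}$-module such that $W$, regarded as a real $\mathfrak h^{\mathbb R}$-module, is isomorphic to $V$ or to $V\oplus V$; such a $V$ exists. The *endotype* of $W$ is the isomorphism class of the real superalgebra $$\underline{\mathrm{End}}(V)=\mathrm{Hom}_{\mathfrak h^{\mathbb R}}(V,V)\oplus\mathrm{Hom}_{\mathfrak h^{\mathbb R}}(V,\Pi V),$$ which does not depend on the choice of $V$. It is denoted as follows, where $\iota$ is odd, $\mathbb C$, $\mathbb R$ and the quaternions $\mathbb H$ are even, and $\iota$ commutes with the even part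 unless stated otherwise: - $0_{\mathbb C}$: $\mathbb C$; $\quad 1_{\mathbb C}$: $\mathbb C\oplus\mathbb C\iota$, $\iota^2=1$; - $0_{\mathbb R}$: $\mathbb R$; $\quad 1_{\mathbb R}$: $\mathbb R\oplus\mathbb R\iota$, $\iota^2=-1$; - $2_{\mathbb R}$: $\mathbb C\oplus\mathbb C\iota$, $\iota^2=-1$, $\iota i=-i\iota$; $\quad 3_{\mathbb R}$: $\mathbb H\oplus\mathbb H\iota$, $\iota^2=1$; - $4_{\mathbb R}$: $\mathbb H$; $\quad 5_{\mathbb R}$: $\mathbb H\oplus\mathbb H\iota$, $\iota^2=-1$; - $6_{\mathbb R}$: $\mathbb C\oplus\mathbb C\iota$, $\iota^2=1$, $\iota i=-i\iota$; $\quad 7_{\mathbb R}$: $\mathbb R\oplus\mathbb R\iota$, $\iota^2=1$. **Proposition 5.1.** Let $W$ be an irreducible $\mathfrak h$-module with central character $\lambda\in\mathfrak h_{\bar 0}^*$, that is, every $h\in\mathfrak h_{\bar 0}$ acts on $W$ by the scalar $\lambda(h)$. Let $B_\lambda:\mathfrak h_{\bar 1}\times\mathfrak h_{\bar 1}\to\mathbb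 C$ be the symmetric bilinear form $B_\lambda(x,y)=\lambda([x,y])$, with radical $R_\lambda$. 1. If $\lambda\neq\overline{\lambda\circ\tau}$, then the endotype of $W$ is $r_{\mathbb C}$, where $r=\mathrm{rank}(B_\lambda)\bmod 2$. 2. If $\lambda=\overline{\lambda\circ\tau}$, then the endotype of $W$ is $t_{\mathbb R}$, where $t=(q-p)\bmod 8$ and $(p,q)$ is the signature ($p$ positive and $q$ negative squares) of the nondegenerate real symmetric bilinear form $B_{\lambda,\tau}$ that $B_\lambda$ induces on $\mathfrak h^{\mathbb R}_{\bar 1}/(R_\lambda\cap\mathfrak h^{\mathbb R}_{\bar 1})$. -/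

import Mathlib

open Module

/-! ### Lie superalgebras and their modules -/

/-- The structure of a Lie superalgebra on a vector space `L` over a field `𝕜`
(used for `𝕜 = ℝ` and `𝕜 = ℂ`): a `ℤ/2`-grading and an even bilinear bracket that is
super-antisymmetric and satisfies the super Jacobi identity. -/
structure LieSuperalgebra (𝕜 : Type*) [Field 𝕜] (L : Type*) [AddCommGroup L] [Module 𝕜 L] where
  grading : ZMod 2 → Submodule 𝕜 L
  isCompl : IsCompl (grading 0) (grading 1)
  bracket : L →ₗ[𝕜] L →ₗ[𝕜] L
  bracket_mem : ∀ (i j : ZMod 2) (x y : L), x ∈ grading i → y ∈ grading j →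
    bracket x y ∈ grading (i + j)
  bracket_symm : ∀ (i j : ZMod 2) (x y : L), x ∈ grading i → y ∈ grading j →
    bracket x y = -((-1 : 𝕜) ^ (i.val * j.val) • bracket y x)
  jacobi : ∀ (i j : ZMod 2) (x y z : L), x ∈ grading i → y ∈ grading j →
    bracket x (bracket y z) =
      bracket (bracket x y) z + (-1 : 𝕜) ^ (i.val * j.val) • bracket y (bracket x z)

namespace LieSuperalgebra

section Modules

variable {𝕜 : Type*} [Field 𝕜] {L : Type*} [AddCommGroup L] [Module 𝕜 L]

/-- A module over a Lie superalgebra: a `ℤ/2`-graded vector space `V` with an even linear action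
satisfying `ρ [x, y] = ρ x ρ y - (-1)^{|x||y|} ρ y ρ x`. -/
structure Rep (𝔤 : LieSuperalgebra 𝕜 L) (V : Type*) [AddCommGroup V] [Module 𝕜 V] where
  grading : ZMod 2 → Submodule 𝕜 V
  isCompl : IsCompl (grading 0) (grading 1)
  ρ : L →ₗ[𝕜] Module.End 𝕜 V
  ρ_mem : ∀ (i j : ZMod 2) (x : L) (v : V), x ∈ 𝔤.grading i → v ∈ grading j →
    ρ x v ∈ grading (i + j)
  ρ_bracket : ∀ (i j : ZMod 2) (x y : L), x ∈ 𝔤.grading i → y ∈ 𝔤.grading j →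
    ρ (𝔤.bracket x y) = ρ x * ρ y - (-1 : 𝕜) ^ (i.val * j.val) • (ρ y * ρ x)

variable {𝔤 : LieSuperalgebra 𝕜 L}
variable {V : Type*} [AddCommGroup V] [Module 𝕜 V] {V' : Type*} [AddCommGroup V'] [Module 𝕜 V']

namespace Rep

/-- `U` is a graded submodule of `M`: it is spanned by its homogeneous components and stable under
the action. -/
def IsSubmodule (M : 𝔤.Rep V) (U : Submodule 𝕜 V) : Prop :=
  U = (U ⊓ M.grading 0) ⊔ (U ⊓ M.grading 1) ∧ ∀ (x : L) (v : V), v ∈ U → M.ρ x v ∈ U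

/-- `M` is a simple object of the category of graded modules and even morphisms. -/
def IsIrreducible (M : 𝔤.Rep V) : Prop :=
  Nontrivial V ∧ ∀ U : Submodule 𝕜 V, M.IsSubmodule U → U = ⊥ ∨ U = ⊤

/-- The space of (grading preserving) morphisms of modules. -/
def hom (M : 𝔤.Rep V) (N : 𝔤.Rep V') : Submodule 𝕜 (V →ₗ[𝕜] V') where
  carrier := {T | (∀ (j : ZMod 2) (v : V), v ∈ M.grading j → T v ∈ N.grading j) ∧
    ∀ (x : L) (v : V), T (M.ρ x v) = N.ρ x (T v)}
  add_mem' := by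
    rintro S T ⟨hS, hS'⟩ ⟨hT, hT'⟩
    exact ⟨fun j v hv => add_mem (hS j v hv) (hT j v hv), fun x v => by simp [hS', hT']⟩
  zero_mem' := ⟨fun j v _ => by simp, fun x v => by simp⟩
  smul_mem' := by
    rintro c T ⟨hT, hT'⟩
    exact ⟨fun j v hv => Submodule.smul_mem _ c (hT j v hv), fun x v => by simp [hT']⟩

/-- Isomorphism in the category of modules and even morphisms. -/
def IsIso (M : 𝔤.Rep V) (N : 𝔤.Rep V') : Prop :=
  ∃ e : V ≃ₗ[𝕜] V', e.toLinearMap ∈ hom M N ∧ e.symm.toLinearMap ∈ hom N M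

/-- The direct sum of two modules. -/
def directSum (M : 𝔤.Rep V) (N : 𝔤.Rep V') : 𝔤.Rep (V × V') where
  grading i := (M.grading i).prod (N.grading i)
  isCompl := by
    constructor
    · rw [disjoint_iff, Submodule.prod_inf_prod, M.isCompl.inf_eq_bot, N.isCompl.inf_eq_bot,
        Submodule.prod_bot]
    · rw [codisjoint_iff, Submodule.prod_sup_prod, M.isCompl.sup_eq_top, N.isCompl.sup_eq_top,
        Submodule.prod_top]
  ρ :=
    { toFun := fun x => (M.ρ x).prodMap (N.ρ x)
      map_add' := fun x y => by ext <;> simp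
      map_smul' := fun c x => by ext <;> simp }
  ρ_mem := fun i j x v hx hv =>
    ⟨M.ρ_mem i j x v.1 hx hv.1, N.ρ_mem i j x v.2 hx hv.2⟩
  ρ_bracket := fun i j x y hx hy => by
    ext <;> simp [M.ρ_bracket i j x y hx hy, N.ρ_bracket i j x y hx hy]

/-- `Πⁱ M`, where `Π` is the parity change functor: the same space with the same action, and with
the even and odd parts exchanged if `i = 1`. -/
def parityShift (i : ZMod 2) (M : 𝔤.Rep V) : 𝔤.Rep V where
  grading j := M.grading (j + i)
  isCompl := by
    have h : ∀ i : ZMod 2, i = 0 ∨ i = 1 := by decide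
    rcases h i with rfl | rfl
    · simpa using M.isCompl
    · simpa [show (1 + 1 : ZMod 2) = 0 from rfl] using M.isCompl.symm
  ρ := M.ρ
  ρ_mem := fun k j x v hx hv => by
    rw [add_assoc]; exact M.ρ_mem k (j + i) x v hx hv
  ρ_bracket := M.ρ_bracket

end Rep

end Modules

end LieSuperalgebra

/-! ### Associative superalgebras and the Brauer–Wall monoid of `ℝ` -/

/-- An associative unital superalgebra over `𝕜`. -/
structure Superalgebra (𝕜 : Type*) [Field 𝕜] where
  carrier : Type*
  [ring : Ring carrier]
  [algebra : Algebra 𝕜 carrier]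
  grading : ZMod 2 → Submodule 𝕜 carrier
  isCompl : IsCompl (grading 0) (grading 1)
  one_mem : (1 : carrier) ∈ grading 0
  mul_mem : ∀ (i j : ZMod 2) (a b : carrier), a ∈ grading i → b ∈ grading j →
    a * b ∈ grading (i + j)

attribute [instance] Superalgebra.ring Superalgebra.algebra

namespace Superalgebra

/-- Isomorphism of superalgebras: a grading preserving isomorphism of algebras. -/
def IsIso {𝕜 : Type*} [Field 𝕜] (A B : Superalgebra 𝕜) : Prop :=
  ∃ e : A.carrier ≃ₐ[𝕜] B.carrier, ∀ i : ZMod 2,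
    (A.grading i).map e.toLinearEquiv.toLinearMap = B.grading i

/-- An algebra regarded as a purely even superalgebra. -/
noncomputable def ofEven (D : Type) [Ring D] [Algebra ℝ D] : Superalgebra ℝ where
  carrier := D
  grading i := if i = 0 then ⊤ else ⊥
  isCompl := by simpa using isCompl_top_bot
  one_mem := by simp
  mul_mem := by
    have h : ∀ i : ZMod 2, i = 0 ∨ i = 1 := by decide
    intro i j a b ha hb
    rcases h i with rfl | rfl <;> rcases h j with rfl | rfl <;> simp_all

section AdjoinOdd

variable {D : Type} [Ring D] [Algebra ℝ D]

/-- The underlying space of `D ⊕ Dι`; the pair `⟨a, b⟩` stands for `a + bι`. -/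
@[ext]
structure AdjoinOdd (σ : {σ : D ≃ₐ[ℝ] D // ∀ a, σ (σ a) = a}) (ε : ℝ) where
  fst : D
  snd : D

namespace AdjoinOdd

variable {σ : {σ : D ≃ₐ[ℝ] D // ∀ a, σ (σ a) = a}} {ε : ℝ}

instance : Zero (AdjoinOdd σ ε) := ⟨⟨0, 0⟩⟩
instance : One (AdjoinOdd σ ε) := ⟨⟨1, 0⟩⟩
instance : Add (AdjoinOdd σ ε) := ⟨fun x y => ⟨x.1 + y.1, x.2 + y.2⟩⟩
instance : Neg (AdjoinOdd σ ε) := ⟨fun x => ⟨-x.1, -x.2⟩⟩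
instance : SMul ℝ (AdjoinOdd σ ε) := ⟨fun c x => ⟨c • x.1, c • x.2⟩⟩

/-- The multiplication of `D ⊕ Dι` determined by `ι a = σ(a) ι` and `ι² = ε`. -/
instance : Mul (AdjoinOdd σ ε) :=
  ⟨fun x y => ⟨x.1 * y.1 + ε • (x.2 * σ.1 y.2), x.1 * y.2 + x.2 * σ.1 y.1⟩⟩

@[simp] theorem zero_fst : (0 : AdjoinOdd σ ε).fst = 0 := rfl
@[simp] theorem zero_snd : (0 : AdjoinOdd σ ε).snd = 0 := rfl
@[simp] theorem one_fst : (1 : AdjoinOdd σ ε).fst = 1 := rfl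
@[simp] theorem one_snd : (1 : AdjoinOdd σ ε).snd = 0 := rfl
@[simp] theorem add_fst (x y : AdjoinOdd σ ε) : (x + y).fst = x.fst + y.fst := rfl
@[simp] theorem add_snd (x y : AdjoinOdd σ ε) : (x + y).snd = x.snd + y.snd := rfl
@[simp] theorem neg_fst (x : AdjoinOdd σ ε) : (-x).fst = -x.fst := rfl
@[simp] theorem neg_snd (x : AdjoinOdd σ ε) : (-x).snd = -x.snd := rfl
@[simp] theorem smul_fst (c : ℝ) (x : AdjoinOdd σ ε) : (c • x).fst = c • x.fst := rfl
@[simp] theorem smul_snd (c : ℝ) (x : AdjoinOdd σ ε) : (c • x).snd = c • x.snd := rfl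
@[simp] theorem mul_fst (x y : AdjoinOdd σ ε) :
    (x * y).fst = x.fst * y.fst + ε • (x.snd * σ.1 y.snd) := rfl
@[simp] theorem mul_snd (x y : AdjoinOdd σ ε) :
    (x * y).snd = x.fst * y.snd + x.snd * σ.1 y.fst := rfl

instance : Ring (AdjoinOdd σ ε) where
  add_assoc x y z := by ext <;> simp [add_assoc]
  zero_add x := by ext <;> simp
  add_zero x := by ext <;> simp
  add_comm x y := by ext <;> simp [add_comm]
  neg_add_cancel x := by ext <;> simp
  nsmul := nsmulRec
  zsmul := zsmulRec
  left_distrib x y z := by ext <;> simp [mul_add] <;> abel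
  right_distrib x y z := by ext <;> simp [add_mul] <;> abel
  zero_mul x := by ext <;> simp
  mul_zero x := by ext <;> simp
  mul_assoc x y z := by ext <;> simp [mul_add, add_mul, mul_assoc, σ.2] <;> abel
  one_mul x := by ext <;> simp
  mul_one x := by ext <;> simp

instance : Module ℝ (AdjoinOdd σ ε) where
  one_smul x := by ext <;> simp
  mul_smul c d x := by ext <;> simp [mul_smul]
  smul_zero c := by ext <;> simp
  smul_add c x y := by ext <;> simp
  add_smul c d x := by ext <;> simp [add_smul]
  zero_smul x := by ext <;> simp

instance : Algebra ℝ (AdjoinOdd σ ε) :=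
  Algebra.ofModule
    (fun c x y => by ext <;> simp [smul_comm ε c])
    (fun c x y => by ext <;> simp [smul_comm ε c])

end AdjoinOdd

/-- The superalgebra `D ⊕ Dι` with even part `D` and odd part `Dι`, where `ι² = ε` and
`ι a = σ(a) ι` for `a ∈ D`; here `σ` is an automorphism of the `ℝ`-algebra `D` with `σ² = 1`. -/
noncomputable def adjoinOdd (σ : {σ : D ≃ₐ[ℝ] D // ∀ a, σ (σ a) = a}) (ε : ℝ) : Superalgebra ℝ where
  carrier := AdjoinOdd σ ε
  grading i :=
    { carrier := {x | (i = 0 → x.2 = 0) ∧ (i = 1 → x.1 = 0)}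
      add_mem' := fun {x y} hx hy =>
        ⟨fun h => by simp [hx.1 h, hy.1 h], fun h => by simp [hx.2 h, hy.2 h]⟩
      zero_mem' := ⟨fun _ => rfl, fun _ => rfl⟩
      smul_mem' := fun c x hx => ⟨fun h => by simp [hx.1 h], fun h => by simp [hx.2 h]⟩ }
  isCompl := by
    constructor
    · rw [Submodule.disjoint_def]
      intro x hx hy
      exact AdjoinOdd.ext (hy.2 rfl) (hx.1 rfl)
    · rw [codisjoint_iff, eq_top_iff]
      intro x _
      refine Submodule.mem_sup.2 ⟨⟨x.1, 0⟩, ⟨fun _ => rfl, fun h => absurd h (by decide)⟩,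
        ⟨0, x.2⟩, ⟨fun h => absurd h (by decide), fun _ => rfl⟩, ?_⟩
      ext <;> simp
  one_mem := ⟨fun _ => rfl, fun h => absurd h (by decide)⟩
  mul_mem := by
    have h : ∀ i : ZMod 2, i = 0 ∨ i = 1 := by decide
    intro i j a b ha hb
    rcases h i with rfl | rfl <;> rcases h j with rfl | rfl
    · exact ⟨fun _ => by simp [ha.1 rfl, hb.1 rfl], fun h => absurd h (by decide)⟩
    · exact ⟨fun h => absurd h (by decide), fun _ => by simp [ha.1 rfl, hb.2 rfl]⟩
    · exact ⟨fun h => absurd h (by decide), fun _ => by simp [ha.2 rfl, hb.1 rfl]⟩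
    · exact ⟨fun _ => by simp [ha.2 rfl, hb.2 rfl], fun h => absurd h (by decide)⟩

/-- The trivial automorphism of `D`, so that `ι` commutes with `D`. -/
def trivialAut (D : Type) [Ring D] [Algebra ℝ D] : {σ : D ≃ₐ[ℝ] D // ∀ a, σ (σ a) = a} :=
  ⟨AlgEquiv.refl, fun _ => rfl⟩

/-- Complex conjugation, so that `ι i = -i ι`. -/
noncomputable def conjAut : {σ : ℂ ≃ₐ[ℝ] ℂ // ∀ a, σ (σ a) = a} :=
  ⟨Complex.conjAe, fun a => by simp⟩

end AdjoinOdd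

end Superalgebra

/-- The ten elements of the Brauer–Wall monoid of `ℝ`: `complex k` is `k_ℂ` and `real k` is
`k_ℝ`. -/
inductive BrauerWall : Type
  | complex (k : ZMod 2)
  | real (k : ZMod 8)

open Superalgebra Quaternion in
/-- The real division superalgebra that represents an element of the Brauer–Wall monoid. The
division superalgebra `k_ℝ` is Morita equivalent to the real Clifford superalgebra on `k`
anticommuting odd generators of square `-1`. -/
noncomputable def BrauerWall.divisionSuperalgebra : BrauerWall → Superalgebra ℝ
  | .complex k =>
    match k.val with
    | 0 => ofEven ℂ
    | _ => adjoinOdd (trivialAut ℂ) 1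
  | .real k =>
    match k.val with
    | 0 => ofEven ℝ
    | 1 => adjoinOdd (trivialAut ℝ) (-1)
    | 2 => adjoinOdd conjAut (-1)
    | 3 => adjoinOdd (trivialAut ℍ[ℝ]) 1
    | 4 => ofEven ℍ[ℝ]
    | 5 => adjoinOdd (trivialAut ℍ[ℝ]) (-1)
    | 6 => adjoinOdd conjAut 1
    | _ => adjoinOdd (trivialAut ℝ) 1

/-! ### Enriched endomorphism superalgebras -/

namespace LieSuperalgebra

namespace Rep

variable {L : Type*} [AddCommGroup L] [Module ℝ L] {𝔤 : LieSuperalgebra ℝ L}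
variable {V : Type*} [AddCommGroup V] [Module ℝ V]

/-- The parity operator of the graded space underlying a module. -/
theorem exists_parity (M : 𝔤.Rep V) : ∃ γ : Module.End ℝ V, (∀ v, γ (γ v) = v) ∧
    (∀ v, v ∈ M.grading 0 ↔ γ v = v) ∧ (∀ v, v ∈ M.grading 1 ↔ γ v = -v) := by
  have : IsAddTorsionFree V := IsAddTorsionFree.of_isTorsionFree ℝ V
  let γ : Module.End ℝ V := LinearMap.ofIsCompl M.isCompl (M.grading 0).subtype
    (-(M.grading 1).subtype)
  have h0 : ∀ v, v ∈ M.grading 0 → γ v = v := fun v hv =>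
    LinearMap.ofIsCompl_apply_left M.isCompl (⟨v, hv⟩ : M.grading 0)
  have h1 : ∀ v, v ∈ M.grading 1 → γ v = -v := fun v hv =>
    LinearMap.ofIsCompl_apply_right M.isCompl (⟨v, hv⟩ : M.grading 1)
  have hd : ∀ v, ∃ a ∈ M.grading 0, ∃ b ∈ M.grading 1, a + b = v := fun v =>
    Submodule.mem_sup.1 (M.isCompl.sup_eq_top ▸ Submodule.mem_top)
  refine ⟨γ, fun v => ?_, fun v => ⟨h0 v, fun h => ?_⟩, fun v => ⟨h1 v, fun h => ?_⟩⟩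
  · obtain ⟨a, ha, b, hb, rfl⟩ := hd v
    simp [h0 a ha, h1 b hb]
  · obtain ⟨a, ha, b, hb, rfl⟩ := hd v
    rw [map_add, h0 a ha, h1 b hb, add_right_inj, neg_eq_self] at h
    simpa [h] using ha
  · obtain ⟨a, ha, b, hb, rfl⟩ := hd v
    rw [map_add, h0 a ha, h1 b hb, neg_add, add_left_inj, self_eq_neg] at h
    simpa [h] using hb

/-- The enriched endomorphism superalgebra `Hom(V, V) ⊕ Hom(V, ΠV)`. Both summands are spaces of
linear endomorphisms of `V`; their sum is the algebra of all linear endomorphisms that commute with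
the action. -/
noncomputable def enrichedEnd (M : 𝔤.Rep V) : Superalgebra ℝ where
  carrier := Subalgebra.centralizer ℝ (Set.range M.ρ : Set (Module.End ℝ V))
  grading i := (hom M (M.parityShift i)).comap
    (Subalgebra.centralizer ℝ (Set.range M.ρ : Set (Module.End ℝ V))).val.toLinearMap
  isCompl := by
    have h2 : ∀ i : ZMod 2, i = 0 ∨ i = 1 := by decide
    obtain ⟨γ, hγ, hγ0, hγ1⟩ := M.exists_parity
    have hd : ∀ v, ∃ a ∈ M.grading 0, ∃ b ∈ M.grading 1, a + b = v := fun v =>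
      Submodule.mem_sup.1 (M.isCompl.sup_eq_top ▸ Submodule.mem_top)
    constructor
    · rw [Submodule.disjoint_def]
      rintro ⟨T, hT⟩ h h'
      have h0 := h.1
      have h1 := h'.1
      have key : ∀ (j : ZMod 2) (v : V), v ∈ M.grading j → T v = 0 := by
        intro j v hv
        have a : T v ∈ M.grading (j + 0) := h0 j v hv
        have b : T v ∈ M.grading (j + 1) := h1 j v hv
        have hdis := Submodule.disjoint_def.1 M.isCompl.disjoint
        rcases h2 j with rfl | rfl
        · exact hdis _ a b
        · exact hdis _ b a
      apply Subtype.ext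
      ext v
      obtain ⟨a, ha, b, hb, rfl⟩ := hd v
      change T (a + b) = 0
      rw [map_add, key 0 a ha, key 1 b hb, add_zero]
    · rw [codisjoint_iff, eq_top_iff]
      rintro ⟨T, hT⟩ -
      have hTc : ∀ x v, T (M.ρ x v) = M.ρ x (T v) := fun x v =>
        (LinearMap.congr_fun (Subalgebra.mem_centralizer_iff ℝ |>.1 hT (M.ρ x) ⟨x, rfl⟩) v).symm
      have hγe : ∀ x ∈ 𝔤.grading 0, ∀ v, γ (M.ρ x v) = M.ρ x (γ v) := by
        intro x hx v
        obtain ⟨a, ha, b, hb, rfl⟩ := hd v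
        have ha' := (hγ0 _).1 (M.ρ_mem 0 0 x a hx ha)
        have hb' := (hγ1 _).1 (M.ρ_mem 0 1 x b hx hb)
        simp [ha', hb', (hγ0 _).1 ha, (hγ1 _).1 hb]
      have hγo : ∀ x ∈ 𝔤.grading 1, ∀ v, γ (M.ρ x v) = -M.ρ x (γ v) := by
        intro x hx v
        obtain ⟨a, ha, b, hb, rfl⟩ := hd v
        have ha' := (hγ1 _).1 (M.ρ_mem 1 0 x a hx ha)
        have hb' := (hγ0 _).1 (M.ρ_mem 1 1 x b hx hb)
        simp [ha', hb', (hγ0 _).1 ha, (hγ1 _).1 hb, add_comm]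
      have hS : ∀ x v, γ (T (γ (M.ρ x v))) = M.ρ x (γ (T (γ v))) := by
        intro x v
        obtain ⟨a, ha, b, hb, rfl⟩ :=
          Submodule.mem_sup.1 (𝔤.isCompl.sup_eq_top ▸ (Submodule.mem_top : x ∈ ⊤))
        simp [hγe a ha, hγo b hb, hTc]
      have hmem : ∀ c : ℝ, (T + c • (γ * T * γ)) ∈
          Subalgebra.centralizer ℝ (Set.range M.ρ : Set (Module.End ℝ V)) := by
        intro c
        rw [Subalgebra.mem_centralizer_iff]
        rintro _ ⟨x, rfl⟩
        ext v
        simp [hTc, hS]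
      have hmem' : ∀ c : ℝ, ∀ x v, (T + c • (γ * T * γ)) (M.ρ x v) =
          M.ρ x ((T + c • (γ * T * γ)) v) := by
        intro c x v
        simp [hTc, hS]
      refine Submodule.mem_sup.2 ⟨(1 / 2 : ℝ) • ⟨_, hmem 1⟩, Submodule.smul_mem _ _ ?_,
        (1 / 2 : ℝ) • ⟨_, hmem (-1)⟩, Submodule.smul_mem _ _ ?_, ?_⟩
      · refine ⟨fun j v hv => ?_, fun x v => hmem' 1 x v⟩
        change (T + (1 : ℝ) • (γ * T * γ)) v ∈ M.grading (j + 0)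
        rcases h2 j with rfl | rfl
        · refine (hγ0 _).2 ?_
          simp [(hγ0 _).1 hv, hγ, add_comm]
        · refine (hγ1 _).2 ?_
          simp [(hγ1 _).1 hv, hγ]
      · refine ⟨fun j v hv => ?_, fun x v => hmem' (-1) x v⟩
        change (T + (-1 : ℝ) • (γ * T * γ)) v ∈ M.grading (j + 1)
        rcases h2 j with rfl | rfl
        · refine (hγ1 _).2 ?_
          simp [(hγ0 _).1 hv, hγ]
        · refine (hγ0 _).2 ?_
          simp [(hγ1 _).1 hv, hγ, add_comm]
      · apply Subtype.ext
        ext v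
        simp only [Subalgebra.coe_add, Subalgebra.coe_smul, LinearMap.add_apply,
          LinearMap.smul_apply]
        module
  one_mem := ⟨fun j v hv => by simpa [parityShift] using hv, fun x v => rfl⟩
  mul_mem := by
    rintro i j ⟨S, hS⟩ ⟨T, hT⟩ ⟨hS1, hS2⟩ ⟨hT1, hT2⟩
    refine ⟨fun k v hv => ?_, fun x v => ?_⟩
    · have h := hS1 (k + j) (T v) (hT1 k v hv)
      change S (T v) ∈ M.grading (k + (i + j))
      have e : k + (i + j) = k + j + i := by ring
      rw [e]; exact h
    · change S (T (M.ρ x v)) = M.ρ x (S (T v))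
      have a : T (M.ρ x v) = M.ρ x (T v) := hT2 x v
      have b : S (M.ρ x (T v)) = M.ρ x (S (T v)) := hS2 x (T v)
      rw [a, b]

end Rep

/-! ### Real forms -/

/-- An antilinear involution of a complex Lie superalgebra: an even antilinear bijection of order at
most two which preserves the bracket. -/
structure AntilinearInvolution {L : Type*} [AddCommGroup L] [Module ℂ L]
    (𝔤 : LieSuperalgebra ℂ L) where
  toMap : L →ₛₗ[starRingEnd ℂ] L
  map_mem : ∀ (i : ZMod 2) (x : L), x ∈ 𝔤.grading i → toMap x ∈ 𝔤.grading i
  map_bracket : ∀ x y : L, toMap (𝔤.bracket x y) = 𝔤.bracket (toMap x) (toMap y)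
  map_map : ∀ x : L, toMap (toMap x) = x

namespace AntilinearInvolution

variable {L : Type*} [AddCommGroup L] [Module ℂ L] {𝔤 : LieSuperalgebra ℂ L}

/-- The real vector space of fixed points of `τ`. -/
def fixed (τ : 𝔤.AntilinearInvolution) : Submodule ℝ L where
  carrier := {x | τ.toMap x = x}
  add_mem' := fun {x y} hx hy => by
    change τ.toMap (x + y) = x + y
    rw [map_add, show τ.toMap x = x from hx, show τ.toMap y = y from hy]
  zero_mem' := map_zero _
  smul_mem' := fun c x hx => by
    change τ.toMap (c • x) = c • x
    rw [← Complex.coe_smul, map_smulₛₗ, show τ.toMap x = x from hx, Complex.conj_ofReal]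

/-- The real form `𝔤^ℝ` of `𝔤` given by the fixed points of `τ`. -/
noncomputable def realForm (τ : 𝔤.AntilinearInvolution) : LieSuperalgebra ℝ τ.fixed where
  grading i := ((𝔤.grading i).restrictScalars ℝ).comap τ.fixed.subtype
  isCompl := by
    have hdis := Submodule.disjoint_def.1 𝔤.isCompl.disjoint
    constructor
    · rw [Submodule.disjoint_def]
      intro x hx hy
      exact Subtype.ext (hdis _ hx hy)
    · rw [codisjoint_iff, eq_top_iff]
      rintro ⟨x, hx⟩ -
      obtain ⟨a, ha, b, hb, rfl⟩ :=
        Submodule.mem_sup.1 (𝔤.isCompl.sup_eq_top ▸ (Submodule.mem_top : x ∈ ⊤))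
      have hx' : τ.toMap a + τ.toMap b = a + b := by rw [← map_add]; exact hx
      have hab : τ.toMap a - a = b - τ.toMap b := by
        rw [sub_eq_sub_iff_add_eq_add, hx', add_comm]
      have h0 : τ.toMap a - a = 0 := by
        refine hdis _ (sub_mem (τ.map_mem 0 a ha) ha) ?_
        rw [hab]
        exact sub_mem hb (τ.map_mem 1 b hb)
      have ha' : τ.toMap a = a := sub_eq_zero.1 h0
      have hb' : τ.toMap b = b := (sub_eq_zero.1 (hab ▸ h0)).symm
      exact Submodule.mem_sup.2 ⟨⟨a, ha'⟩, ha, ⟨b, hb'⟩, hb, rfl⟩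
  bracket := LinearMap.mk₂ ℝ
    (fun x y => ⟨𝔤.bracket x y, by
      have hx : τ.toMap (x : L) = x := x.2
      have hy : τ.toMap (y : L) = y := y.2
      change τ.toMap (𝔤.bracket x y) = 𝔤.bracket x y
      rw [τ.map_bracket, hx, hy]⟩)
    (fun x y z => Subtype.ext (by simp))
    (fun c x y => Subtype.ext (by simp [← Complex.coe_smul]))
    (fun x y z => Subtype.ext (by simp))
    (fun c x y => Subtype.ext (by simp [← Complex.coe_smul]))
  bracket_mem := fun i j x y hx hy => 𝔤.bracket_mem i j x y hx hy
  bracket_symm := fun i j x y hx hy => Subtype.ext (by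
    have h := 𝔤.bracket_symm i j x y hx hy
    simpa [← Complex.coe_smul] using h)
  jacobi := fun i j x y z hx hy => Subtype.ext (by
    have h := 𝔤.jacobi i j x y z hx hy
    simpa [← Complex.coe_smul] using h)

/-- Restriction of a complex module to a real module of the real form. -/
noncomputable def restrict (τ : 𝔤.AntilinearInvolution) {W : Type*} [AddCommGroup W] [Module ℂ W]
    (M : 𝔤.Rep W) : τ.realForm.Rep W where
  grading i := (M.grading i).restrictScalars ℝ
  isCompl := by
    constructor
    · rw [Submodule.disjoint_def]
      exact fun x hx hy => Submodule.disjoint_def.1 M.isCompl.disjoint x hx hy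
    · rw [codisjoint_iff, eq_top_iff]
      intro x _
      obtain ⟨a, ha, b, hb, h⟩ :=
        Submodule.mem_sup.1 (M.isCompl.sup_eq_top ▸ (Submodule.mem_top : x ∈ ⊤))
      exact Submodule.mem_sup.2 ⟨a, ha, b, hb, h⟩
  ρ :=
    { toFun := fun x => (M.ρ x).restrictScalars ℝ
      map_add' := fun x y => by ext v; simp
      map_smul' := fun c x => by ext v; simp [← Complex.coe_smul] }
  ρ_mem := fun i j x v hx hv => M.ρ_mem i j x v hx hv
  ρ_bracket := fun i j x y hx hy => by
    ext v
    have h := LinearMap.congr_fun (M.ρ_bracket i j x y hx hy) v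
    simpa [realForm, ← Complex.coe_smul] using h

end AntilinearInvolution

/-! ### Endotypes -/

section Endotype

universe u v

variable {L : Type u} [AddCommGroup L] [Module ℂ L] {𝔤 : LieSuperalgebra ℂ L}

/-- `Φ([W]) = [V]`: the module `V` of the real form is irreducible, and the restriction of `W` to
the real form is isomorphic to `V` or to `V ⊕ V`. -/
def IsPhi (τ : 𝔤.AntilinearInvolution) {W : Type v} [AddCommGroup W] [Module ℂ W] (M : 𝔤.Rep W)
    {V : Type v} [AddCommGroup V] [Module ℝ V] (N : τ.realForm.Rep V) : Prop :=
  N.IsIrreducible ∧ ((τ.restrict M).IsIso N ∨ (τ.restrict M).IsIso (N.directSum N))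

/-- The endotype of `W` is `d`: a module `V` with `Φ([W]) = [V]` exists, and the enriched
endomorphism superalgebra of each such `V` is isomorphic to the division superalgebra `d`. -/
def HasEndotype (τ : 𝔤.AntilinearInvolution) {W : Type v} [AddCommGroup W] [Module ℂ W]
    (M : 𝔤.Rep W) (d : BrauerWall) : Prop :=
  (∃ (V : Type v) (_ : AddCommGroup V) (_ : Module ℝ V) (N : τ.realForm.Rep V), IsPhi τ M N) ∧
  ∀ (V : Type v) [AddCommGroup V] [Module ℝ V] (N : τ.realForm.Rep V), IsPhi τ M N →
    N.enrichedEnd.IsIso d.divisionSuperalgebra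

end Endotype

/-! ### Central characters and the forms `B_λ` and `B_{λ,τ}` -/

section Forms

variable {L : Type*} [AddCommGroup L] [Module ℂ L] {𝔥 : LieSuperalgebra ℂ L}

/-- The even part acts on the module by the linear functional `lam`. -/
def HasCentralCharacter {W : Type*} [AddCommGroup W] [Module ℂ W] (M : 𝔥.Rep W)
    (lam : Dual ℂ (𝔥.grading 0)) : Prop :=
  ∀ h : 𝔥.grading 0, M.ρ h = lam h • (1 : Module.End ℂ W)

/-- The complex linear functional `x ↦ conj (lam (τ x))` on the even part. -/
noncomputable def conjDual (τ : 𝔥.AntilinearInvolution) (lam : Dual ℂ (𝔥.grading 0)) :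
    Dual ℂ (𝔥.grading 0) where
  toFun x := starRingEnd ℂ (lam ⟨τ.toMap x, τ.map_mem 0 x x.2⟩)
  map_add' x y := by
    rw [← map_add, ← map_add]
    congr 2
    exact Subtype.ext (map_add τ.toMap (x : L) y)
  map_smul' c x := by
    have h : (⟨τ.toMap ((c • x : 𝔥.grading 0) : L), τ.map_mem 0 _ (c • x).2⟩ : 𝔥.grading 0) =
        (starRingEnd ℂ c) • ⟨τ.toMap x, τ.map_mem 0 x x.2⟩ :=
      Subtype.ext (map_smulₛₗ τ.toMap c (x : L))
    rw [h, map_smul]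
    simp

/-- The bilinear form `B_λ(x, y) = λ([x, y])` on the odd part. -/
noncomputable def oddForm (lam : Dual ℂ (𝔥.grading 0)) :
    𝔥.grading 1 →ₗ[ℂ] 𝔥.grading 1 →ₗ[ℂ] ℂ :=
  LinearMap.mk₂ ℂ (fun x y => lam ⟨𝔥.bracket x y, 𝔥.bracket_mem 1 1 x y x.2 y.2⟩)
    (fun x y z => by rw [← map_add]; congr 1; exact Subtype.ext (by simp))
    (fun c x y => by rw [← map_smul]; congr 1; exact Subtype.ext (by simp))
    (fun x y z => by rw [← map_add]; congr 1; exact Subtype.ext (by simp))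
    (fun c x y => by rw [← map_smul]; congr 1; exact Subtype.ext (by simp))

/-- The rank of `B_λ`. -/
noncomputable def oddRank (lam : Dual ℂ (𝔥.grading 0)) : ℕ :=
  finrank ℂ (LinearMap.range (oddForm lam))

/-- The inclusion of the odd part of the real form into the odd part. -/
noncomputable def oddInclusion (τ : 𝔥.AntilinearInvolution) : τ.realForm.grading 1 →ₗ[ℝ] 𝔥.grading 1 where
  toFun x := ⟨x, x.2⟩
  map_add' _ _ := rfl
  map_smul' _ _ := rfl

/-- The intersection of the radical of `B_λ` with the odd part of the real form. -/
noncomputable def realRadical (τ : 𝔥.AntilinearInvolution) (lam : Dual ℂ (𝔥.grading 0)) :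
    Submodule ℝ (τ.realForm.grading 1) :=
  ((LinearMap.ker (oddForm lam)).restrictScalars ℝ).comap (oddInclusion τ)

/-- The real part of the restriction of `B_λ` to the odd part of the real form. (If
`λ = conj (λ ∘ τ)`, then this restriction is real-valued; see `coe_realOddForm`.) -/
noncomputable def realOddForm (τ : 𝔥.AntilinearInvolution) (lam : Dual ℂ (𝔥.grading 0)) :
    τ.realForm.grading 1 →ₗ[ℝ] τ.realForm.grading 1 →ₗ[ℝ] ℝ :=
  LinearMap.mk₂ ℝ (fun x y => (oddForm lam (oddInclusion τ x) (oddInclusion τ y)).re)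
    (fun x y z => by simp)
    (fun c x y => by simp [← Complex.coe_smul])
    (fun x y z => by simp)
    (fun c x y => by simp [← Complex.coe_smul])

theorem oddForm_symm (lam : Dual ℂ (𝔥.grading 0)) (x y : 𝔥.grading 1) :
    oddForm lam x y = oddForm lam y x := by
  have h := 𝔥.bracket_symm 1 1 x y x.2 y.2
  have h' : (1 : ZMod 2).val = 1 := rfl
  simp only [h', mul_one, pow_one, neg_smul, one_smul, neg_neg] at h
  change lam _ = lam _
  congr 1
  exact Subtype.ext h

theorem coe_realOddForm (τ : 𝔥.AntilinearInvolution) (lam : Dual ℂ (𝔥.grading 0))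
    (h : lam = conjDual τ lam) (x y : τ.realForm.grading 1) :
    (realOddForm τ lam x y : ℂ) = oddForm lam (oddInclusion τ x) (oddInclusion τ y) := by
  refine Complex.conj_eq_iff_re.1 ?_
  have hx : τ.toMap (x : L) = x := x.1.2
  have hy : τ.toMap (y : L) = y := y.1.2
  conv_rhs => rw [h]
  change starRingEnd ℂ (lam _) = starRingEnd ℂ (lam _)
  congr 2
  apply Subtype.ext
  change 𝔥.bracket x y = τ.toMap (𝔥.bracket x y)
  rw [τ.map_bracket, hx, hy]

/-- The form `B_{λ,τ}` that `B_λ` induces on the quotient of the odd part of the real form by the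
radical. -/
noncomputable def inducedForm (τ : 𝔥.AntilinearInvolution) (lam : Dual ℂ (𝔥.grading 0)) :
    LinearMap.BilinForm ℝ (τ.realForm.grading 1 ⧸ realRadical τ lam) :=
  ((realRadical τ lam).liftQ ((realRadical τ lam).liftQ (realOddForm τ lam) (by
      intro x hx
      have hx' : oddForm lam (oddInclusion τ x) = 0 := hx
      ext y
      change (oddForm lam (oddInclusion τ x) (oddInclusion τ y)).re = 0
      simp [hx'])).flip (by
    intro y hy
    have hy' : oddForm lam (oddInclusion τ y) = 0 := hy
    ext x
    change (oddForm lam (oddInclusion τ x) (oddInclusion τ y)).re = 0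
    rw [oddForm_symm, hy']
    simp)).flip

theorem inducedForm_mk (τ : 𝔥.AntilinearInvolution) (lam : Dual ℂ (𝔥.grading 0))
    (x y : τ.realForm.grading 1) :
    inducedForm τ lam (Submodule.Quotient.mk x) (Submodule.Quotient.mk y) =
      realOddForm τ lam x y := rfl

end Forms

end LieSuperalgebra

/-! ### Graded simple sets of operators and their commutants -/

namespace GradedOperators

variable {V : Type*} [AddCommGroup V] [Module ℝ V]

/-! Let `V` be the real module attached to `W`. It embeds into `W`, so every odd pair satisfies the
Clifford relation xy + yx = B_λ(x, y) there. A vector of the radical acts by an odd operator of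
square zero that commutes or anticommutes with the action of every homogeneous element; its kernel
is therefore a submodule, and the operator vanishes. The endotype is thus the commutant of a
Clifford algebra on a graded simple module, and the task is to compute that commutant.

If λ is real on the real form, even elements act by real scalars and the odd ones generate a real
Clifford algebra with p squares +1 and q squares −1. Three facts give the answer modulo 8
(`IsClifford.hasCommutant`). Generators a, b with a² = 1 and b² = −1 can be removed: ab is an even
involution commuting with all other generators, a exchanges its eigenspaces, and the other
generators act on the fixed space with the same commutant (`IsReduction.isGradedSimple`,
`IsReduction.hasCommutant`). Four generators of equal square change sign when multiplied by their
volume element (`IsClifford.flip`), which shifts q − p by 8. What remains is at most four generators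
of one sign. Up to three of them generate the opposite of a division superalgebra B; V is then a
free right B-module on one homogeneous vector and the commutant is B acting from the left
(`IsGradedSimple.hasCommutant`). Four reduce to the quaternions through their volume element.

If λ is not real on the real form, some even element of the real form acts by a nonreal scalar, so
multiplication by i lies in the real algebra generated by the action (`imaginaryUnit_mem_adjoin`).
Hence `W` stays irreducible and `V` is isomorphic to it. The generated algebra is a complex Clifford
algebra on rank(B_λ) generators, and these are removed two at a time with the involution iab
(`IsComplexClifford.hasCommutant`), so only the parity of the rank survives.

That `V` exists (`exists_isPhi`) is the usual argument: a proper nonzero real submodule U of `W`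
satisfies W = U ⊕ iU. -/

/-- The set `S` of operators on the space `V` with parity operator `γ` has no invariant graded
subspaces other than `0` and `V`, and `V ≠ 0`. -/
structure IsGradedSimple (γ : End ℝ V) (S : Set (End ℝ V)) : Prop where
  nontrivial : Nontrivial V
  eq_bot_or_eq_top : ∀ U : Submodule ℝ V, (∀ v ∈ U, γ v ∈ U) →
    (∀ s ∈ S, ∀ v ∈ U, s v ∈ U) → U = ⊥ ∨ U = ⊤

/-- The commutant of `S`, graded by means of the parity operator `γ`, is isomorphic to `B`. -/
def HasCommutant (γ : End ℝ V) (S : Set (End ℝ V)) (B : Superalgebra ℝ) : Prop :=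
  ∃ f : B.carrier →ₐ[ℝ] End ℝ V, Function.Injective f ∧
    (∀ T : End ℝ V, (∀ s ∈ S, s * T = T * s) ↔ ∃ b, f b = T) ∧
    (∀ b ∈ B.grading 0, γ * f b = f b * γ) ∧ (∀ b ∈ B.grading 1, γ * f b = -(f b * γ))

theorem apply_mem_of_mem_adjoin {S : Set (End ℝ V)} {U : Submodule ℝ V}
    (h : ∀ s ∈ S, ∀ v ∈ U, s v ∈ U) {t : End ℝ V} (ht : t ∈ Algebra.adjoin ℝ S) :
    ∀ v ∈ U, t v ∈ U := by
  induction ht using Algebra.adjoin_induction with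
  | mem x hx => exact h x hx
  | algebraMap r => exact fun v hv => by simpa using U.smul_mem r hv
  | add x y _ _ hx hy => exact fun v hv => U.add_mem (hx v hv) (hy v hv)
  | mul x y _ _ hx hy => exact fun v hv => hx _ (hy v hv)

theorem mul_comm_of_mem_adjoin {A : Type*} [Ring A] [Algebra ℝ A] {S : Set A} {T : A}
    (h : ∀ s ∈ S, s * T = T * s) {t : A} (ht : t ∈ Algebra.adjoin ℝ S) : t * T = T * t := by
  have hle : Algebra.adjoin ℝ S ≤ Subalgebra.centralizer ℝ {T} := by
    refine Algebra.adjoin_le fun s hs => ?_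
    rw [SetLike.mem_coe, Subalgebra.mem_centralizer_iff]
    rintro _ rfl
    exact (h s hs).symm
  exact ((Subalgebra.mem_centralizer_iff ℝ).1 (hle ht) T rfl).symm

/-- Only the algebra generated by the operators matters, here and in `HasCommutant.congr_adjoin`, so
generating sets can be exchanged freely later. -/
theorem IsGradedSimple.of_subset_adjoin {γ : End ℝ V} {S S' : Set (End ℝ V)}
    (h : IsGradedSimple γ S) (hS : ∀ s ∈ S, s ∈ Algebra.adjoin ℝ S') : IsGradedSimple γ S' :=
  ⟨h.nontrivial, fun U hγ hU => h.eq_bot_or_eq_top U hγ fun s hs =>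
    apply_mem_of_mem_adjoin hU (hS s hs)⟩

theorem HasCommutant.congr_adjoin {γ : End ℝ V} {S S' : Set (End ℝ V)} {B : Superalgebra ℝ}
    (h : HasCommutant γ S B) (hS : ∀ s ∈ S, s ∈ Algebra.adjoin ℝ S')
    (hS' : ∀ s ∈ S', s ∈ Algebra.adjoin ℝ S) : HasCommutant γ S' B := by
  obtain ⟨f, hf, hT, h0, h1⟩ := h
  refine ⟨f, hf, fun T => ?_, h0, h1⟩
  rw [← hT T]
  exact ⟨fun h s hs => mul_comm_of_mem_adjoin h (hS s hs),
    fun h s hs => mul_comm_of_mem_adjoin h (hS' s hs)⟩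

/-- A superalgebra whose nonzero homogeneous elements are invertible and whose opposite acts with
image the algebra generated by a graded simple set `S` is the commutant of `S`. -/
theorem IsGradedSimple.hasCommutant {γ : End ℝ V} (hγ : γ * γ = 1) {S : Set (End ℝ V)}
    (hS : IsGradedSimple γ S) (B : Superalgebra ℝ)
    (hB : ∀ i, ∀ b ∈ B.grading i, b ≠ 0 → ∃ c, b * c = 1)
    (ψ : B.carrier →ₐ[ℝ] (End ℝ V)ᵐᵒᵖ)
    (h0 : ∀ b ∈ B.grading 0, γ * (ψ b).unop = (ψ b).unop * γ)
    (h1 : ∀ b ∈ B.grading 1, γ * (ψ b).unop = -((ψ b).unop * γ))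
    (hSψ : ∀ s ∈ S, ∃ b, (ψ b).unop = s)
    (hψS : ∀ b, (ψ b).unop ∈ Algebra.adjoin ℝ S) : HasCommutant γ S B := by
  have hγγ : ∀ v, γ (γ v) = v := LinearMap.congr_fun hγ
  have hdec : ∀ b : B.carrier, ∃ b₀ ∈ B.grading 0, ∃ b₁ ∈ B.grading 1, b₀ + b₁ = b := fun b =>
    Submodule.mem_sup.1 (B.isCompl.sup_eq_top ▸ Submodule.mem_top)
  have h0' : ∀ b ∈ B.grading 0, ∀ w, γ ((ψ b).unop w) = (ψ b).unop (γ w) := fun b hb w =>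
    LinearMap.congr_fun (h0 b hb) w
  have h1' : ∀ b ∈ B.grading 1, ∀ w, γ ((ψ b).unop w) = -(ψ b).unop (γ w) := fun b hb w =>
    LinearMap.congr_fun (h1 b hb) w
  -- A nonzero homogeneous vector: an arbitrary `w` if it is even, otherwise twice its odd
  -- component.
  obtain ⟨v, hv0, r, hr⟩ : ∃ v, v ≠ 0 ∧ ∃ r : ℝ, γ v = r • v := by
    obtain ⟨w, hw⟩ := (nontrivial_iff_exists_ne (0 : V)).1 hS.nontrivial
    by_cases h : γ w = w
    · exact ⟨w, hw, 1, by simp [h]⟩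
    · exact ⟨w - γ w, fun h' => h (sub_eq_zero.1 h').symm, -1, by simp [hγγ]⟩
  have hrr : r * r = 1 := by
    have h := hγγ v
    rw [hr, map_smul, hr, smul_smul] at h
    have h2 : (r * r - 1) • v = 0 := by rw [sub_smul, h, one_smul, sub_self]
    exact sub_eq_zero.1 ((smul_eq_zero.1 h2).resolve_right hv0)
  -- The orbit map of `v`. As `ψ` lands in the opposite algebra, B acts from the right and `φ (b *
  -- c)` is `φ b` acted on by `c`.
  let φ : B.carrier →ₗ[ℝ] V :=
    { toFun := fun b => (ψ b).unop v
      map_add' := fun b c => by simp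
      map_smul' := fun c b => by simp }
  have hφ : ∀ b, φ b = (ψ b).unop v := fun _ => rfl
  have hφmul : ∀ b c, φ (b * c) = (ψ c).unop (φ b) := fun b c => by simp [hφ]
  have hφ0 : ∀ b ∈ B.grading 0, γ (φ b) = r • φ b := fun b hb => by
    rw [hφ, h0' b hb, hr, map_smul]
  have hφ1 : ∀ b ∈ B.grading 1, γ (φ b) = -(r • φ b) := fun b hb => by
    rw [hφ, h1' b hb, hr, map_smul]
  have hhom : ∀ i, ∀ b ∈ B.grading i, φ b = 0 → b = 0 := by
    intro i b hb hb0
    by_contra hne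
    obtain ⟨c, hc⟩ := hB i b hb hne
    have := hφmul b c
    rw [hc, hb0, map_zero, hφ, map_one] at this
    exact hv0 this
  have hinj : Function.Injective φ := by
    rw [← LinearMap.ker_eq_bot, LinearMap.ker_eq_bot']
    intro b hb
    obtain ⟨b₀, hb₀, b₁, hb₁, rfl⟩ := hdec b
    rw [map_add] at hb
    -- The parity operator turns the sum of the two homogeneous parts into their difference up to
    -- the sign `r`, so both parts die separately.
    have e := congrArg γ hb
    rw [map_add, hφ0 _ hb₀, hφ1 _ hb₁, map_zero, ← sub_eq_add_neg, ← smul_sub] at e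
    have e' := congrArg (r • ·) e
    simp only [smul_smul, hrr, one_smul, smul_zero] at e'
    have e0 : φ b₀ = 0 := by
      have : (2 : ℝ) • φ b₀ = 0 := by
        rw [two_smul]; nth_rw 2 [sub_eq_zero.1 e']; exact hb
      simpa using this
    have e1 : φ b₁ = 0 := by rw [sub_eq_zero.1 e'] at e0; exact e0
    rw [hhom 0 b₀ hb₀ e0, hhom 1 b₁ hb₁ e1, add_zero]
  have hsurj : Function.Surjective φ := by
    rw [← LinearMap.range_eq_top]
    refine (hS.eq_bot_or_eq_top (LinearMap.range φ) ?_ ?_).resolve_left fun h => ?_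
    · rintro _ ⟨b, rfl⟩
      obtain ⟨b₀, hb₀, b₁, hb₁, rfl⟩ := hdec b
      exact ⟨r • b₀ - r • b₁, by simp [hφ0 _ hb₀, hφ1 _ hb₁, sub_eq_add_neg]⟩
    · rintro s hs _ ⟨b, rfl⟩
      obtain ⟨c, rfl⟩ := hSψ s hs
      exact ⟨b * c, hφmul b c⟩
    · have : φ 1 ∈ (⊥ : Submodule ℝ V) := h ▸ LinearMap.mem_range_self φ 1
      exact hv0 (by simpa [hφ] using this)
  let e : B.carrier ≃ₗ[ℝ] V := LinearEquiv.ofBijective φ ⟨hinj, hsurj⟩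
  have he : ∀ b, e b = φ b := fun _ => rfl
  -- Left multiplications of B, carried to `V` along the orbit map; they commute with the right
  -- action by associativity.
  let f : B.carrier →ₐ[ℝ] End ℝ V :=
    AlgHom.ofLinearMap (e.conj.toLinearMap ∘ₗ (LinearMap.mul ℝ B.carrier))
      (by ext w; simp [LinearEquiv.conj_apply]) (fun b c => by
        ext w; simp [LinearEquiv.conj_apply, mul_assoc])
  have hf : ∀ b x, f b (φ x) = φ (b * x) := fun b x => by
    rw [← he, ← he]; simp [f, LinearEquiv.conj_apply]
  refine ⟨f, fun b c hbc => ?_, fun T => ⟨fun hT => ?_, ?_⟩, fun b hb => ?_, fun b hb => ?_⟩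
  · have h := LinearMap.congr_fun hbc (φ 1)
    rw [hf, hf, mul_one, mul_one] at h
    exact hinj h
  -- `v` generates `V`, so an operator of the commutant is determined by its value at `v`.
  · obtain ⟨b, hb⟩ := hsurj (T v)
    refine ⟨b, LinearMap.ext fun w => ?_⟩
    obtain ⟨x, rfl⟩ := hsurj w
    have h := LinearMap.congr_fun (mul_comm_of_mem_adjoin hT (hψS x)) v
    simp only [Module.End.mul_apply] at h
    rw [hf, hφmul, hb, h, hφ]
  · rintro ⟨b, rfl⟩ s hs
    obtain ⟨c, rfl⟩ := hSψ s hs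
    ext w
    obtain ⟨x, rfl⟩ := hsurj w
    rw [Module.End.mul_apply, Module.End.mul_apply, hf, ← hφmul, ← hφmul, hf, mul_assoc]
  · ext w
    obtain ⟨x, rfl⟩ := hsurj w
    obtain ⟨x₀, hx₀, x₁, hx₁, rfl⟩ := hdec x
    have m0 : b * x₀ ∈ B.grading 0 := B.mul_mem 0 0 _ _ hb hx₀
    have m1 : b * x₁ ∈ B.grading 1 := B.mul_mem 0 1 _ _ hb hx₁
    simp [hf, hφ0 _ hx₀, hφ1 _ hx₁, hφ0 _ m0, hφ1 _ m1]
  · ext w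
    obtain ⟨x, rfl⟩ := hsurj w
    obtain ⟨x₀, hx₀, x₁, hx₁, rfl⟩ := hdec x
    have m0 : b * x₀ ∈ B.grading 1 := B.mul_mem 1 0 _ _ hb hx₀
    have m1 : b * x₁ ∈ B.grading 0 := B.mul_mem 1 1 _ _ hb hx₁
    simp [hf, hφ0 _ hx₀, hφ1 _ hx₁, hφ0 _ m1, hφ1 _ m0, add_comm]

/-! ### Reduction to an eigenspace -/

/-- The fixed space of `ω`. -/
abbrev Fixed (ω : End ℝ V) : Submodule ℝ V := LinearMap.eqLocus ω 1

/-- The projection to the fixed space of an involution. -/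
noncomputable def proj (ω : End ℝ V) (hω : ω * ω = 1) : V →ₗ[ℝ] Fixed ω :=
  ((1 / 2 : ℝ) • (1 + ω)).codRestrict _ fun v => by
    have h : ω (ω v) = v := LinearMap.congr_fun hω v
    simp [h, add_comm]

/-- The compression of an operator to the fixed space of an involution. -/
noncomputable def corner (ω : End ℝ V) (hω : ω * ω = 1) (s : End ℝ V) : End ℝ (Fixed ω) :=
  proj ω hω ∘ₗ s ∘ₗ (Fixed ω).subtype

variable {ω : End ℝ V} {hω : ω * ω = 1}

theorem coe_proj (v : V) : (proj ω hω v : V) = (1 / 2 : ℝ) • (v + ω v) := by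
  simp [proj]

theorem Fixed.apply (v : Fixed ω) : ω (v : V) = v := v.2

/-- An operator commuting with `ω` preserves the fixed space, so its compression is simply its
restriction; this is what makes compression multiplicative on such operators. -/
theorem coe_corner {s : End ℝ V} (hs : s * ω = ω * s) (v : Fixed ω) :
    (corner ω hω s v : V) = s v := by
  have h : s (ω v) = ω (s v) := LinearMap.congr_fun hs (v : V)
  rw [Fixed.apply] at h
  change (proj ω hω (s v) : V) = _
  rw [coe_proj, ← h, ← two_smul ℝ, smul_smul]
  norm_num

theorem corner_mul {s t : End ℝ V} (hs : s * ω = ω * s) (ht : t * ω = ω * t) :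
    corner ω hω (s * t) = corner ω hω s * corner ω hω t := by
  have hst : s * t * ω = ω * (s * t) := by rw [mul_assoc, ht, ← mul_assoc, hs, mul_assoc]
  ext v
  rw [Module.End.mul_apply, coe_corner hst, coe_corner hs, coe_corner ht, Module.End.mul_apply]

theorem corner_one : corner ω hω 1 = 1 := by
  ext v
  rw [coe_corner (by simp)]
  simp

theorem corner_neg (s : End ℝ V) : corner ω hω (-s) = -corner ω hω s := by
  ext v; simp [corner]

theorem corner_smul (c : ℝ) (s : End ℝ V) : corner ω hω (c • s) = c • corner ω hω s := by
  ext v; simp [corner]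

/-- Auxiliary data for the reduction to the fixed space of `ω`: an even involution `ω`, an odd
operator `u` with `u² = c = ±1` which anticommutes with `ω`, and operators which commute with `ω`
and which commute or anticommute with `u`. -/
structure IsReduction (γ ω u : End ℝ V) (c : ℝ) (S : Set (End ℝ V)) : Prop where
  sq_parity : γ * γ = 1
  sq_omega : ω * ω = 1
  parity_omega : γ * ω = ω * γ
  parity_u : γ * u = -(u * γ)
  c_mul_c : c * c = 1
  u_mul_u : u * u = c • 1
  u_omega : u * ω = -(ω * u)
  mul_omega : ∀ s ∈ S, s * ω = ω * s
  mul_u : ∀ s ∈ S, s * u = u * s ∨ s * u = -(u * s)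

namespace IsReduction

variable {γ u : End ℝ V} {c : ℝ} {S : Set (End ℝ V)}

/-- Since `u` anticommutes with `ω` and is invertible, it maps the fixed space onto the −1
eigenspace. Thus `V` consists of two copies of the fixed space, with unique coordinates by
`decomp_unique`. -/
theorem decomp (h : IsReduction γ ω u c S) (v : V) :
    ∃ x y : Fixed ω, v = x + u y := by
  have huu : ∀ v, u (u v) = c • v := fun v => by
    simpa using LinearMap.congr_fun h.u_mul_u v
  have hωω : ∀ v, ω (ω v) = v := LinearMap.congr_fun h.sq_omega
  have huω : ∀ v, u (ω v) = -ω (u v) := LinearMap.congr_fun h.u_omega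
  -- The −1 component of `v` is (v − ωv)/2; its preimage under `u` is obtained by applying `c • u`,
  -- because u² = c and c² = 1.
  refine ⟨proj ω h.sq_omega v, ⟨(c / 2) • u (v - ω v), ?_⟩, ?_⟩
  · change ω _ = _
    simp only [map_smul, map_sub, huω, map_neg, hωω, Module.End.one_apply]
    module
  · simp only [coe_proj, map_smul, huu, smul_smul, div_mul_eq_mul_div, h.c_mul_c]
    module

theorem decomp_unique (h : IsReduction γ ω u c S) {x y x' y' : Fixed ω}
    (e : (x : V) + u y = x' + u y') : x = x' ∧ y = y' := by
  have huu : ∀ v, u (u v) = c • v := fun v => by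
    simpa using LinearMap.congr_fun h.u_mul_u v
  have huω : ∀ v : Fixed ω, ω (u v) = -u v := fun v => by
    have := LinearMap.congr_fun h.u_omega (v : V)
    simp only [Module.End.mul_apply, LinearMap.neg_apply, Fixed.apply] at this
    rw [← neg_eq_iff_eq_neg] at this
    exact this.symm
  have e' := congrArg ω e
  simp only [map_add, huω, Fixed.apply] at e'
  have e1 : (2 : ℝ) • (x : V) = (2 : ℝ) • (x' : V) := by
    calc (2 : ℝ) • (x : V) = (x + u y) + (x + -u y) := by module
      _ = (x' + u y') + (x' + -u y') := by rw [e, e']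
      _ = (2 : ℝ) • (x' : V) := by module
  have e2 : (x : V) = x' := smul_right_injective V (two_ne_zero) e1
  rw [e2, add_right_inj] at e
  have e3 := congrArg (fun w => c • u w) e
  simp only [huu, smul_smul, h.c_mul_c, one_smul] at e3
  exact ⟨Subtype.ext e2, Subtype.ext e3⟩

/-- An invariant graded subspace U of the fixed space generates the invariant graded subspace U ⊕ uU
of `V`, which is zero or everything only if U is. -/
theorem isGradedSimple (h : IsReduction γ ω u c S) (hS : IsGradedSimple γ (S ∪ {ω, u})) :
    IsGradedSimple (corner ω h.sq_omega γ) (corner ω h.sq_omega '' S) := by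
  have huu : ∀ v, u (u v) = c • v := fun v => by
    simpa using LinearMap.congr_fun h.u_mul_u v
  have huω : ∀ v : Fixed ω, ω (u v) = -u v := fun v => by
    have := LinearMap.congr_fun h.u_omega (v : V)
    simp only [Module.End.mul_apply, LinearMap.neg_apply, Fixed.apply] at this
    rw [← neg_eq_iff_eq_neg] at this
    exact this.symm
  have hγu : ∀ v, γ (u v) = -u (γ v) := LinearMap.congr_fun h.parity_u
  refine ⟨?_, fun U hγU hSU => ?_⟩
  · by_contra hn
    rw [not_nontrivial_iff_subsingleton] at hn
    obtain ⟨v, hv⟩ := (nontrivial_iff_exists_ne (0 : V)).1 hS.nontrivial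
    obtain ⟨x, y, rfl⟩ := h.decomp v
    exact hv (by simp [Subsingleton.elim x 0, Subsingleton.elim y 0])
  · let U' : Submodule ℝ V := U.map (Fixed ω).subtype ⊔ (U.map (Fixed ω).subtype).map u
    have hU' : ∀ v, v ∈ U' ↔ ∃ x ∈ U, ∃ y ∈ U, (x : V) + u y = v := fun v => by
      simp only [U', Submodule.mem_sup, Submodule.mem_map]
      constructor
      · rintro ⟨_, ⟨x, hx, rfl⟩, _, ⟨_, ⟨y, hy, rfl⟩, rfl⟩, rfl⟩
        exact ⟨x, hx, y, hy, rfl⟩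
      · rintro ⟨x, hx, y, hy, rfl⟩
        exact ⟨_, ⟨x, hx, rfl⟩, _, ⟨_, ⟨y, hy, rfl⟩, rfl⟩, rfl⟩
    have key : U' = ⊥ ∨ U' = ⊤ := by
      refine hS.eq_bot_or_eq_top U' (fun v hv => ?_) fun s hs v hv => ?_
      · obtain ⟨x, hx, y, hy, rfl⟩ := (hU' v).1 hv
        refine (hU' _).2 ⟨_, hγU x hx, -_, neg_mem (hγU y hy), ?_⟩
        simp [coe_corner h.parity_omega, hγu]
      · obtain ⟨x, hx, y, hy, rfl⟩ := (hU' v).1 hv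
        rcases hs with hs | rfl | rfl
        · have h1 := hSU _ ⟨s, hs, rfl⟩ x hx
          have h2 := hSU _ ⟨s, hs, rfl⟩ y hy
          rcases h.mul_u s hs with e | e
          · refine (hU' _).2 ⟨_, h1, _, h2, ?_⟩
            have e' : s (u y) = u (s y) := LinearMap.congr_fun e y
            simp [coe_corner (h.mul_omega s hs), e']
          · refine (hU' _).2 ⟨_, h1, -_, neg_mem h2, ?_⟩
            have e' : s (u y) = -u (s y) := LinearMap.congr_fun e y
            simp [coe_corner (h.mul_omega s hs), e']
        · exact (hU' _).2 ⟨x, hx, -y, neg_mem hy, by simp [huω, Fixed.apply]⟩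
        · exact (hU' _).2 ⟨c • y, U.smul_mem c hy, x, hx, by simp [huu, add_comm]⟩
    refine key.imp (fun e => ?_) fun e => ?_
    · rw [eq_bot_iff]
      intro x hx
      have : (x : V) ∈ U' := (hU' _).2 ⟨x, hx, 0, zero_mem _, by simp⟩
      rw [e] at this
      simpa using this
    · rw [eq_top_iff]
      intro x _
      obtain ⟨x', hx', y, hy, e'⟩ := (hU' (x : V)).1 (e ▸ Submodule.mem_top)
      have : x' = x := (h.decomp_unique (y' := 0) (by simpa using e')).1
      exact this ▸ hx'

/-- An operator commuting with `ω` and `u` acts in the same way on both copies of the fixed space,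
so restriction identifies the two commutants. The inverse sends T to x + uy ↦ Tx + uTy. -/
theorem hasCommutant (h : IsReduction γ ω u c S) {B : Superalgebra ℝ}
    (hB : HasCommutant (corner ω h.sq_omega γ) (corner ω h.sq_omega '' S) B) :
    HasCommutant γ (S ∪ {ω, u}) B := by
  have huu : ∀ v, u (u v) = c • v := fun v => by
    simpa using LinearMap.congr_fun h.u_mul_u v
  have huω : ∀ v, u (ω v) = -ω (u v) := LinearMap.congr_fun h.u_omega
  have huω' : ∀ v : Fixed ω, ω (u v) = -u v := fun v => by
    have := huω v
    rw [Fixed.apply, ← neg_eq_iff_eq_neg] at this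
    exact this.symm
  have hγu : ∀ v, γ (u v) = -u (γ v) := LinearMap.congr_fun h.parity_u
  let p : V →ₗ[ℝ] Fixed ω := proj ω h.sq_omega
  -- The operator `c • u` interchanges the two summands, so `p` reads off x and `q` reads off y in x
  -- + uy.
  let q : V →ₗ[ℝ] Fixed ω := p ∘ₗ (c • u)
  have hp : ∀ x y : Fixed ω, p (x + u y) = x := fun x y => by
    refine Subtype.ext ?_
    change (proj ω h.sq_omega _ : V) = _
    rw [coe_proj]
    simp only [map_add, huω', Fixed.apply]
    module
  have hq : ∀ x y : Fixed ω, q (x + u y) = y := fun x y => by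
    have : (c • u) ((x : V) + u y) = y + u (c • x) := by
      simp [huu, smul_smul, h.c_mul_c, add_comm]
    change p ((c • u) ((x : V) + u y)) = y
    rw [this]
    exact hp y (c • x)
  let g : End ℝ (Fixed ω) →ₗ[ℝ] End ℝ V :=
    { toFun := fun T => (Fixed ω).subtype ∘ₗ T ∘ₗ p + u ∘ₗ (Fixed ω).subtype ∘ₗ T ∘ₗ q
      map_add' := fun S T => by ext v; simp; abel
      map_smul' := fun r T => by ext v; simp }
  have hg : ∀ T (x y : Fixed ω), g T ((x : V) + u y) = T x + u (T y) := fun T x y => by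
    change ((T (p _) : Fixed ω) : V) + u ((T (q _) : Fixed ω) : V) = _
    rw [hp, hq]
  have ext' : ∀ S T : End ℝ V, (∀ x y : Fixed ω, S (x + u y) = T (x + u y)) → S = T :=
    fun S T hST => LinearMap.ext fun v => by
      obtain ⟨x, y, rfl⟩ := h.decomp v
      exact hST x y
  let G : End ℝ (Fixed ω) →ₐ[ℝ] End ℝ V := AlgHom.ofLinearMap g
    (ext' _ _ fun x y => by rw [hg]; simp)
    (fun S T => ext' _ _ fun x y => by
      rw [Module.End.mul_apply, hg, hg, hg]; simp)
  have hG : ∀ T (x y : Fixed ω), G T ((x : V) + u y) = T x + u (T y) := hg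
  have hG0 : ∀ T (x : Fixed ω), G T x = T x := fun T x => by simpa using hG T x 0
  have hG1 : ∀ T (x : Fixed ω), G T (u x) = u (T x) := fun T x => by simpa using hG T 0 x
  obtain ⟨f, hf, hT, h0, h1⟩ := hB
  refine ⟨G.comp f, fun b b' e => hf ?_, fun T => ⟨fun hS => ?_, ?_⟩, fun b hb => ?_,
    fun b hb => ?_⟩
  · ext x
    rw [← hG0, ← hG0]
    exact LinearMap.congr_fun e (x : V)
  · have hTω : T * ω = ω * T := (hS ω (by simp)).symm
    have hTu : ∀ v, u (T v) = T (u v) := LinearMap.congr_fun (hS u (by simp))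
    obtain ⟨b, hb⟩ := (hT (corner ω h.sq_omega T)).1 (by
      rintro _ ⟨s, hs, rfl⟩
      rw [← corner_mul (h.mul_omega s hs) hTω, ← corner_mul hTω (h.mul_omega s hs),
        hS s (Or.inl hs)])
    refine ⟨b, ext' _ _ fun x y => ?_⟩
    rw [AlgHom.comp_apply, hG, hb, coe_corner hTω, coe_corner hTω, hTu, map_add]
  -- An operator of `S` that anticommutes with `u` also commutes with the extension: the sign
  -- appears on the second copy on both sides.
  · rintro ⟨b, rfl⟩ s hs
    refine ext' _ _ fun x y => ?_
    rw [AlgHom.comp_apply]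
    simp only [Module.End.mul_apply, map_add, hG0, hG1]
    rcases hs with hs | rfl | rfl
    · have hb := (hT (f b)).2 ⟨b, rfl⟩ _ ⟨s, hs, rfl⟩
      have hb' : ∀ x : Fixed ω, s (f b x) = (f b (corner ω h.sq_omega s x) : V) := fun x => by
        rw [← coe_corner (hω := h.sq_omega) (h.mul_omega s hs)]
        exact congrArg Subtype.val (LinearMap.congr_fun hb x)
      have hs' : ∀ x : Fixed ω, s x = (corner ω h.sq_omega s x : V) := fun x =>
        (coe_corner (h.mul_omega s hs) x).symm
      rcases h.mul_u s hs with e | e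
      · have e' : ∀ v, s (u v) = u (s v) := LinearMap.congr_fun e
        simp only [e', hb', hs', hG0, hG1]
      · have e' : ∀ v, s (u v) = -u (s v) := LinearMap.congr_fun e
        simp only [e', hb', hs', hG0, hG1, map_neg]
    · simp [Fixed.apply, huω', hG0, hG1]
    · simp [huu, hG0, hG1]
  · refine ext' _ _ fun x y => ?_
    have hb' : ∀ x : Fixed ω, γ (f b x) = (f b (corner ω h.sq_omega γ x) : V) := fun x => by
      rw [← coe_corner (hω := h.sq_omega) h.parity_omega]
      exact congrArg Subtype.val (LinearMap.congr_fun (h0 b hb) x)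
    have hs' : ∀ x : Fixed ω, γ x = (corner ω h.sq_omega γ x : V) := fun x =>
      (coe_corner h.parity_omega x).symm
    simp only [AlgHom.comp_apply, Module.End.mul_apply, map_add, hG0, hG1, hγu, hb', hs', map_neg]
  · refine ext' _ _ fun x y => ?_
    have hb' : ∀ x : Fixed ω, γ (f b x) = -(f b (corner ω h.sq_omega γ x) : V) := fun x => by
      rw [← coe_corner (hω := h.sq_omega) h.parity_omega]
      exact congrArg Subtype.val (LinearMap.congr_fun (h1 b hb) x)
    have hs' : ∀ x : Fixed ω, γ x = (corner ω h.sq_omega γ x : V) := fun x =>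
      (coe_corner h.parity_omega x).symm
    simp only [AlgHom.comp_apply, Module.End.mul_apply, LinearMap.neg_apply, map_add, hG0, hG1,
      hγu, hb', hs', map_neg]

end IsReduction

end GradedOperators

/-! ### Division superalgebras as commutants -/

namespace Superalgebra.AdjoinOdd

variable {D : Type} [Ring D] [Algebra ℝ D] {σ : {σ : D ≃ₐ[ℝ] D // ∀ a, σ (σ a) = a}} {ε : ℝ}
variable {E : Type*} [Ring E] [Algebra ℝ E]

/-- The universal property of `D ⊕ Dι`. -/
def lift (f : D →ₐ[ℝ] E) (u : E) (hu : u * u = ε • 1)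
    (h : ∀ a, u * f a = f (σ.1 a) * u) : AdjoinOdd σ ε →ₐ[ℝ] E :=
  AlgHom.ofLinearMap
    { toFun := fun x => f x.fst + f x.snd * u
      map_add' := fun x y => by simp [add_mul]; abel
      map_smul' := fun c x => by simp }
    (by simp)
    (fun x y => by
      have e1 : f x.snd * u * f y.fst = f x.snd * f (σ.1 y.fst) * u := by
        rw [mul_assoc, h, mul_assoc]
      have e2 : f x.snd * u * f y.snd * u = ε • (f x.snd * f (σ.1 y.snd)) := by
        rw [mul_assoc (f x.snd), h, mul_assoc, mul_assoc, hu]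
        simp
      simp only [LinearMap.coe_mk, AddHom.coe_mk, mul_fst, mul_snd, map_add, map_mul, map_smul,
        add_mul, mul_add, ← mul_assoc, e1, e2]
      abel)

end Superalgebra.AdjoinOdd

namespace GradedOperators

open Superalgebra Quaternion

variable {V : Type*} [AddCommGroup V] [Module ℝ V]

section Opposite

variable {E : Type*} [Ring E] [Algebra ℝ E]

/-- The action of the complex numbers determined by an operator of square `-1`. -/
noncomputable def complexAction (I : E) (hI : I * I = -1) : ℂ →ₐ[ℝ] Eᵐᵒᵖ :=
  Complex.liftAux (MulOpposite.op I) (by rw [← MulOpposite.op_mul, hI]; rfl)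

theorem unop_complexAction (I : E) (hI : I * I = -1) (z : ℂ) :
    (complexAction I hI z).unop = z.re • 1 + z.im • I := by
  simp [complexAction, Complex.liftAux_apply, Algebra.algebraMap_eq_smul_one]

/-- The right action of the quaternions determined by anticommuting operators of square `-1`. -/
noncomputable def quaternionAction (I J : E) (hI : I * I = -1) (hJ : J * J = -1)
    (hIJ : I * J = -(J * I)) : ℍ[ℝ] →ₐ[ℝ] Eᵐᵒᵖ :=
  QuaternionAlgebra.Basis.liftHom
    { i := MulOpposite.op I
      j := MulOpposite.op J
      -- The order is reversed because k = ij is computed in the opposite algebra.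
      k := MulOpposite.op (J * I)
      i_mul_i := by rw [← MulOpposite.op_mul, hI]; simp
      j_mul_j := by rw [← MulOpposite.op_mul, hJ]; simp
      i_mul_j := by rw [← MulOpposite.op_mul]
      j_mul_i := by rw [← MulOpposite.op_mul, hIJ]; simp }

theorem unop_quaternionAction (I J : E) (hI : I * I = -1) (hJ : J * J = -1)
    (hIJ : I * J = -(J * I)) (z : ℍ[ℝ]) :
    (quaternionAction I J hI hJ hIJ z).unop =
      z.re • 1 + z.imI • I + z.imJ • J + z.imK • (J * I) := by
  change (algebraMap ℝ Eᵐᵒᵖ z.re + z.imI • MulOpposite.op I + z.imJ • MulOpposite.op J +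
    z.imK • MulOpposite.op (J * I)).unop = _
  simp [Algebra.algebraMap_eq_smul_one]

end Opposite

/-! ### Clifford algebras that are themselves division superalgebras. -/

variable {γ : End ℝ V} {S : Set (End ℝ V)}

/-- Hypothesis `hSf` says that `S` lies in the image of `f`, phrased through all subalgebras
containing that image so that applications need only closure properties. -/
theorem IsGradedSimple.hasCommutant_ofEven (hγ : γ * γ = 1) (hS : IsGradedSimple γ S) (D : Type)
    [DivisionRing D] [Algebra ℝ D] (f : D →ₐ[ℝ] (End ℝ V)ᵐᵒᵖ)
    (hf : ∀ a, γ * (f a).unop = (f a).unop * γ)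
    (hSf : ∀ s ∈ S, ∀ K : Subalgebra ℝ (End ℝ V), (∀ a, (f a).unop ∈ K) → s ∈ K)
    (hfS : ∀ a, (f a).unop ∈ Algebra.adjoin ℝ S) : HasCommutant γ S (ofEven D) := by
  refine hS.hasCommutant hγ (ofEven D) ?_ f (fun b _ => hf b) ?_ ?_ hfS
  · intro i b _ hb
    exact ⟨(b⁻¹ : D), mul_inv_cancel₀ (G₀ := D) hb⟩
  · intro (b : D) hb
    obtain rfl : b = 0 := (Submodule.mem_bot ℝ (M := D)).1 hb
    change γ * (f (0 : D)).unop = -((f (0 : D)).unop * γ)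
    simp
  · intro s hs
    obtain ⟨b, hb⟩ := hSf s hs f.range.unop fun a => ⟨a, rfl⟩
    exact ⟨b, congrArg MulOpposite.unop hb⟩

/-- The operator `u` plays the part of ι. The relation `hfu` is ιa = σ(a)ι with its factors
reversed, as the action is from the right. -/
theorem IsGradedSimple.hasCommutant_adjoinOdd (hγ : γ * γ = 1) (hS : IsGradedSimple γ S) {D : Type}
    [DivisionRing D] [Algebra ℝ D] (σ : {σ : D ≃ₐ[ℝ] D // ∀ a, σ (σ a) = a}) {ε : ℝ} (hε : ε ≠ 0)
    (f : D →ₐ[ℝ] (End ℝ V)ᵐᵒᵖ) (u : End ℝ V) (hu : u * u = ε • 1)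
    (hfu : ∀ a, (f a).unop * u = u * (f (σ.1 a)).unop)
    (hf : ∀ a, γ * (f a).unop = (f a).unop * γ) (hγu : γ * u = -(u * γ))
    (hSf : ∀ s ∈ S, ∀ K : Subalgebra ℝ (End ℝ V), u ∈ K → (∀ a, (f a).unop ∈ K) → s ∈ K)
    (huS : u ∈ Algebra.adjoin ℝ S) (hfS : ∀ a, (f a).unop ∈ Algebra.adjoin ℝ S) :
    HasCommutant γ S (adjoinOdd σ ε) := by
  let ψ : AdjoinOdd σ ε →ₐ[ℝ] (End ℝ V)ᵐᵒᵖ := AdjoinOdd.lift f (MulOpposite.op u)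
    (by rw [← MulOpposite.op_mul, hu]; simp)
    (fun a => by
      apply MulOpposite.unop_injective
      simpa using hfu a)
  have hψ : ∀ x : AdjoinOdd σ ε, (ψ x).unop = (f x.fst).unop + u * (f x.snd).unop := fun x => rfl
  refine hS.hasCommutant hγ (adjoinOdd σ ε) ?_ ψ ?_ ?_ ?_ ?_
  · have h2 : ∀ i : ZMod 2, i = 0 ∨ i = 1 := by decide
    intro i (b : AdjoinOdd σ ε) hb hb0
    rcases h2 i with rfl | rfl
    · have hb2 : b.snd = 0 := hb.1 rfl
      have hb1 : b.fst ≠ 0 := fun h => hb0 (AdjoinOdd.ext h hb2)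
      refine ⟨(⟨b.fst⁻¹, 0⟩ : AdjoinOdd σ ε), ?_⟩
      change b * (⟨b.fst⁻¹, 0⟩ : AdjoinOdd σ ε) = (1 : AdjoinOdd σ ε)
      ext
      · simp [hb1]
      · simp [hb2]
    · have hb1 : b.fst = 0 := hb.2 rfl
      have hb2 : b.snd ≠ 0 := fun h => hb0 (AdjoinOdd.ext hb1 h)
      -- From (bι)(cι) = ε bσ(c), and since σ is an involution, the inverse of bι is cι with c =
      -- ε⁻¹σ(b⁻¹).
      refine ⟨(⟨0, ε⁻¹ • σ.1 b.snd⁻¹⟩ : AdjoinOdd σ ε), ?_⟩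
      change b * (⟨0, ε⁻¹ • σ.1 b.snd⁻¹⟩ : AdjoinOdd σ ε) = (1 : AdjoinOdd σ ε)
      ext
      · simp [hb1, σ.2, hb2, smul_smul, hε]
      · simp [hb1]
  · intro (b : AdjoinOdd σ ε) hb
    have hb2 : b.snd = 0 := hb.1 rfl
    change γ * (ψ b).unop = (ψ b).unop * γ
    rw [hψ, hb2]
    simpa using hf _
  · intro (b : AdjoinOdd σ ε) hb
    have hb1 : b.fst = 0 := hb.2 rfl
    change γ * (ψ b).unop = -((ψ b).unop * γ)
    rw [hψ, hb1]
    simp only [map_zero, MulOpposite.unop_zero, zero_add]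
    rw [← mul_assoc, hγu, neg_mul, mul_assoc, hf, mul_assoc]
  · intro s hs
    obtain ⟨b, hb⟩ := hSf s hs ψ.range.unop
      ⟨(⟨0, 1⟩ : AdjoinOdd σ ε), MulOpposite.unop_injective (by simp [hψ])⟩
      fun a => ⟨(⟨a, 0⟩ : AdjoinOdd σ ε), MulOpposite.unop_injective (by simp [hψ])⟩
    exact ⟨b, congrArg MulOpposite.unop hb⟩
  · intro (b : AdjoinOdd σ ε)
    change (ψ b).unop ∈ _
    rw [hψ]
    exact add_mem (hfS _) (mul_mem huS (hfS _))

theorem unop_complexAction_mem {I : End ℝ V} (hI : I * I = -1) {K : Subalgebra ℝ (End ℝ V)}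
    (h : I ∈ K) (a : ℂ) : (complexAction I hI a).unop ∈ K := by
  rw [unop_complexAction]
  exact add_mem (K.smul_mem (one_mem K) _) (K.smul_mem h _)

theorem unop_quaternionAction_mem {I J : End ℝ V} (hI : I * I = -1) (hJ : J * J = -1)
    (hIJ : I * J = -(J * I)) {K : Subalgebra ℝ (End ℝ V)} (h : I ∈ K) (h' : J ∈ K) (a : ℍ[ℝ]) :
    (quaternionAction I J hI hJ hIJ a).unop ∈ K := by
  rw [unop_quaternionAction]
  exact add_mem (add_mem (add_mem (K.smul_mem (one_mem K) _) (K.smul_mem h _))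
    (K.smul_mem h' _)) (K.smul_mem (mul_mem h' h) _)

/-- Together with the next two lemmas, this gives the commutation rules in right-associated form, so
that `simp` can sort words in the generators. -/
theorem mul_mul_left_of_anticomm {R : Type*} [Ring R] {a b : R} (h : a * b = -(b * a)) (x : R) :
    a * (b * x) = -(b * (a * x)) := by
  rw [← mul_assoc, h, neg_mul, mul_assoc]

theorem mul_mul_left_of_comm {R : Type*} [Ring R] {a b : R} (h : a * b = b * a) (x : R) :
    a * (b * x) = b * (a * x) := by
  rw [← mul_assoc, h, mul_assoc]

theorem mul_mul_left_of_sq {R : Type*} [Ring R] [Algebra ℝ R] {a : R} {ε : ℝ}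
    (h : a * a = ε • 1) (x : R) : a * (a * x) = ε • x := by
  rw [← mul_assoc, h, smul_mul_assoc, one_mul]

theorem IsGradedSimple.hasCommutant_empty (hγ : γ * γ = 1) (hS : IsGradedSimple γ ∅) :
    HasCommutant γ ∅ (ofEven ℝ) := by
  have h : ∀ a : ℝ, (Algebra.ofId ℝ (End ℝ V)ᵐᵒᵖ a).unop = a • 1 := fun a => by
    simp [Algebra.ofId_apply, Algebra.algebraMap_eq_smul_one]
  refine hS.hasCommutant_ofEven hγ ℝ (Algebra.ofId ℝ _) (fun a => ?_) (by simp) fun a => ?_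
  · rw [h]; simp
  · rw [h]; exact Subalgebra.smul_mem _ (one_mem _) _

theorem IsGradedSimple.hasCommutant_one (hγ : γ * γ = 1) {e : End ℝ V} {ε : ℝ} (hε : ε * ε = 1)
    (he : e * e = ε • 1) (hγe : γ * e = -(e * γ)) (hS : IsGradedSimple γ {e}) :
    HasCommutant γ {e} (adjoinOdd (trivialAut ℝ) ε) := by
  have h : ∀ a : ℝ, (Algebra.ofId ℝ (End ℝ V)ᵐᵒᵖ a).unop = a • 1 := fun a => by
    simp [Algebra.ofId_apply, Algebra.algebraMap_eq_smul_one]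
  refine hS.hasCommutant_adjoinOdd hγ (trivialAut ℝ) (left_ne_zero_of_mul_eq_one hε)
    (Algebra.ofId ℝ _) e he (fun a => ?_) (fun a => ?_) hγe ?_ (Algebra.subset_adjoin rfl)
    fun a => ?_
  · change _ = e * (Algebra.ofId ℝ (End ℝ V)ᵐᵒᵖ a).unop
    rw [h]; simp
  · rw [h]; simp
  · rintro _ rfl K hK -
    exact hK
  · rw [h]; exact Subalgebra.smul_mem _ (one_mem _) _

/-- Take i = ab and ι = a: the product ab has square −ε² = −1 and anticommutes with a, which is why
conjugation appears. -/
theorem IsGradedSimple.hasCommutant_two (hγ : γ * γ = 1) {a b : End ℝ V} {ε : ℝ} (hε : ε * ε = 1)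
    (ha : a * a = ε • 1) (hb : b * b = ε • 1) (hba : b * a = -(a * b)) (hγa : γ * a = -(a * γ))
    (hγb : γ * b = -(b * γ)) (hS : IsGradedSimple γ {a, b}) :
    HasCommutant γ {a, b} (adjoinOdd conjAut ε) := by
  have rel := fun x => mul_mul_left_of_anticomm hba x
  have rel1 := fun x => mul_mul_left_of_anticomm hγa x
  have rel2 := fun x => mul_mul_left_of_sq ha x
  have hI : (a * b) * (a * b) = -1 := by
    simp [mul_assoc, rel, ha, hb, smul_smul, hε]
  have mem : ∀ K : Subalgebra ℝ (End ℝ V), a ∈ K → a * b ∈ K → b ∈ K := fun K h1 h2 => by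
    have : b = ε • (a * (a * b)) := by rw [rel2, smul_smul, hε, one_smul]
    rw [this]
    exact K.smul_mem (mul_mem h1 h2) _
  have hab : a * b ∈ Algebra.adjoin ℝ {a, b} :=
    mul_mem (Algebra.subset_adjoin (by simp)) (Algebra.subset_adjoin (by simp))
  refine hS.hasCommutant_adjoinOdd hγ conjAut (left_ne_zero_of_mul_eq_one hε)
    (complexAction (a * b) hI) a ha (fun z => ?_) (fun z => ?_) hγa ?_
    (Algebra.subset_adjoin (by simp)) (unop_complexAction_mem hI hab)
  · simp only [unop_complexAction, conjAut, Complex.conjAe_coe, Complex.conj_re, Complex.conj_im,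
      add_mul, mul_add]
    simp [mul_assoc, hba]
  · simp only [unop_complexAction]
    simp [mul_add, add_mul, mul_assoc, rel1, hγb]
  · have hK : ∀ K : Subalgebra ℝ (End ℝ V), (∀ z, (complexAction (a * b) hI z).unop ∈ K) →
        a * b ∈ K := fun K h => by
      have := h Complex.I
      rw [unop_complexAction] at this
      simpa using this
    rintro s (rfl | rfl) K h1 h2
    · exact h1
    · exact mem K h1 (hK K h2)

theorem unop_quaternionAction_basis {I J : End ℝ V} (hI : I * I = -1) (hJ : J * J = -1)
    (hIJ : I * J = -(J * I)) {K : Subalgebra ℝ (End ℝ V)}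
    (h : ∀ a, (quaternionAction I J hI hJ hIJ a).unop ∈ K) : I ∈ K ∧ J ∈ K := by
  have h1 := (unop_quaternionAction I J hI hJ hIJ ⟨0, 1, 0, 0⟩).subst
    (motive := fun t => t ∈ K) (h _)
  have h2 := (unop_quaternionAction I J hI hJ hIJ ⟨0, 0, 1, 0⟩).subst
    (motive := fun t => t ∈ K) (h _)
  exact ⟨by simpa using h1, by simpa using h2⟩

theorem IsGradedSimple.hasCommutant_quaternion (hγ : γ * γ = 1) {I J : End ℝ V} (hI : I * I = -1)
    (hJ : J * J = -1) (hIJ : I * J = -(J * I)) (hγI : γ * I = I * γ) (hγJ : γ * J = J * γ)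
    (hS : IsGradedSimple γ {I, J}) : HasCommutant γ {I, J} (ofEven ℍ[ℝ]) := by
  refine hS.hasCommutant_ofEven hγ ℍ[ℝ] (quaternionAction I J hI hJ hIJ) (fun z => ?_) ?_
    (unop_quaternionAction_mem hI hJ hIJ (Algebra.subset_adjoin (by simp))
      (Algebra.subset_adjoin (by simp)))
  · rw [unop_quaternionAction]
    have := fun x => mul_mul_left_of_comm hγJ x
    simp [mul_add, add_mul, mul_assoc, this, hγI, hγJ]
  · rintro s (rfl | rfl) K h
    · exact (unop_quaternionAction_basis hI hJ hIJ h).1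
    · exact (unop_quaternionAction_basis hI hJ hIJ h).2

/-- The even products ab and bc generate the quaternions. The volume element abc commutes with all
three generators and has square −ε³ = −ε, so it serves as ι. -/
theorem IsGradedSimple.hasCommutant_three (hγ : γ * γ = 1) {a b c : End ℝ V} {ε : ℝ}
    (hε : ε * ε = 1) (ha : a * a = ε • 1) (hb : b * b = ε • 1) (hc : c * c = ε • 1)
    (hba : b * a = -(a * b)) (hca : c * a = -(a * c)) (hcb : c * b = -(b * c))
    (hγa : γ * a = -(a * γ)) (hγb : γ * b = -(b * γ)) (hγc : γ * c = -(c * γ))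
    (hS : IsGradedSimple γ {a, b, c}) :
    HasCommutant γ {a, b, c} (adjoinOdd (trivialAut ℍ[ℝ]) (-ε)) := by
  have r1 := fun x => mul_mul_left_of_anticomm hba x
  have r2 := fun x => mul_mul_left_of_anticomm hca x
  have r3 := fun x => mul_mul_left_of_anticomm hcb x
  have r4 := fun x => mul_mul_left_of_anticomm hγa x
  have r5 := fun x => mul_mul_left_of_anticomm hγb x
  have r6 := fun x => mul_mul_left_of_sq ha x
  have r7 := fun x => mul_mul_left_of_sq hb x
  have r9 := fun x => mul_mul_left_of_anticomm hγc x
  have hI : (a * b) * (a * b) = -1 := by simp [mul_assoc, r1, ha, hb, smul_smul, hε]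
  have hJ : (b * c) * (b * c) = -1 := by simp [mul_assoc, r3, hb, hc, smul_smul, hε]
  have hIJ : (a * b) * (b * c) = -((b * c) * (a * b)) := by
    simp [mul_assoc, r1, r2, r7, hcb]
  have hu : (a * b * c) * (a * b * c) = (-ε) • 1 := by
    simp [mul_assoc, r1, r2, r3, ha, hb, hc, smul_smul, hε]
  have hA : a ∈ Algebra.adjoin ℝ {a, b, c} := Algebra.subset_adjoin (by simp)
  have hB : b ∈ Algebra.adjoin ℝ {a, b, c} := Algebra.subset_adjoin (by simp)
  have hC : c ∈ Algebra.adjoin ℝ {a, b, c} := Algebra.subset_adjoin (by simp)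
  refine hS.hasCommutant_adjoinOdd hγ (trivialAut ℍ[ℝ])
    (neg_ne_zero.2 (left_ne_zero_of_mul_eq_one hε))
    (quaternionAction (a * b) (b * c) hI hJ hIJ) (a * b * c) hu (fun z => ?_) (fun z => ?_) ?_ ?_
    (mul_mem (mul_mem hA hB) hC)
    (unop_quaternionAction_mem hI hJ hIJ (mul_mem hA hB) (mul_mem hB hC))
  · change _ = a * b * c * (quaternionAction (a * b) (b * c) hI hJ hIJ z).unop
    rw [unop_quaternionAction]
    simp [mul_add, add_mul, mul_assoc, r1, r2, r3, r6, r7, hba, hcb, hb, hc]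
  · rw [unop_quaternionAction]
    simp [mul_add, add_mul, mul_assoc, r4, r5, r9, hγb, hγc]
  · simp [mul_assoc, r4, r5, hγc]
  -- The generators are recovered from abc, ab and bc, so no part of the algebra is lost.
  · have ea : a = (-1 : ℝ) • ((a * b * c) * (b * c)) := by
      simp [mul_assoc, r3, hb, hc, smul_smul, hε]
    have ec : c = (-1 : ℝ) • ((a * b) * (a * b * c)) := by
      simp [mul_assoc, r1, r6, r7, smul_smul, hε]
    have eb : b = ε • (a * (a * b)) := by simp [r6, smul_smul, hε]
    intro s hs K h1 h2
    obtain ⟨h3, h4⟩ := unop_quaternionAction_basis hI hJ hIJ h2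
    have ha' : a ∈ K := by rw [ea]; exact K.smul_mem (mul_mem h1 h4) _
    rcases hs with rfl | rfl | rfl
    · exact ha'
    · rw [eb]; exact K.smul_mem (mul_mem ha' h3) _
    · rw [ec]; exact K.smul_mem (mul_mem h3 h1) _

theorem IsGradedSimple.hasCommutant_complex_zero (hγ : γ * γ = 1) {J : End ℝ V} (hJ : J * J = -1)
    (hγJ : γ * J = J * γ) (hS : IsGradedSimple γ {J}) : HasCommutant γ {J} (ofEven ℂ) := by
  refine hS.hasCommutant_ofEven hγ ℂ (complexAction J hJ) (fun z => ?_) ?_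
    (unop_complexAction_mem hJ (Algebra.subset_adjoin rfl))
  · rw [unop_complexAction]
    simp [mul_add, add_mul, hγJ]
  · rintro _ rfl K h
    have := h Complex.I
    rw [unop_complexAction] at this
    simpa using this

theorem IsGradedSimple.hasCommutant_complex_one (hγ : γ * γ = 1) {J e : End ℝ V} (hJ : J * J = -1)
    (he : e * e = 1) (hJe : J * e = e * J) (hγJ : γ * J = J * γ) (hγe : γ * e = -(e * γ))
    (hS : IsGradedSimple γ {J, e}) : HasCommutant γ {J, e} (adjoinOdd (trivialAut ℂ) 1) := by
  refine hS.hasCommutant_adjoinOdd hγ (trivialAut ℂ) one_ne_zero (complexAction J hJ) e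
    (by simpa using he) (fun z => ?_) (fun z => ?_) hγe ?_ (Algebra.subset_adjoin (by simp))
    (unop_complexAction_mem hJ (Algebra.subset_adjoin (by simp)))
  · change _ = e * (complexAction J hJ z).unop
    rw [unop_complexAction]
    simp [mul_add, add_mul, hJe]
  · rw [unop_complexAction]
    simp [mul_add, add_mul, hγJ]
  · rintro s (rfl | rfl) K h1 h2
    · have := h2 Complex.I
      rw [unop_complexAction] at this
      simpa using this
    · exact h1

end GradedOperators

/-! ### Graded simple modules over real Clifford algebras -/

namespace GradedOperators

open Superalgebra Quaternion

universe u

/-- `P` and `Q` are lists of pairwise anticommuting odd operators with squares `ε` and `-ε`. -/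
structure IsClifford {V : Type*} [AddCommGroup V] [Module ℝ V] (γ : End ℝ V) (ε : ℝ)
    (P Q : List (End ℝ V)) : Prop where
  sq_parity : γ * γ = 1
  sq_sign : ε * ε = 1
  odd : ∀ e ∈ P ++ Q, γ * e = -(e * γ)
  sq_left : ∀ e ∈ P, e * e = ε • 1
  sq_right : ∀ e ∈ Q, e * e = (-ε) • 1
  anticomm : (P ++ Q).Pairwise fun a b => a * b = -(b * a)

variable {V : Type*} [AddCommGroup V] [Module ℝ V] {γ : End ℝ V} {ε : ℝ}

/-- The free sign `ε` lets one argument serve for both signatures. -/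
theorem IsClifford.swap {P Q : List (End ℝ V)} (h : IsClifford γ ε P Q) :
    IsClifford γ (-ε) Q P where
  sq_parity := h.sq_parity
  sq_sign := by simpa using h.sq_sign
  odd e he := h.odd e (by simpa [or_comm] using he)
  sq_left := h.sq_right
  sq_right := by simpa using h.sq_left
  anticomm := (List.pairwise_append_comm fun {a b} hab => by rw [hab, neg_neg]).1 h.anticomm

theorem setOf_mem_append_comm (P Q : List (End ℝ V)) :
    {e | e ∈ P ++ Q} = {e | e ∈ Q ++ P} := by
  ext; simp [or_comm]

theorem IsClifford.map_corner {ω : End ℝ V} (hω : ω * ω = 1) (hγω : γ * ω = ω * γ)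
    {P Q : List (End ℝ V)} (h : IsClifford γ ε P Q) (hPQ : ∀ e ∈ P ++ Q, e * ω = ω * e) :
    IsClifford (corner ω hω γ) ε (P.map (corner ω hω)) (Q.map (corner ω hω)) where
  sq_parity := by rw [← corner_mul hγω hγω, h.sq_parity, corner_one]
  sq_sign := h.sq_sign
  odd e he := by
    rw [← List.map_append, List.mem_map] at he
    obtain ⟨s, hs, rfl⟩ := he
    rw [← corner_mul hγω (hPQ s hs), ← corner_mul (hPQ s hs) hγω, h.odd s hs, corner_neg]
  sq_left e he := by
    obtain ⟨s, hs, rfl⟩ := List.mem_map.1 he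
    have hc := hPQ s (List.mem_append_left _ hs)
    rw [← corner_mul hc hc, h.sq_left s hs, corner_smul, corner_one]
  sq_right e he := by
    obtain ⟨s, hs, rfl⟩ := List.mem_map.1 he
    have hc := hPQ s (List.mem_append_right _ hs)
    rw [← corner_mul hc hc, h.sq_right s hs, corner_smul, corner_one]
  anticomm := by
    rw [← List.map_append, List.pairwise_map]
    refine h.anticomm.imp_of_mem fun ha hb hab => ?_
    rw [← corner_mul (hPQ _ ha) (hPQ _ hb), hab, corner_neg, corner_mul (hPQ _ hb) (hPQ _ ha)]

/-! ### Four generators: the volume element and the change of sign. -/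

section Quad

variable {R : Type*} [Ring R] [Algebra ℝ R] {a b c d : R}

/-- Sorting the square of abcd takes six transpositions, which leaves ε⁴ = 1. Moving one generator
through abcd passes three others, which gives the sign −1. -/
theorem mul_sq_of_anticomm_quadruple (hε : ε * ε = 1) (ha : a * a = ε • 1) (hb : b * b = ε • 1)
    (hc : c * c = ε • 1) (hd : d * d = ε • 1)
    (hba : b * a = -(a * b)) (hca : c * a = -(a * c)) (hda : d * a = -(a * d))
    (hcb : c * b = -(b * c)) (hdb : d * b = -(b * d)) (hdc : d * c = -(c * d)) :
    (a * b * c * d) * (a * b * c * d) = 1 ∧ a * (a * b * c * d) = -((a * b * c * d) * a) ∧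
      b * (a * b * c * d) = -((a * b * c * d) * b) ∧
      c * (a * b * c * d) = -((a * b * c * d) * c) ∧
      d * (a * b * c * d) = -((a * b * c * d) * d) := by
  have r1 := fun x => mul_mul_left_of_anticomm hba x
  have r2 := fun x => mul_mul_left_of_anticomm hca x
  have r3 := fun x => mul_mul_left_of_anticomm hcb x
  have r4 := fun x => mul_mul_left_of_anticomm hda x
  have r5 := fun x => mul_mul_left_of_anticomm hdb x
  have r6 := fun x => mul_mul_left_of_anticomm hdc x
  have r7 := fun x => mul_mul_left_of_sq ha x
  have r8 := fun x => mul_mul_left_of_sq hb x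
  have r9 := fun x => mul_mul_left_of_sq hc x
  refine ⟨?_, ?_, ?_, ?_, ?_⟩ <;>
    simp [mul_assoc, r1, r2, r3, r4, r5, r6, r7, r8, r9, ha, hb, hc, hd, hda, hdb, hdc, smul_smul, hε]

end Quad

theorem mul_mul_mul_of_anticomm {R : Type*} [Ring R] {w e f : R} (hw : w * w = 1) (he : e * w = -(w * e)) :
    (w * e) * (w * f) = -(e * f) := by
  rw [mul_assoc, ← mul_assoc e, he, neg_mul, mul_neg, mul_assoc w e f, ← mul_assoc w w, hw, one_mul]

/-- Multiplication by the volume element of four operators with the same square changes the sign of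
their squares. -/
theorem IsClifford.flip {a b c d : End ℝ V} {P Q : List (End ℝ V)}
    (h : IsClifford γ ε (a :: b :: c :: d :: P) Q) :
    ∃ a' b' c' d' : End ℝ V, IsClifford γ ε P (a' :: b' :: c' :: d' :: Q) ∧
      (∀ e ∈ a :: b :: c :: d :: P ++ Q,
        e ∈ Algebra.adjoin ℝ {e | e ∈ P ++ a' :: b' :: c' :: d' :: Q}) ∧
      (∀ e ∈ P ++ a' :: b' :: c' :: d' :: Q,
        e ∈ Algebra.adjoin ℝ {e | e ∈ a :: b :: c :: d :: P ++ Q}) := by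
  have h1 := h.anticomm
  have h2 := h.odd
  have h3 := h.sq_left
  simp only [List.cons_append, List.pairwise_cons, List.forall_mem_cons] at h1 h2 h3
  obtain ⟨⟨hab, hac, had, haP⟩, ⟨hbc, hbd, hbP⟩, ⟨hcd, hcP⟩, hdP, hPQ⟩ := h1
  obtain ⟨hγa, hγb, hγc, hγd, hγP⟩ := h2
  obtain ⟨ha, hb, hc, hd, hP⟩ := h3
  have neg' : ∀ {x y : End ℝ V}, x * y = -(y * x) → y * x = -(x * y) := fun e => by
    rw [e, neg_neg]
  obtain ⟨hω, haω, hbω, hcω, hdω⟩ := mul_sq_of_anticomm_quadruple h.sq_sign ha hb hc hd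
    (neg' hab) (neg' hac) (neg' had) (neg' hbc) (neg' hbd) (neg' hcd)
  generalize hw : a * b * c * d = ω at *
  -- Passing four anticommuting factors costs no sign. This covers both the remaining generators and
  -- the parity operator.
  have comm4 : ∀ x, a * x = -(x * a) → b * x = -(x * b) → c * x = -(x * c) → d * x = -(x * d) →
      ω * x = x * ω := fun x h1 h2 h3 h4 => by
    have r1 := mul_mul_left_of_anticomm h1
    have r2 := mul_mul_left_of_anticomm h2
    have r3 := mul_mul_left_of_anticomm h3
    rw [← hw]
    simp [mul_assoc, h4, r1, r2, r3]
  have hωP : ∀ x ∈ P ++ Q, ω * x = x * ω := fun x hx =>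
    comm4 x (haP x hx) (hbP x hx) (hcP x hx) (hdP x hx)
  have hγω : γ * ω = ω * γ :=
    (comm4 γ (neg' hγa) (neg' hγb) (neg' hγc) (neg' hγd)).symm
  have odd' : ∀ {e : End ℝ V}, γ * e = -(e * γ) → γ * (ω * e) = -(ω * e * γ) := fun {e} he => by
    rw [← mul_assoc, hγω, mul_assoc, he, mul_neg, mul_assoc]
  have sq' : ∀ {e : End ℝ V}, e * ω = -(ω * e) → e * e = ε • 1 →
      (ω * e) * (ω * e) = (-ε) • 1 := fun {e} h1 h2 => by
    rw [mul_mul_mul_of_anticomm hω h1, h2, neg_smul]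
  have anti' : ∀ {e f : End ℝ V}, e * ω = -(ω * e) → f * ω = -(ω * f) → e * f = -(f * e) →
      (ω * e) * (ω * f) = -((ω * f) * (ω * e)) := fun h1 h2 h3 => by
    rw [mul_mul_mul_of_anticomm hω h1, mul_mul_mul_of_anticomm hω h2, h3]
  have antiP : ∀ {e x : End ℝ V}, x ∈ P ++ Q → e * x = -(x * e) →
      (ω * e) * x = -(x * (ω * e)) := fun {e x} hx h => by
    rw [mul_assoc, h, mul_neg, ← mul_assoc, hωP x hx, mul_assoc]
  have hω' : ∀ e, ω * (ω * e) = e := fun e => by rw [← mul_assoc, hω, one_mul]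
  refine ⟨ω * a, ω * b, ω * c, ω * d, ⟨h.sq_parity, h.sq_sign, ?_, hP, ?_, ?_⟩, ?_, ?_⟩
  · intro e he
    simp only [List.mem_append, List.mem_cons] at he
    rcases he with he | rfl | rfl | rfl | rfl | he
    · exact hγP e (List.mem_append_left _ he)
    · exact odd' hγa
    · exact odd' hγb
    · exact odd' hγc
    · exact odd' hγd
    · exact hγP e (List.mem_append_right _ he)
  · simp only [List.forall_mem_cons]
    exact ⟨sq' haω ha, sq' hbω hb, sq' hcω hc, sq' hdω hd, h.sq_right⟩
  · rw [List.pairwise_append_comm fun {x y} hxy => neg' hxy]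
    simp only [List.cons_append, List.pairwise_cons, List.forall_mem_cons]
    have hmem : ∀ {x}, x ∈ Q ++ P → x ∈ P ++ Q := fun {x} hx => by
      simpa [or_comm] using hx
    refine ⟨⟨anti' haω hbω hab, anti' haω hcω hac, anti' haω hdω had, fun x hx =>
      antiP (hmem hx) (haP x (hmem hx))⟩, ⟨anti' hbω hcω hbc, anti' hbω hdω hbd, fun x hx =>
      antiP (hmem hx) (hbP x (hmem hx))⟩, ⟨anti' hcω hdω hcd, fun x hx =>
      antiP (hmem hx) (hcP x (hmem hx))⟩, fun x hx => antiP (hmem hx) (hdP x (hmem hx)), ?_⟩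
    exact (List.pairwise_append_comm fun {x y} hxy => neg' hxy).1 hPQ
  -- The new generators have the same volume element as the old ones, so they generate `ω`, and e =
  -- ω(ωe) recovers each old generator.
  · have hωeq : (ω * a) * (ω * b) * (ω * c) * (ω * d) = ω := by
      rw [mul_mul_mul_of_anticomm hω haω, mul_assoc, mul_mul_mul_of_anticomm hω hcω, neg_mul_neg,
        ← mul_assoc, hw]
    generalize hK : Algebra.adjoin ℝ {e | e ∈ P ++ ω * a :: ω * b :: ω * c :: ω * d :: Q} = K
    have hmem : ∀ e ∈ P ++ ω * a :: ω * b :: ω * c :: ω * d :: Q, e ∈ K := fun e he =>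
      hK ▸ Algebra.subset_adjoin he
    have ma := hmem (ω * a) (by simp)
    have mb := hmem (ω * b) (by simp)
    have mc := hmem (ω * c) (by simp)
    have md := hmem (ω * d) (by simp)
    have hωK : ω ∈ K := by
      have := mul_mem (mul_mem (mul_mem ma mb) mc) md
      rwa [hωeq] at this
    intro e he
    simp only [List.cons_append, List.mem_append, List.mem_cons] at he
    rcases he with rfl | rfl | rfl | rfl | he | he
    · rw [← hω' e]; exact mul_mem hωK ma
    · rw [← hω' e]; exact mul_mem hωK mb
    · rw [← hω' e]; exact mul_mem hωK mc
    · rw [← hω' e]; exact mul_mem hωK md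
    · exact hmem e (by simp [he])
    · exact hmem e (by simp [he])
  · generalize hK : Algebra.adjoin ℝ {e | e ∈ a :: b :: c :: d :: P ++ Q} = K
    have hmem : ∀ e ∈ a :: b :: c :: d :: P ++ Q, e ∈ K := fun e he =>
      hK ▸ Algebra.subset_adjoin he
    have ma := hmem a (by simp)
    have mb := hmem b (by simp)
    have mc := hmem c (by simp)
    have md := hmem d (by simp)
    have hωK : ω ∈ K := hw ▸ mul_mem (mul_mem (mul_mem ma mb) mc) md
    intro e he
    simp only [List.mem_append, List.mem_cons] at he
    rcases he with he | rfl | rfl | rfl | rfl | he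
    · exact hmem e (by simp [he])
    · exact mul_mem hωK ma
    · exact mul_mem hωK mb
    · exact mul_mem hωK mc
    · exact mul_mem hωK md
    · exact hmem e (by simp [he])

/-- The volume element is an even involution anticommuting with `d`, so `V` reduces to its fixed
space. There ab and ac act as anticommuting even operators of square −1, whichever sign `ε` has, in
accordance with 4 = −4 modulo 8. -/
theorem IsGradedSimple.hasCommutant_four (hγ : γ * γ = 1) {a b c d : End ℝ V}
    (hε : ε * ε = 1) (ha : a * a = ε • 1) (hb : b * b = ε • 1) (hc : c * c = ε • 1)
    (hd : d * d = ε • 1)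
    (hba : b * a = -(a * b)) (hca : c * a = -(a * c)) (hda : d * a = -(a * d))
    (hcb : c * b = -(b * c)) (hdb : d * b = -(b * d)) (hdc : d * c = -(c * d))
    (hγa : γ * a = -(a * γ)) (hγb : γ * b = -(b * γ)) (hγc : γ * c = -(c * γ))
    (hγd : γ * d = -(d * γ)) (hS : IsGradedSimple γ {a, b, c, d}) :
    HasCommutant γ {a, b, c, d} (ofEven ℍ[ℝ]) := by
  obtain ⟨hω, haω, hbω, hcω, hdω⟩ := mul_sq_of_anticomm_quadruple hε ha hb hc hd hba hca hda hcb
    hdb hdc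
  have r1 := fun x => mul_mul_left_of_anticomm hba x
  have r2 := fun x => mul_mul_left_of_anticomm hca x
  have r3 := fun x => mul_mul_left_of_anticomm hcb x
  have r4 := fun x => mul_mul_left_of_anticomm hda x
  have r7 := fun x => mul_mul_left_of_sq ha x
  have g1 := fun x => mul_mul_left_of_anticomm hγa x
  have g2 := fun x => mul_mul_left_of_anticomm hγb x
  have g3 := fun x => mul_mul_left_of_anticomm hγc x
  have habω : (a * b) * (a * b * c * d) = (a * b * c * d) * (a * b) := by
    rw [mul_assoc a b, hbω, mul_neg, ← mul_assoc a, haω, neg_mul, neg_neg, ← mul_assoc _ a b]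
  have hacω : (a * c) * (a * b * c * d) = (a * b * c * d) * (a * c) := by
    rw [mul_assoc a c, hcω, mul_neg, ← mul_assoc a, haω, neg_mul, neg_neg, ← mul_assoc _ a c]
  have hγω : γ * (a * b * c * d) = (a * b * c * d) * γ := by
    simp [mul_assoc, g1, g2, g3, hγd]
  have hred : IsReduction γ (a * b * c * d) d ε {a * b, a * c} :=
    { sq_parity := hγ
      sq_omega := hω
      parity_omega := hγω
      parity_u := hγd
      c_mul_c := hε
      u_mul_u := hd
      u_omega := hdω
      mul_omega := by
        rintro s (rfl | rfl)
        · exact habω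
        · exact hacω
      mul_u := by
        rintro s (rfl | rfl)
        · exact Or.inl (by simp [mul_assoc, r4, hdb])
        · exact Or.inl (by simp [mul_assoc, r4, hdc]) }
  have hK : ∀ s ∈ ({a, b, c, d} : Set (End ℝ V)),
      s ∈ Algebra.adjoin ℝ (({a * b, a * c} : Set (End ℝ V)) ∪ {a * b * c * d, d}) := by
    generalize hK : Algebra.adjoin ℝ
      (({a * b, a * c} : Set (End ℝ V)) ∪ {a * b * c * d, d}) = K
    have hmem : ∀ e ∈ (({a * b, a * c} : Set (End ℝ V)) ∪ {a * b * c * d, d}), e ∈ K :=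
      fun e he => hK ▸ Algebra.subset_adjoin he
    have m1 := hmem (a * b) (by simp)
    have m2 := hmem (a * c) (by simp)
    have m3 := hmem (a * b * c * d) (by simp)
    have m4 := hmem d (by simp)
    have ma : a ∈ K := by
      -- Here (abcd)d = ε abc and (ab)(ac) = −ε bc, and −abc·bc = a because (bc)² = −1.
      have : a = (a * b * c * d) * d * ((a * b) * (a * c)) := by
        simp [mul_assoc, r1, r3, r7, hb, hc, hd, smul_smul, hε]
      rw [this]
      exact mul_mem (mul_mem m3 m4) (mul_mem m1 m2)
    have h : ∀ x, a * x ∈ K → x ∈ K := fun x hx => by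
      have : x = ε • (a * (a * x)) := by rw [r7, smul_smul, hε, one_smul]
      rw [this]
      exact K.smul_mem (mul_mem ma hx) _
    rintro s (rfl | rfl | rfl | rfl)
    exacts [ma, h _ m1, h _ m2, m4]
  refine (hred.hasCommutant ?_).congr_adjoin ?_ hK
  · have hs := hred.isGradedSimple (hS.of_subset_adjoin hK)
    rw [Set.image_pair] at hs ⊢
    have hγab : γ * (a * b) = (a * b) * γ := by simp [mul_assoc, g1, hγb]
    have hγac : γ * (a * c) = (a * c) * γ := by simp [mul_assoc, g1, hγc]
    refine hs.hasCommutant_quaternion ?_ ?_ ?_ ?_ ?_ ?_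
    · rw [← corner_mul hγω hγω, hγ, corner_one]
    · rw [← corner_mul habω habω, ← corner_one (hω := hω), ← corner_neg]
      congr 1
      simp [mul_assoc, r1, ha, hb, smul_smul, hε]
    · rw [← corner_mul hacω hacω, ← corner_one (hω := hω), ← corner_neg]
      congr 1
      simp [mul_assoc, r2, ha, hc, smul_smul, hε]
    · rw [← corner_mul habω hacω, ← corner_mul hacω habω, ← corner_neg]
      congr 1
      simp [mul_assoc, r1, r2, r7, hcb]
    · rw [← corner_mul habω hγω, ← corner_mul hγω habω, hγab]
    · rw [← corner_mul hacω hγω, ← corner_mul hγω hacω, hγac]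
  · generalize hK' : Algebra.adjoin ℝ ({a, b, c, d} : Set (End ℝ V)) = K
    have hmem : ∀ e ∈ ({a, b, c, d} : Set (End ℝ V)), e ∈ K :=
      fun e he => hK' ▸ Algebra.subset_adjoin he
    have ma := hmem a (by simp)
    have mb := hmem b (by simp)
    have mc := hmem c (by simp)
    have md := hmem d (by simp)
    rintro s ((rfl | rfl) | (rfl | rfl))
    exacts [mul_mem ma mb, mul_mem ma mc, mul_mem (mul_mem (mul_mem ma mb) mc) md, md]

/-- A Clifford family consisting of at most four operators with the same square. -/
theorem IsClifford.hasCommutant_of_length_le (P : List (End ℝ V)) (hP : P.length ≤ 4)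
    (h : IsClifford γ ε P []) (hS : IsGradedSimple γ {e | e ∈ P}) :
    HasCommutant γ {e | e ∈ P}
      (match P.length with
        | 0 => ofEven ℝ
        | 1 => adjoinOdd (trivialAut ℝ) ε
        | 2 => adjoinOdd conjAut ε
        | 3 => adjoinOdd (trivialAut ℍ[ℝ]) (-ε)
        | _ => ofEven ℍ[ℝ]) := by
  have h1 := h.anticomm
  have h2 := h.odd
  have h3 := h.sq_left
  have neg' : ∀ {x y : End ℝ V}, x * y = -(y * x) → y * x = -(x * y) := fun e => by
    rw [e, neg_neg]
  match P with
  | [] =>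
    have e : {e | e ∈ ([] : List (End ℝ V))} = ∅ := by ext; simp
    rw [e] at hS ⊢
    exact hS.hasCommutant_empty h.sq_parity
  | [a] =>
    have e : {e | e ∈ [a]} = {a} := by ext; simp
    rw [e] at hS ⊢
    exact hS.hasCommutant_one h.sq_parity h.sq_sign (h3 a (by simp)) (h2 a (by simp))
  | [a, b] =>
    have e : {e | e ∈ [a, b]} = {a, b} := by ext; simp
    rw [e] at hS ⊢
    simp only [List.append_nil, List.pairwise_cons, List.forall_mem_cons] at h1 h2 h3
    exact hS.hasCommutant_two h.sq_parity h.sq_sign h3.1 h3.2.1 (neg' h1.1.1) h2.1 h2.2.1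
  | [a, b, c] =>
    have e : {e | e ∈ [a, b, c]} = {a, b, c} := by ext; simp
    rw [e] at hS ⊢
    simp only [List.append_nil, List.pairwise_cons, List.forall_mem_cons] at h1 h2 h3
    exact hS.hasCommutant_three h.sq_parity h.sq_sign h3.1 h3.2.1 h3.2.2.1 (neg' h1.1.1)
      (neg' h1.1.2.1) (neg' h1.2.1.1) h2.1 h2.2.1 h2.2.2.1
  | [a, b, c, d] =>
    have e : {e | e ∈ [a, b, c, d]} = {a, b, c, d} := by ext; simp
    rw [e] at hS ⊢
    simp only [List.append_nil, List.pairwise_cons, List.forall_mem_cons] at h1 h2 h3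
    exact hS.hasCommutant_four h.sq_parity h.sq_sign h3.1 h3.2.1 h3.2.2.1 h3.2.2.2.1 (neg' h1.1.1)
      (neg' h1.1.2.1) (neg' h1.1.2.2.1) (neg' h1.2.1.1) (neg' h1.2.1.2.1) (neg' h1.2.2.1.1)
      h2.1 h2.2.1 h2.2.2.1 h2.2.2.2.1
  | _ :: _ :: _ :: _ :: _ :: _ => simp at hP; omega

/-- Removal of two operators with opposite squares. -/
theorem IsClifford.hasCommutant_cons_cons {a b : End ℝ V} {P Q : List (End ℝ V)}
    (h : IsClifford γ 1 (a :: P) (b :: Q)) (hS : IsGradedSimple γ {e | e ∈ a :: P ++ b :: Q})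
    (B : Superalgebra ℝ)
    (IH : ∀ (U : Submodule ℝ V) (γ' : End ℝ U) (P' Q' : List (End ℝ U)), P'.length = P.length →
      Q'.length = Q.length → IsClifford γ' 1 P' Q' → IsGradedSimple γ' {e | e ∈ P' ++ Q'} →
      HasCommutant γ' {e | e ∈ P' ++ Q'} B) :
    HasCommutant γ {e | e ∈ a :: P ++ b :: Q} B := by
  have neg' : ∀ {x y : End ℝ V}, x * y = -(y * x) → y * x = -(x * y) := fun e => by
    rw [e, neg_neg]
  have h1 := h.anticomm
  rw [List.cons_append, List.pairwise_cons, List.pairwise_append_comm fun {x y} hxy => neg' hxy,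
    List.cons_append, List.pairwise_cons,
    List.pairwise_append_comm fun {x y} hxy => neg' hxy] at h1
  obtain ⟨haP, hbP, hPQ⟩ := h1
  have hab := haP b (by simp)
  have hba := neg' hab
  have haP' : ∀ x ∈ P ++ Q, a * x = -(x * a) := fun x hx => haP x (by
    simp only [List.mem_append, List.mem_cons] at hx ⊢; tauto)
  have hbP' : ∀ x ∈ P ++ Q, b * x = -(x * b) := fun x hx => hbP x (by
    simp only [List.mem_append] at hx ⊢; tauto)
  have ha : a * a = 1 := by simpa using h.sq_left a (by simp)
  have hb : b * b = -1 := by simpa using h.sq_right b (by simp)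
  have hγa := h.odd a (by simp)
  have hγb := h.odd b (by simp)
  have r1 := fun x => mul_mul_left_of_anticomm hba x
  have g1 := fun x => mul_mul_left_of_anticomm hγa x
  have hω : (a * b) * (a * b) = 1 := by simp [mul_assoc, r1, ha, hb]
  have hγω : γ * (a * b) = (a * b) * γ := by simp [mul_assoc, g1, hγb]
  have hPω : ∀ e ∈ P ++ Q, e * (a * b) = (a * b) * e := fun e he => by
    have := fun x => mul_mul_left_of_anticomm (haP' e he) x
    simp [mul_assoc, hbP' e he, this]
  -- Opposite squares are essential: (ab)² = −a²b² = 1. The remaining generators anticommute with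
  -- both a and b, hence commute with ab.
  have hred : IsReduction γ (a * b) a 1 {e | e ∈ P ++ Q} :=
    { sq_parity := h.sq_parity
      sq_omega := hω
      parity_omega := hγω
      parity_u := hγa
      c_mul_c := one_mul 1
      u_mul_u := by simpa using ha
      u_omega := by simp [mul_assoc, hba]
      mul_omega := hPω
      mul_u := fun s hs => Or.inr (neg' (haP' s hs)) }
  have hK : ∀ s ∈ {e | e ∈ a :: P ++ b :: Q},
      s ∈ Algebra.adjoin ℝ ({e | e ∈ P ++ Q} ∪ {a * b, a}) := by
    generalize hK : Algebra.adjoin ℝ ({e | e ∈ P ++ Q} ∪ {a * b, a}) = K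
    have hmem : ∀ e ∈ ({e | e ∈ P ++ Q} ∪ {a * b, a}), e ∈ K :=
      fun e he => hK ▸ Algebra.subset_adjoin he
    have m1 := hmem a (by simp)
    have m2 := hmem (a * b) (by simp)
    have m3 : b ∈ K := by
      have := mul_mem m1 m2
      rwa [← mul_assoc, ha, one_mul] at this
    intro s hs
    simp only [List.cons_append, Set.mem_ofPred_eq, List.mem_append, List.mem_cons] at hs
    rcases hs with rfl | hs | rfl | hs
    exacts [m1, hmem s (by simp [hs]), m3, hmem s (by simp [hs])]
  refine (hred.hasCommutant ?_).congr_adjoin ?_ hK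
  · have hs := hred.isGradedSimple (hS.of_subset_adjoin hK)
    have e : corner (a * b) hω '' {e | e ∈ P ++ Q} =
        {e | e ∈ P.map (corner (a * b) hω) ++ Q.map (corner (a * b) hω)} := by
      ext t
      rw [← List.map_append]
      simp only [Set.mem_image, Set.mem_ofPred_eq, List.mem_map]
    rw [e] at hs ⊢
    have hcl : IsClifford γ 1 P Q :=
      { sq_parity := h.sq_parity
        sq_sign := h.sq_sign
        odd := fun e he => h.odd e (by
          simp only [List.cons_append, List.mem_append, List.mem_cons] at he ⊢; tauto)
        sq_left := fun e he => h.sq_left e (List.mem_cons_of_mem _ he)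
        sq_right := fun e he => h.sq_right e (List.mem_cons_of_mem _ he)
        anticomm := hPQ }
    exact IH _ _ _ _ (by simp) (by simp) (hcl.map_corner hω hγω hPω) hs
  · generalize hK' : Algebra.adjoin ℝ {e | e ∈ a :: P ++ b :: Q} = K
    have hmem : ∀ e ∈ a :: P ++ b :: Q, e ∈ K := fun e he => hK' ▸ Algebra.subset_adjoin he
    rintro s (hs | rfl | rfl)
    · refine hmem s ?_
      simp only [Set.mem_ofPred_eq, List.cons_append, List.mem_append, List.mem_cons] at hs ⊢
      tauto
    · exact mul_mem (hmem a (by simp)) (hmem b (by simp))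
    · exact hmem s (by simp)

/-- The commutant of a graded simple module over the real Clifford algebra on `p` generators of
square `1` and `q` generators of square `-1`. -/
theorem IsClifford.hasCommutant {V : Type u} [AddCommGroup V] [Module ℝ V] {γ : End ℝ V}
    (P Q : List (End ℝ V)) (h : IsClifford γ 1 P Q) (hS : IsGradedSimple γ {e | e ∈ P ++ Q}) :
    HasCommutant γ {e | e ∈ P ++ Q}
      (BrauerWall.real ((Q.length : ZMod 8) - (P.length : ZMod 8))).divisionSuperalgebra := by
  induction hn : P.length + Q.length using Nat.strong_induction_on generalizing V with
  | _ n IH =>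
  -- Removing one generator of each sign leaves q − p unchanged.
  have pair : ∀ (a b : End ℝ V) (P Q : List (End ℝ V)), P.length + Q.length < n →
      IsClifford γ 1 (a :: P) (b :: Q) → IsGradedSimple γ {e | e ∈ a :: P ++ b :: Q} →
      HasCommutant γ {e | e ∈ a :: P ++ b :: Q}
        (BrauerWall.real ((Q.length : ZMod 8) - (P.length : ZMod 8))).divisionSuperalgebra := by
    intro a b P Q hlt h hS
    refine h.hasCommutant_cons_cons hS _ fun U γ' P' Q' hP' hQ' h' hS' => ?_
    have := IH (P.length + Q.length) hlt P' Q' h' hS' (by rw [hP', hQ'])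
    rwa [hP', hQ'] at this
  have h8 : (8 : ZMod 8) = 0 := rfl
  match P, Q with
  | a :: P, b :: Q =>
    have := pair a b P Q (by simp at hn; omega) h hS
    convert this using 3
    simp
  | [], Q =>
    -- With five or more generators of square −1, four are flipped to square 1 and one of the others
    -- is cancelled against a flipped one. The flip lowers q − p by 8; the total number of
    -- generators drops by two.
    by_cases hQ : Q.length ≤ 4
    · have := h.swap.hasCommutant_of_length_le Q hQ hS
      rw [List.length_nil, Nat.cast_zero, sub_zero]
      match Q with
      | [] => exact this
      | [_] => exact this
      | [_, _] => exact this
      | [_, _, _] => rw [neg_neg] at this; exact this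
      | [_, _, _, _] => exact this
      | _ :: _ :: _ :: _ :: _ :: _ => simp at hQ; omega
    · match Q with
      | a :: b :: c :: d :: e :: Q =>
        obtain ⟨a', b', c', d', h', h1, h2⟩ := h.swap.flip
        have h'' := h'.swap
        rw [neg_neg] at h''
        rw [setOf_mem_append_comm] at hS ⊢
        have h1' : ∀ s ∈ {s | s ∈ a :: b :: c :: d :: e :: Q ++ []},
            s ∈ Algebra.adjoin ℝ {s | s ∈ [a', b', c', d'] ++ e :: Q} := by
          rw [setOf_mem_append_comm [a', b', c', d']]; exact h1
        have h2' : ∀ s ∈ {s | s ∈ [a', b', c', d'] ++ e :: Q},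
            s ∈ Algebra.adjoin ℝ {s | s ∈ a :: b :: c :: d :: e :: Q ++ []} := by
          rw [setOf_mem_append_comm [a', b', c', d']]; exact h2
        have := (pair a' e [b', c', d'] Q (by simp at hn ⊢; omega) h''
          (hS.of_subset_adjoin h1')).congr_adjoin h2' h1'
        convert this using 3
        simp only [List.length_cons, List.length_nil]
        push_cast
        linear_combination h8
      | [] | [_] | [_, _] | [_, _, _] | [_, _, _, _] => simp at hQ
  | a :: P, [] =>
    -- The mirror image: flipping four generators of square 1 raises q − p by 8.
    by_cases hP : (a :: P).length ≤ 4
    · rw [List.append_nil] at hS ⊢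
      have := h.hasCommutant_of_length_le (a :: P) hP hS
      match P with
      | [] => exact this
      | [_] => exact this
      | [_, _] => exact this
      | [_, _, _] => exact this
      | _ :: _ :: _ :: _ :: _ => simp at hP; omega
    · match P with
      | b :: c :: d :: e :: P =>
        have h' : IsClifford γ 1 (a :: b :: c :: d :: e :: P) [] := h
        obtain ⟨a', b', c', d', h', h1, h2⟩ := h'.flip
        have := (pair e a' P [b', c', d'] (by simp at hn ⊢; omega) h'
          (hS.of_subset_adjoin h1)).congr_adjoin h2 h1
        convert this using 3
        simp only [List.length_cons, List.length_nil]
        push_cast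
        linear_combination -h8
      | [] | [_] | [_, _] | [_, _, _] => simp at hP

end GradedOperators

/-! ### Graded simple modules over complex Clifford algebras -/

namespace GradedOperators

open Superalgebra

universe u

/-- `E` is a list of pairwise anticommuting odd operators of square `1` which are linear with
respect to the even complex structure `J`. -/
structure IsComplexClifford {V : Type*} [AddCommGroup V] [Module ℝ V] (γ J : End ℝ V)
    (E : List (End ℝ V)) : Prop where
  sq_parity : γ * γ = 1
  sq_complex : J * J = -1
  parity_complex : γ * J = J * γ
  complex_comm : ∀ e ∈ E, J * e = e * J
  odd : ∀ e ∈ E, γ * e = -(e * γ)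
  sq : ∀ e ∈ E, e * e = 1
  anticomm : E.Pairwise fun a b => a * b = -(b * a)

/-- Any two generators can be cancelled, because J² = −1 compensates for (ab)² = −1: the operator
Jab is an even involution that commutes with `J` and the other generators and anticommutes with `a`.
No generator leaves the commutant ℂ, one leaves ℂ ⊕ ℂι. -/
theorem IsComplexClifford.hasCommutant {V : Type u} [AddCommGroup V] [Module ℝ V] {γ J : End ℝ V}
    (E : List (End ℝ V)) (h : IsComplexClifford γ J E)
    (hS : IsGradedSimple γ (insert J {e | e ∈ E})) :
    HasCommutant γ (insert J {e | e ∈ E})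
      (BrauerWall.complex (E.length : ZMod 2)).divisionSuperalgebra := by
  induction hn : E.length using Nat.strong_induction_on generalizing V with
  | _ n IH =>
  match E with
  | [] =>
    subst hn
    have e : (insert J {e | e ∈ ([] : List (End ℝ V))} : Set (End ℝ V)) = {J} := by ext; simp
    rw [e] at hS ⊢
    exact hS.hasCommutant_complex_zero h.sq_parity h.sq_complex h.parity_complex
  | [a] =>
    subst hn
    have e : (insert J {e | e ∈ [a]} : Set (End ℝ V)) = {J, a} := by ext; simp
    rw [e] at hS ⊢
    exact hS.hasCommutant_complex_one h.sq_parity h.sq_complex (h.sq a (by simp))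
      (h.complex_comm a (by simp)) h.parity_complex (h.odd a (by simp))
  | a :: b :: E =>
    have neg' : ∀ {x y : End ℝ V}, x * y = -(y * x) → y * x = -(x * y) := fun e => by
      rw [e, neg_neg]
    have h1 := h.anticomm
    have h2 := h.odd
    have h3 := h.sq
    have h4 := h.complex_comm
    simp only [List.pairwise_cons, List.forall_mem_cons] at h1 h2 h3 h4
    obtain ⟨⟨hab, haE⟩, hbE, hE⟩ := h1
    obtain ⟨hγa, hγb, hγE⟩ := h2
    obtain ⟨ha, hb, hE1⟩ := h3
    obtain ⟨hJa, hJb, hJE⟩ := h4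
    have hba := neg' hab
    have r1 := fun x => mul_mul_left_of_anticomm hba x
    have r2 := fun x => mul_mul_left_of_comm hJa.symm x
    have r3 := fun x => mul_mul_left_of_comm hJb.symm x
    have r4 := fun x => mul_mul_left_of_anticomm hγa x
    have r5 := fun x => mul_mul_left_of_comm h.parity_complex x
    have rJ : ∀ x, J * (J * x) = -x := fun x => by rw [← mul_assoc, h.sq_complex, neg_one_mul]
    have hω : (J * a * b) * (J * a * b) = 1 := by
      simp [mul_assoc, r1, r2, r3, h.sq_complex, ha, hb]
    have hγω : γ * (J * a * b) = (J * a * b) * γ := by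
      simp [mul_assoc, r4, r5, hγb]
    have hJω : J * (J * a * b) = (J * a * b) * J := by
      simp [mul_assoc, r2, ← hJb]
    have hEω : ∀ e ∈ E, e * (J * a * b) = (J * a * b) * e := fun e he => by
      have s1 := fun x => mul_mul_left_of_anticomm (neg' (haE e he)) x
      have s2 := fun x => mul_mul_left_of_comm (hJE e he).symm x
      simp [mul_assoc, s1, s2, neg' (hbE e he)]
    have hred : IsReduction γ (J * a * b) a 1 (insert J {e | e ∈ E}) :=
      { sq_parity := h.sq_parity
        sq_omega := hω
        parity_omega := hγω
        parity_u := hγa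
        c_mul_c := one_mul 1
        u_mul_u := by simpa using ha
        u_omega := by simp [mul_assoc, r2, hba]
        mul_omega := by
          rintro s (rfl | hs)
          exacts [hJω, hEω s hs]
        mul_u := by
          rintro s (rfl | hs)
          exacts [Or.inl hJa, Or.inr (neg' (haE s hs))] }
    have hK : ∀ s ∈ (insert J {e | e ∈ a :: b :: E} : Set (End ℝ V)),
        s ∈ Algebra.adjoin ℝ (insert J {e | e ∈ E} ∪ {J * a * b, a}) := by
      generalize hK : Algebra.adjoin ℝ (insert J {e | e ∈ E} ∪ {J * a * b, a}) = K
      have hmem : ∀ e ∈ (insert J {e | e ∈ E} ∪ {J * a * b, a} : Set (End ℝ V)), e ∈ K :=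
        fun e he => hK ▸ Algebra.subset_adjoin he
      have m1 := hmem a (by simp)
      have m2 := hmem (J * a * b) (by simp)
      have m4 := hmem J (by simp)
      have m3 : b ∈ K := by
        -- By `J`-linearity of a, Ja(Jab) = J²a²b = −b.
        have : b = (-1 : ℝ) • (J * (a * (J * a * b))) := by
          have ra : a * (a * b) = b := by rw [← mul_assoc, ha, one_mul]
          simp [mul_assoc, r2, rJ, ra]
        rw [this]
        exact K.smul_mem (mul_mem m4 (mul_mem m1 m2)) _
      rintro s (rfl | hs)
      · exact m4
      · simp only [Set.mem_ofPred_eq, List.mem_cons] at hs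
        rcases hs with rfl | rfl | hs
        exacts [m1, m3, hmem s (by simp [hs])]
    refine (hred.hasCommutant ?_).congr_adjoin ?_ hK
    · have hs := hred.isGradedSimple (hS.of_subset_adjoin hK)
      have e : corner (J * a * b) hω '' (insert J {e | e ∈ E}) =
          insert (corner (J * a * b) hω J) {e | e ∈ E.map (corner (J * a * b) hω)} := by
        rw [Set.image_insert_eq]
        congr 1
        ext t
        simp only [Set.mem_image, Set.mem_ofPred_eq, List.mem_map]
      rw [e] at hs ⊢
      have hcl : IsComplexClifford (corner (J * a * b) hω γ) (corner (J * a * b) hω J)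
          (E.map (corner (J * a * b) hω)) :=
        { sq_parity := by rw [← corner_mul hγω hγω, h.sq_parity, corner_one]
          sq_complex := by
            rw [← corner_mul hJω hJω, h.sq_complex, corner_neg, corner_one]
          parity_complex := by
            rw [← corner_mul hγω hJω, ← corner_mul hJω hγω, h.parity_complex]
          complex_comm := by
            intro e he
            obtain ⟨s, hs, rfl⟩ := List.mem_map.1 he
            rw [← corner_mul hJω (hEω s hs), ← corner_mul (hEω s hs) hJω, hJE s hs]
          odd := by
            intro e he
            obtain ⟨s, hs, rfl⟩ := List.mem_map.1 he
            rw [← corner_mul hγω (hEω s hs), ← corner_mul (hEω s hs) hγω, hγE s hs, corner_neg]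
          sq := by
            intro e he
            obtain ⟨s, hs, rfl⟩ := List.mem_map.1 he
            rw [← corner_mul (hEω s hs) (hEω s hs), hE1 s hs, corner_one]
          anticomm := by
            rw [List.pairwise_map]
            refine hE.imp_of_mem fun ha hb hab => ?_
            rw [← corner_mul (hEω _ ha) (hEω _ hb), hab, corner_neg,
              corner_mul (hEω _ hb) (hEω _ ha)] }
      have := IH E.length (by simp at hn; omega) _ hcl hs (by simp)
      convert this using 3
      have h2 : (2 : ZMod 2) = 0 := rfl
      rw [← hn, List.length_cons, List.length_cons]
      push_cast
      linear_combination h2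
    · generalize hK' : Algebra.adjoin ℝ (insert J {e | e ∈ a :: b :: E}) = K
      have hmem : ∀ e ∈ (insert J {e | e ∈ a :: b :: E} : Set (End ℝ V)), e ∈ K :=
        fun e he => hK' ▸ Algebra.subset_adjoin he
      have mJ := hmem J (by simp)
      have ma := hmem a (by simp)
      have mb := hmem b (by simp)
      rintro s ((rfl | hs) | (rfl | rfl))
      · exact mJ
      · refine hmem s (Or.inr ?_)
        simp only [Set.mem_ofPred_eq, List.mem_cons] at hs ⊢
        exact Or.inr (Or.inr hs)
      · exact mul_mem (mul_mem mJ ma) mb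
      · exact ma

/-! ### Vanishing of the radical, and transport of commutants. -/

/-- An odd operator of square zero which commutes or anticommutes with a graded simple set of
operators vanishes. -/
theorem IsGradedSimple.eq_zero_of_sq_eq_zero {V : Type*} [AddCommGroup V] [Module ℝ V]
    {γ r : End ℝ V} {S : Set (End ℝ V)} (hS : IsGradedSimple γ S) (hγ : γ * r = -(r * γ))
    (hr : r * r = 0) (hSr : ∀ s ∈ S, r * s = s * r ∨ r * s = -(s * r)) : r = 0 := by
  have hγ' : ∀ v, γ (r v) = -r (γ v) := LinearMap.congr_fun hγ
  have hr' : ∀ v, r (r v) = 0 := LinearMap.congr_fun hr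
  -- The kernel of `r` is graded and invariant. If it is zero, then it still contains the image of
  -- `r`, since r² = 0, and `r` vanishes all the same.
  have h1 : ∀ v ∈ LinearMap.ker r, γ v ∈ LinearMap.ker r := fun v hv => by
    rw [LinearMap.mem_ker] at hv ⊢
    have := hγ' v
    rw [hv, map_zero] at this
    exact neg_eq_zero.1 this.symm
  have h2 : ∀ s ∈ S, ∀ v ∈ LinearMap.ker r, s v ∈ LinearMap.ker r := fun s hs v hv => by
    rw [LinearMap.mem_ker] at hv ⊢
    rcases hSr s hs with e | e
    · have e' : r (s v) = s (r v) := LinearMap.congr_fun e v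
      rw [e', hv, map_zero]
    · have e' : r (s v) = -s (r v) := LinearMap.congr_fun e v
      rw [e', hv, map_zero, neg_zero]
  rcases hS.eq_bot_or_eq_top (LinearMap.ker r) h1 h2 with h | h
  · ext v
    have h3 : r v ∈ LinearMap.ker r := hr' v
    rw [h] at h3
    exact h3
  · exact LinearMap.ker_eq_top.1 h

theorem HasCommutant.of_linearEquiv {V V' : Type*} [AddCommGroup V] [Module ℝ V] [AddCommGroup V']
    [Module ℝ V'] {γ : End ℝ V} {S : Set (End ℝ V)} {B : Superalgebra ℝ} (h : HasCommutant γ S B)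
    (e : V ≃ₗ[ℝ] V') : HasCommutant (e.conj γ) (e.conj '' S) B := by
  obtain ⟨f, hf, hT, h0, h1⟩ := h
  have hmul : ∀ s t : End ℝ V, e.conj (s * t) = e.conj s * e.conj t := fun s t =>
    e.conj_comp t s
  let g : End ℝ V →ₐ[ℝ] End ℝ V' := AlgHom.ofLinearMap e.conj.toLinearMap
    (LinearEquiv.conj_id e) hmul
  refine ⟨g.comp f, e.conj.injective.comp hf, fun T => ?_, fun b hb => ?_, fun b hb => ?_⟩
  · obtain ⟨T, rfl⟩ := e.conj.surjective T
    have h2 : ∀ b, (g.comp f) b = e.conj (f b) := fun b => rfl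
    simp only [Set.forall_mem_image, h2, ← hmul, e.conj.injective.eq_iff, hT]
  · change e.conj γ * e.conj (f b) = e.conj (f b) * e.conj γ
    rw [← hmul, ← hmul, h0 b hb]
  · change e.conj γ * e.conj (f b) = -(e.conj (f b) * e.conj γ)
    rw [← hmul, ← hmul, h1 b hb, map_neg]

end GradedOperators

/-! ### Modules over real Lie superalgebras -/

namespace LieSuperalgebra

open GradedOperators

namespace Rep

section Graded

variable {𝕜 : Type*} [Field 𝕜] {L : Type*} [AddCommGroup L] [Module 𝕜 L] {𝔤 : LieSuperalgebra 𝕜 L}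
variable {V : Type*} [AddCommGroup V] [Module 𝕜 V] {V' : Type*} [AddCommGroup V'] [Module 𝕜 V']

theorem exists_add_eq (M : 𝔤.Rep V) (v : V) :
    ∃ a ∈ M.grading 0, ∃ b ∈ M.grading 1, a + b = v :=
  Submodule.mem_sup.1 (M.isCompl.sup_eq_top ▸ Submodule.mem_top)

theorem eq_zero_of_mem_of_mem (M : 𝔤.Rep V) {v : V} (h : v ∈ M.grading 0) (h' : v ∈ M.grading 1) :
    v = 0 :=
  Submodule.disjoint_def.1 M.isCompl.disjoint v h h'

/-- Homogeneous components are unique, so being spanned by homogeneous elements amounts to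
containing the components of each element. -/
theorem isSubmodule_iff (M : 𝔤.Rep V) (U : Submodule 𝕜 V) :
    M.IsSubmodule U ↔
      (∀ a b, a ∈ M.grading 0 → b ∈ M.grading 1 → a + b ∈ U → a ∈ U ∧ b ∈ U) ∧
        ∀ (x : L) (v : V), v ∈ U → M.ρ x v ∈ U := by
  refine and_congr_left fun _ => ⟨fun h a b ha hb hab => ?_, fun h => le_antisymm ?_ ?_⟩
  · rw [h] at hab
    obtain ⟨a', ha', b', hb', e⟩ := Submodule.mem_sup.1 hab
    have e1 : a' - a = b - b' := by rw [sub_eq_sub_iff_add_eq_add, e, add_comm]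
    have h0 : a' - a = 0 := M.eq_zero_of_mem_of_mem (sub_mem ha'.2 ha) (e1 ▸ sub_mem hb hb'.2)
    rw [sub_eq_zero.1 h0, sub_self, eq_comm, sub_eq_zero] at e1
    exact ⟨sub_eq_zero.1 h0 ▸ ha'.1, e1 ▸ hb'.1⟩
  · intro v hv
    obtain ⟨a, ha, b, hb, rfl⟩ := M.exists_add_eq v
    obtain ⟨h1, h2⟩ := h a b ha hb hv
    exact Submodule.mem_sup.2 ⟨a, ⟨h1, ha⟩, b, ⟨h2, hb⟩, rfl⟩
  · exact sup_le inf_le_left inf_le_left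

theorem isSubmodule_range {M : 𝔤.Rep V} {N : 𝔤.Rep V'} {j : V →ₗ[𝕜] V'} (hj : j ∈ hom M N) :
    N.IsSubmodule (LinearMap.range j) := by
  refine (N.isSubmodule_iff _).2 ⟨?_, ?_⟩
  · rintro a b ha hb ⟨v, hv⟩
    obtain ⟨a', ha', b', hb', rfl⟩ := M.exists_add_eq v
    rw [map_add] at hv
    have e1 : j a' - a = b - j b' := by rw [sub_eq_sub_iff_add_eq_add, hv, add_comm]
    have h0 : j a' - a = 0 := N.eq_zero_of_mem_of_mem (sub_mem (hj.1 0 a' ha') ha)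
      (e1 ▸ sub_mem hb (hj.1 1 b' hb'))
    rw [h0, eq_comm] at e1
    exact ⟨⟨a', sub_eq_zero.1 h0⟩, ⟨b', (sub_eq_zero.1 e1).symm⟩⟩
  · rintro x _ ⟨v, rfl⟩
    exact ⟨M.ρ x v, hj.2 x v⟩

/-- The restriction of a module to a submodule. -/
def subRep (M : 𝔤.Rep V) (U : Submodule 𝕜 V) (hU : M.IsSubmodule U) : 𝔤.Rep U where
  grading i := (M.grading i).comap U.subtype
  isCompl := by
    constructor
    · rw [Submodule.disjoint_def]
      exact fun x h h' => Subtype.ext (M.eq_zero_of_mem_of_mem h h')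
    · rw [codisjoint_iff, eq_top_iff]
      rintro ⟨v, hv⟩ -
      obtain ⟨a, ha, b, hb, rfl⟩ := M.exists_add_eq v
      obtain ⟨h1, h2⟩ := ((M.isSubmodule_iff U).1 hU).1 a b ha hb hv
      exact Submodule.mem_sup.2 ⟨⟨a, h1⟩, ha, ⟨b, h2⟩, hb, rfl⟩
  ρ :=
    { toFun := fun x => (M.ρ x).restrict (hU.2 x)
      map_add' := fun x y => by ext; simp
      map_smul' := fun c x => by ext; simp }
  ρ_mem := fun i j x v hx hv => M.ρ_mem i j x v hx hv
  ρ_bracket := fun i j x y hx hy => by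
    ext v
    have h := LinearMap.congr_fun (M.ρ_bracket i j x y hx hy) (v : V)
    simpa using h

end Graded

/-! ### Real modules as graded sets of operators. -/

section Real

variable {L : Type*} [AddCommGroup L] [Module ℝ L] {𝔤 : LieSuperalgebra ℝ L}
variable {V : Type*} [AddCommGroup V] [Module ℝ V] {V' : Type*} [AddCommGroup V'] [Module ℝ V']

/-- `γ` is the parity operator of `M`. -/
def IsParity (M : 𝔤.Rep V) (γ : End ℝ V) : Prop :=
  γ * γ = 1 ∧ (∀ v, v ∈ M.grading 0 ↔ γ v = v) ∧ (∀ v, v ∈ M.grading 1 ↔ γ v = -v)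

theorem exists_isParity (M : 𝔤.Rep V) : ∃ γ, M.IsParity γ := by
  obtain ⟨γ, h, h0, h1⟩ := M.exists_parity
  exact ⟨γ, LinearMap.ext h, h0, h1⟩

theorem IsParity.comm {M : 𝔤.Rep V} {γ : End ℝ V} (hγ : M.IsParity γ) {T : End ℝ V}
    (hT : ∀ (j : ZMod 2) (v : V), v ∈ M.grading j → T v ∈ M.grading j) : γ * T = T * γ := by
  ext v
  obtain ⟨a, ha, b, hb, rfl⟩ := M.exists_add_eq v
  simp [(hγ.2.1 _).1 ha, (hγ.2.2 _).1 hb, (hγ.2.1 _).1 (hT 0 a ha), (hγ.2.2 _).1 (hT 1 b hb)]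

theorem IsParity.anticomm {M : 𝔤.Rep V} {γ : End ℝ V} (hγ : M.IsParity γ) {T : End ℝ V}
    (hT : ∀ (j : ZMod 2) (v : V), v ∈ M.grading j → T v ∈ M.grading (j + 1)) :
    γ * T = -(T * γ) := by
  ext v
  obtain ⟨a, ha, b, hb, rfl⟩ := M.exists_add_eq v
  simp [(hγ.2.1 _).1 ha, (hγ.2.2 _).1 hb, (hγ.2.2 _).1 (hT 0 a ha), (hγ.2.1 _).1 (hT 1 b hb),
    add_comm]

/-- Over ℝ the homogeneous components of v are (v ± γv)/2, so stability under `γ` means being a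
graded subspace. -/
theorem IsIrreducible.isGradedSimple {M : 𝔤.Rep V} (hM : M.IsIrreducible) {γ : End ℝ V}
    (hγ : M.IsParity γ) : IsGradedSimple γ (Set.range M.ρ) := by
  refine ⟨hM.1, fun U hU hS => hM.2 U ((M.isSubmodule_iff U).2
    ⟨fun a b ha hb hab => ?_, fun x v hv => hS _ ⟨x, rfl⟩ v hv⟩)⟩
  have h := hU _ hab
  rw [map_add, (hγ.2.1 _).1 ha, (hγ.2.2 _).1 hb] at h
  have h1 := U.smul_mem (1 / 2 : ℝ) (add_mem hab h)
  have h2 := U.smul_mem (1 / 2 : ℝ) (sub_mem hab h)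
  have e1 : (1 / 2 : ℝ) • ((a + b) + (a + -b)) = a := by module
  have e2 : (1 / 2 : ℝ) • ((a + b) - (a + -b)) = b := by module
  exact ⟨e1 ▸ h1, e2 ▸ h2⟩

/-- The underlying algebra of the enriched endomorphisms is the full commutant, and even and odd
elements are told apart by commuting or anticommuting with `γ`. -/
theorem enrichedEnd_isIso {M : 𝔤.Rep V} {γ : End ℝ V} (hγ : M.IsParity γ) {B : Superalgebra ℝ}
    (h : HasCommutant γ (Set.range M.ρ) B) : M.enrichedEnd.IsIso B := by
  obtain ⟨f, hf, hT, h0, h1⟩ := h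
  have hfc : ∀ b, f b ∈ Subalgebra.centralizer ℝ (Set.range M.ρ : Set (End ℝ V)) := fun b =>
    (Subalgebra.mem_centralizer_iff ℝ).2 ((hT _).2 ⟨b, rfl⟩)
  let g : B.carrier →ₐ[ℝ] Subalgebra.centralizer ℝ (Set.range M.ρ : Set (End ℝ V)) :=
    f.codRestrict _ hfc
  have hg : Function.Bijective g := by
    refine ⟨fun a b hab => hf (congrArg Subtype.val hab), fun T => ?_⟩
    obtain ⟨b, hb⟩ := (hT T.1).1 ((Subalgebra.mem_centralizer_iff ℝ).1 T.2)
    exact ⟨b, Subtype.ext hb⟩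
  let e : B.carrier ≃ₐ[ℝ] M.enrichedEnd.carrier := AlgEquiv.ofBijective g hg
  have hcomm : ∀ b x v, f b (M.ρ x v) = M.ρ x (f b v) := fun b x v =>
    (LinearMap.congr_fun ((hT _).2 ⟨b, rfl⟩ (M.ρ x) ⟨x, rfl⟩) v).symm
  have hmem : ∀ i, ∀ b ∈ B.grading i, e b ∈ M.enrichedEnd.grading i := by
    have h2 : ∀ i : ZMod 2, i = 0 ∨ i = 1 := by decide
    intro i b hb
    refine ⟨fun j v hv => ?_, fun x v => hcomm b x v⟩
    change f b v ∈ M.grading (j + i)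
    rcases h2 i with rfl | rfl
    · have hc : γ (f b v) = f b (γ v) := LinearMap.congr_fun (h0 b hb) v
      rcases h2 j with rfl | rfl
      · refine (hγ.2.1 _).2 ?_
        rw [hc, (hγ.2.1 _).1 hv]
      · refine (hγ.2.2 _).2 ?_
        rw [hc, (hγ.2.2 _).1 hv, map_neg]
    · have hc : γ (f b v) = -f b (γ v) := LinearMap.congr_fun (h1 b hb) v
      rcases h2 j with rfl | rfl
      · refine (hγ.2.2 _).2 ?_
        rw [hc, (hγ.2.1 _).1 hv]
      · refine (hγ.2.1 _).2 ?_
        rw [hc, (hγ.2.2 _).1 hv, map_neg, neg_neg]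
  have hdec : ∀ b : B.carrier, ∃ b₀ ∈ B.grading 0, ∃ b₁ ∈ B.grading 1, b₀ + b₁ = b := fun b =>
    Submodule.mem_sup.1 (B.isCompl.sup_eq_top ▸ Submodule.mem_top)
  have hdis := Submodule.disjoint_def.1 M.enrichedEnd.isCompl.disjoint
  -- Both sides are direct sums of their graded parts, so a bijection mapping each part into its
  -- counterpart maps it onto.
  have hmem' : ∀ i, ∀ b, e b ∈ M.enrichedEnd.grading i → b ∈ B.grading i := by
    have h2 : ∀ i : ZMod 2, i = 0 ∨ i = 1 := by decide
    intro i b hb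
    obtain ⟨b₀, hb₀, b₁, hb₁, rfl⟩ := hdec b
    rw [map_add] at hb
    rcases h2 i with rfl | rfl
    · have := hdis (e b₁) (by
        have := sub_mem hb (hmem 0 b₀ hb₀)
        rwa [add_sub_cancel_left] at this) (hmem 1 b₁ hb₁)
      replace this := e.injective (this.trans (map_zero e).symm)
      simpa [this] using hb₀
    · have := hdis (e b₀) (hmem 0 b₀ hb₀) (by
        have := sub_mem hb (hmem 1 b₁ hb₁)
        rwa [add_sub_cancel_right] at this)
      replace this := e.injective (this.trans (map_zero e).symm)
      simpa [this] using hb₁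
  refine ⟨e.symm, fun i => ?_⟩
  ext b
  constructor
  · rintro ⟨T, hTi, rfl⟩
    refine hmem' i _ ?_
    change e (e.symm T) ∈ _
    rwa [e.apply_symm_apply]
  · exact fun hb => ⟨e b, hmem i b hb, e.symm_apply_apply b⟩

end Real

end Rep

end LieSuperalgebra

namespace LieSuperalgebra

open GradedOperators

/-! ### Restriction to the real form -/

section ComplexStructure

variable {W : Type*} [AddCommGroup W] [Module ℂ W]

/-- Multiplication by the imaginary unit. -/
noncomputable def imaginaryUnit (W : Type*) [AddCommGroup W] [Module ℂ W] : End ℝ W :=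
  (LinearMap.lsmul ℂ W Complex.I).restrictScalars ℝ

@[simp]
theorem imaginaryUnit_apply (v : W) : imaginaryUnit W v = Complex.I • v := rfl

theorem imaginaryUnit_mul_self : imaginaryUnit W * imaginaryUnit W = -1 := by
  ext v
  simp [smul_smul]

theorem complex_smul_eq (z : ℂ) (v : W) : z • v = z.re • v + z.im • (Complex.I • v) := by
  conv_lhs => rw [← Complex.re_add_im z]
  rw [add_smul, mul_smul, Complex.coe_smul, Complex.coe_smul]

/-- The complex subspace given by a real subspace stable under multiplication by `i`. -/
def complexSubspace (U : Submodule ℝ W) (hU : ∀ v ∈ U, Complex.I • v ∈ U) : Submodule ℂ W where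
  carrier := U
  add_mem' := U.add_mem
  zero_mem' := U.zero_mem
  smul_mem' z v hv := by
    rw [complex_smul_eq]
    exact U.add_mem (U.smul_mem _ hv) (U.smul_mem _ (hU v hv))

end ComplexStructure

section RestrictScalars

variable {L : Type*} [AddCommGroup L] [Module ℂ L] {𝔤 : LieSuperalgebra ℂ L}
variable {W : Type*} [AddCommGroup W] [Module ℂ W]

/-- The real and imaginary parts are (z + τz)/2 and (z − τz)/2i; they are homogeneous whenever z is,
because τ is even. -/
theorem AntilinearInvolution.exists_add_smul (τ : 𝔤.AntilinearInvolution) (z : L) :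
    ∃ x y : τ.fixed, z = x + Complex.I • (y : L) ∧
      ∀ i, z ∈ 𝔤.grading i → (x : L) ∈ 𝔤.grading i ∧ (y : L) ∈ 𝔤.grading i := by
  refine ⟨⟨(1 / 2 : ℂ) • (z + τ.toMap z), ?_⟩, ⟨(-(Complex.I / 2)) • (z - τ.toMap z), ?_⟩, ?_,
    fun i hz => ⟨?_, ?_⟩⟩
  · change τ.toMap _ = _
    rw [map_smulₛₗ, map_add, τ.map_map]
    simp [add_comm, map_ofNat]
  · change τ.toMap _ = _
    rw [map_smulₛₗ, map_sub, τ.map_map, ← neg_sub z, smul_neg, ← neg_smul]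
    congr 1
    simp [neg_div, map_ofNat]
  · have h : Complex.I * (-(Complex.I / 2)) = 1 / 2 := by
      rw [mul_neg, mul_div_assoc', Complex.I_mul_I]; ring
    simp only [smul_smul, h]
    module
  · exact Submodule.smul_mem _ _ (add_mem hz (τ.map_mem i z hz))
  · exact Submodule.smul_mem _ _ (sub_mem hz (τ.map_mem i z hz))

theorem restrict_apply (τ : 𝔤.AntilinearInvolution) (M : 𝔤.Rep W) (x : τ.fixed) (v : W) :
    (τ.restrict M).ρ x v = M.ρ x v := rfl

theorem isSubmodule_complexSubspace {τ : 𝔤.AntilinearInvolution} {M : 𝔤.Rep W}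
    {U : Submodule ℝ W} (h : (τ.restrict M).IsSubmodule U) (hU : ∀ v ∈ U, Complex.I • v ∈ U) :
    M.IsSubmodule (complexSubspace U hU) := by
  have h' := (Rep.isSubmodule_iff _ _).1 h
  refine (M.isSubmodule_iff _).2 ⟨h'.1, fun z v hv => ?_⟩
  obtain ⟨x, y, rfl, -⟩ := τ.exists_add_smul z
  rw [map_add, map_smul, LinearMap.add_apply, LinearMap.smul_apply]
  exact U.add_mem (h'.2 x v hv) (hU _ (h'.2 y v hv))

/-- A real submodule stable under i is a complex subspace stable under the real form, hence under
its complex span, which is the whole superalgebra. -/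
theorem complexSubspace_dichotomy {τ : 𝔤.AntilinearInvolution} {M : 𝔤.Rep W}
    (hM : M.IsIrreducible) {U : Submodule ℝ W} (h : (τ.restrict M).IsSubmodule U)
    (hU : ∀ v ∈ U, Complex.I • v ∈ U) : U = ⊥ ∨ U = ⊤ := by
  refine (hM.2 _ (isSubmodule_complexSubspace h hU)).imp (fun e => ?_) fun e => ?_
  · rw [eq_bot_iff]
    intro v hv
    have : v ∈ complexSubspace U hU := hv
    rw [e] at this
    simpa using this
  · rw [eq_top_iff]
    intro v _
    have : v ∈ complexSubspace U hU := e ▸ Submodule.mem_top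
    exact this

/-- A proper nonzero submodule `U` of the restriction of an irreducible module `W` to the real form
satisfies `W = U ⊕ iU`. -/
theorem real_submodule_decomposition {τ : 𝔤.AntilinearInvolution} {M : 𝔤.Rep W}
    (hM : M.IsIrreducible) {U : Submodule ℝ W} (h : (τ.restrict M).IsSubmodule U) (hb : U ≠ ⊥)
    (ht : U ≠ ⊤) :
    (∀ v ∈ U, Complex.I • v ∈ U → v = 0) ∧ ∀ w, ∃ a ∈ U, ∃ b ∈ U, a + Complex.I • b = w := by
  have h' := (Rep.isSubmodule_iff _ _).1 h
  have hI : ∀ v : W, Complex.I • Complex.I • v = -v := fun v => by simp [smul_smul]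
  have hgr : ∀ i, ∀ v ∈ M.grading i, Complex.I • v ∈ M.grading i := fun i v hv =>
    (M.grading i).smul_mem _ hv
  have hρ : ∀ (x : τ.fixed) (v : W), (τ.restrict M).ρ x (Complex.I • v) =
      Complex.I • (τ.restrict M).ρ x v := fun x v => map_smul (M.ρ x) Complex.I v
  constructor
  -- The vectors v with v and iv in `U` form an i-stable submodule, which is proper because `U` is.
  · let U₁ : Submodule ℝ W := U ⊓ U.comap (imaginaryUnit W)
    have h1 : (τ.restrict M).IsSubmodule U₁ := by
      refine (Rep.isSubmodule_iff _ _).2 ⟨fun a b ha hb hab => ?_, fun x v hv => ?_⟩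
      · have e1 := h'.1 a b ha hb hab.1
        have e2 := h'.1 (Complex.I • a) (Complex.I • b) (hgr 0 a ha) (hgr 1 b hb)
          (by rw [← smul_add]; exact hab.2)
        exact ⟨⟨e1.1, e2.1⟩, ⟨e1.2, e2.2⟩⟩
      · exact ⟨h'.2 x v hv.1, by
          have := h'.2 x _ hv.2
          rw [imaginaryUnit_apply, hρ] at this
          exact this⟩
    rcases complexSubspace_dichotomy hM h1 (fun v hv => ⟨hv.2, by
      change Complex.I • Complex.I • v ∈ U
      rw [hI]; exact neg_mem hv.1⟩) with e | e
    · intro v hv hv'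
      have : v ∈ U₁ := ⟨hv, hv'⟩
      rw [e] at this
      simpa using this
    · exact absurd (top_le_iff.1 (e ▸ inf_le_left)) ht
  -- Dually, U + iU is i-stable and nonzero.
  · let U₂ : Submodule ℝ W := U ⊔ U.map (imaginaryUnit W)
    have hU₂ : ∀ w, w ∈ U₂ ↔ ∃ a ∈ U, ∃ b ∈ U, a + Complex.I • b = w := fun w => by
      simp only [U₂, Submodule.mem_sup, Submodule.mem_map]
      constructor
      · rintro ⟨a, ha, _, ⟨b, hb, rfl⟩, rfl⟩
        exact ⟨a, ha, b, hb, rfl⟩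
      · rintro ⟨a, ha, b, hb, rfl⟩
        exact ⟨a, ha, _, ⟨b, hb, rfl⟩, rfl⟩
    have h2 : (τ.restrict M).IsSubmodule U₂ := by
      refine (Rep.isSubmodule_iff _ _).2 ⟨fun a b ha hb hab => ?_, fun x v hv => ?_⟩
      · obtain ⟨u, hu, v, hv, e⟩ := (hU₂ _).1 hab
        obtain ⟨u₀, hu₀, u₁, hu₁, rfl⟩ := (τ.restrict M).exists_add_eq u
        obtain ⟨v₀, hv₀, v₁, hv₁, rfl⟩ := (τ.restrict M).exists_add_eq v
        have hu' := h'.1 _ _ hu₀ hu₁ hu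
        have hv' := h'.1 _ _ hv₀ hv₁ hv
        have e1 : u₀ + Complex.I • v₀ - a = b - (u₁ + Complex.I • v₁) := by
          rw [sub_eq_sub_iff_add_eq_add, add_comm b a, ← e]; module
        have e0 : u₀ + Complex.I • v₀ - a = 0 := M.eq_zero_of_mem_of_mem
          (sub_mem (add_mem hu₀ (hgr 0 _ hv₀)) ha)
          (e1 ▸ sub_mem hb (add_mem hu₁ (hgr 1 _ hv₁)))
        rw [e0, eq_comm] at e1
        exact ⟨(hU₂ a).2 ⟨u₀, hu'.1, v₀, hv'.1, sub_eq_zero.1 e0⟩,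
          (hU₂ b).2 ⟨u₁, hu'.2, v₁, hv'.2, (sub_eq_zero.1 e1).symm⟩⟩
      · obtain ⟨a, ha, b, hb, rfl⟩ := (hU₂ v).1 hv
        exact (hU₂ _).2 ⟨_, h'.2 x a ha, _, h'.2 x b hb, by rw [map_add, hρ]⟩
    rcases complexSubspace_dichotomy hM h2 (fun v hv => by
      obtain ⟨a, ha, b, hb, rfl⟩ := (hU₂ v).1 hv
      exact (hU₂ _).2 ⟨-b, neg_mem hb, a, ha, by rw [smul_add, hI]; abel⟩) with e | e
    · exact absurd (le_bot_iff.1 (e ▸ le_sup_left)) hb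
    · exact fun w => (hU₂ w).1 (e ▸ Submodule.mem_top)

theorem Rep.isIso_of_bijective {𝕜 : Type*} [Field 𝕜] {L : Type*} [AddCommGroup L] [Module 𝕜 L]
    {𝔤 : LieSuperalgebra 𝕜 L} {V V' : Type*} [AddCommGroup V] [Module 𝕜 V] [AddCommGroup V']
    [Module 𝕜 V'] {M : 𝔤.Rep V} {N : 𝔤.Rep V'} {j : V →ₗ[𝕜] V'} (hj : j ∈ hom M N)
    (hbij : Function.Bijective j) : (LinearEquiv.ofBijective j hbij).symm.toLinearMap ∈ hom N M := by
  set e := LinearEquiv.ofBijective j hbij with he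
  have hej : ∀ v, j (e.symm v) = v := fun v => e.apply_symm_apply v
  refine ⟨fun i v hv => ?_, fun x v => hbij.1 ?_⟩
  · have h2 : ∀ i : ZMod 2, i = 0 ∨ i = 1 := by decide
    change e.symm v ∈ _
    obtain ⟨a, ha, b, hb, e'⟩ := M.exists_add_eq (e.symm v)
    have e1 : j a + j b = v := by rw [← map_add, e', hej]
    rcases h2 i with rfl | rfl
    · have hb' : j b ∈ N.grading 0 := by
        rw [← eq_sub_iff_add_eq'] at e1
        rw [e1]; exact sub_mem hv (hj.1 0 a ha)
      have : b = 0 := hbij.1 ((N.eq_zero_of_mem_of_mem hb' (hj.1 1 b hb)).trans (map_zero j).symm)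
      rw [← e', this, add_zero]; exact ha
    · have ha' : j a ∈ N.grading 1 := by
        rw [← eq_sub_iff_add_eq] at e1
        rw [e1]; exact sub_mem hv (hj.1 1 b hb)
      have : a = 0 := hbij.1 ((N.eq_zero_of_mem_of_mem (hj.1 0 a ha) ha').trans (map_zero j).symm)
      rw [← e', this, zero_add]; exact hb
  · change j (e.symm (N.ρ x v)) = j (M.ρ x (e.symm v))
    rw [hej, hj.2, hej]

universe v

/-- Every irreducible module has an associated irreducible module of the real form. -/
theorem exists_isPhi (τ : 𝔤.AntilinearInvolution) {W : Type v} [AddCommGroup W] [Module ℂ W]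
    (M : 𝔤.Rep W) (hM : M.IsIrreducible) :
    ∃ (V : Type v) (_ : AddCommGroup V) (_ : Module ℝ V) (N : τ.realForm.Rep V), IsPhi τ M N := by
  by_cases hirr : (τ.restrict M).IsIrreducible
  · exact ⟨W, inferInstance, inferInstance, τ.restrict M, hirr, Or.inl
      ⟨LinearEquiv.refl ℝ W, ⟨fun _ _ h => h, fun _ _ => rfl⟩, ⟨fun _ _ h => h, fun _ _ => rfl⟩⟩⟩
  · obtain ⟨U, hU, hb, ht⟩ : ∃ U, (τ.restrict M).IsSubmodule U ∧ U ≠ ⊥ ∧ U ≠ ⊤ := by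
      by_contra hne
      refine hirr ⟨hM.1, fun U hU => ?_⟩
      by_contra hU'
      rw [not_or] at hU'
      exact hne ⟨U, hU, hU'⟩
    obtain ⟨h1, h2⟩ := real_submodule_decomposition hM hU hb ht
    refine ⟨U, inferInstance, inferInstance, (τ.restrict M).subRep U hU, ⟨?_, fun U' hU' => ?_⟩,
      Or.inr ?_⟩
    · exact (Submodule.nontrivial_iff_ne_bot).2 hb
    -- A proper nonzero submodule U' of `U` would also give W = U' + iU'. For u = a + ib in `U` with
    -- a, b in U', the vector ib lies in U ∩ iU = 0, so u lies in U', a contradiction.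
    · by_contra hne
      rw [not_or] at hne
      have hsub : (τ.restrict M).IsSubmodule (U'.map U.subtype) := by
        have h3 := (Rep.isSubmodule_iff _ _).1 hU
        have h4 := (Rep.isSubmodule_iff _ _).1 hU'
        refine (Rep.isSubmodule_iff _ _).2 ⟨?_, ?_⟩
        · rintro a b ha hb ⟨u, hu, e⟩
          have hab := h3.1 a b ha hb (e ▸ u.2)
          have := h4.1 ⟨a, hab.1⟩ ⟨b, hab.2⟩ ha hb (by
            rwa [show (⟨a, hab.1⟩ + ⟨b, hab.2⟩ : U) = u from Subtype.ext e.symm])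
          exact ⟨⟨_, this.1, rfl⟩, ⟨_, this.2, rfl⟩⟩
        · rintro x _ ⟨u, hu, rfl⟩
          exact ⟨_, h4.2 x u hu, rfl⟩
      have hle : U'.map U.subtype ≤ U := Submodule.map_subtype_le U U'
      obtain ⟨-, h6⟩ := real_submodule_decomposition hM hsub
        (fun e => hne.1 (Submodule.map_injective_of_injective
          U.injective_subtype (e.trans (Submodule.map_bot _).symm)))
        (fun e => ht (top_le_iff.1 (e ▸ hle)))
      refine hne.2 (eq_top_iff.2 fun u _ => ?_)
      obtain ⟨a, ha, b, hb', e⟩ := h6 u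
      have hb0 : b = 0 := h1 b (hle hb') (by
        rw [← eq_sub_iff_add_eq'] at e
        rw [e]; exact sub_mem u.2 (hle ha))
      obtain ⟨a', ha', rfl⟩ := ha
      rw [hb0, smul_zero, add_zero] at e
      exact (Subtype.ext e : a' = u) ▸ ha'
    -- The action commutes with i, so iU is a second copy of `U` and (a, b) ↦ a + ib is an
    -- isomorphism of modules.
    · let φ : U × U →ₗ[ℝ] W := U.subtype ∘ₗ LinearMap.fst ℝ U U +
        imaginaryUnit W ∘ₗ U.subtype ∘ₗ LinearMap.snd ℝ U U
      have hφ : ∀ p, φ p = (p.1 : W) + Complex.I • (p.2 : W) := fun p => rfl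
      have hbij : Function.Bijective φ := by
        constructor
        · rw [← LinearMap.ker_eq_bot, LinearMap.ker_eq_bot']
          rintro ⟨a, b⟩ hab
          rw [hφ] at hab
          have hb0 : (b : W) = 0 := h1 b b.2 (by
            rw [← neg_eq_iff_add_eq_zero] at hab
            rw [← hab]; exact neg_mem a.2)
          rw [hb0, smul_zero, add_zero] at hab
          exact Prod.ext (Subtype.ext hab) (Subtype.ext hb0)
        · intro w
          obtain ⟨a, ha, b, hb', e⟩ := h2 w
          exact ⟨(⟨a, ha⟩, ⟨b, hb'⟩), e⟩
      have hhom : φ ∈ Rep.hom (((τ.restrict M).subRep U hU).directSum ((τ.restrict M).subRep U hU))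
          (τ.restrict M) := by
        refine ⟨fun i p hp => ?_, fun x p => ?_⟩
        · exact add_mem (S := Submodule ℝ W) hp.1 ((M.grading i).smul_mem Complex.I hp.2)
        · change M.ρ x p.1 + Complex.I • M.ρ x p.2 = M.ρ x (p.1 + Complex.I • (p.2 : W))
          rw [map_add, map_smul]
      exact ⟨(LinearEquiv.ofBijective φ hbij).symm, Rep.isIso_of_bijective hhom hbij, hhom⟩

/-- Both cases W ≅ V and W ≅ V ⊕ V are used only through an embedding of V into W, along which
operator identities are pulled back. -/
theorem IsPhi.exists_hom {τ : 𝔤.AntilinearInvolution} {W : Type v} [AddCommGroup W] [Module ℂ W]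
    {M : 𝔤.Rep W} {V : Type v} [AddCommGroup V] [Module ℝ V] {N : τ.realForm.Rep V}
    (h : IsPhi τ M N) : ∃ j ∈ Rep.hom N (τ.restrict M), Function.Injective j := by
  obtain ⟨-, ⟨e, -, he⟩ | ⟨e, -, he⟩⟩ := h
  · exact ⟨_, he, e.symm.injective⟩
  · refine ⟨e.symm.toLinearMap ∘ₗ LinearMap.inl ℝ V V, ⟨fun i v hv => ?_, fun x v => ?_⟩,
      e.symm.injective.comp LinearMap.inl_injective⟩
    · exact he.1 i (v, 0) ⟨hv, zero_mem _⟩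
    · have := he.2 x (v, 0)
      change e.symm ((N.ρ x v, N.ρ x 0)) = _ at this
      rw [map_zero] at this
      exact this

end RestrictScalars

end LieSuperalgebra

namespace LieSuperalgebra

open GradedOperators

/-! ### Clifford actions of real Lie superalgebras -/

/-- An odd operator of square zero which commutes or anticommutes with the action of the homogeneous
elements on an irreducible module vanishes. -/
theorem Rep.IsIrreducible.eq_zero_of_sq_eq_zero {L : Type*} [AddCommGroup L] [Module ℝ L]
    {𝔤 : LieSuperalgebra ℝ L} {V : Type*} [AddCommGroup V] [Module ℝ V] {N : 𝔤.Rep V}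
    (hN : N.IsIrreducible) {γ r : End ℝ V} (hγ : N.IsParity γ) (hγr : γ * r = -(r * γ))
    (hr : r * r = 0) (h0 : ∀ x ∈ 𝔤.grading 0, r * N.ρ x = N.ρ x * r)
    (h1 : ∀ x ∈ 𝔤.grading 1, r * N.ρ x = -(N.ρ x * r)) : r = 0 := by
  refine ((hN.isGradedSimple hγ).of_subset_adjoin (S' := N.ρ '' (𝔤.grading 0 ∪ 𝔤.grading 1))
    ?_).eq_zero_of_sq_eq_zero hγr hr ?_
  · rintro _ ⟨y, rfl⟩
    obtain ⟨y₀, hy₀, y₁, hy₁, rfl⟩ :=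
      Submodule.mem_sup.1 (𝔤.isCompl.sup_eq_top ▸ (Submodule.mem_top : y ∈ ⊤))
    rw [map_add]
    exact add_mem (Algebra.subset_adjoin ⟨y₀, Or.inl hy₀, rfl⟩)
      (Algebra.subset_adjoin ⟨y₁, Or.inr hy₁, rfl⟩)
  · rintro _ ⟨y, hy | hy, rfl⟩
    exacts [Or.inl (h0 y hy), Or.inr (h1 y hy)]

/-- The commutant of an irreducible module on which the even part acts by scalars and the odd part
acts through the Clifford algebra of a form of signature `(p, q)` on a quotient. -/
theorem Rep.IsIrreducible.enrichedEnd_isIso {L : Type*} [AddCommGroup L] [Module ℝ L]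
    {𝔤 : LieSuperalgebra ℝ L} {V : Type*} [AddCommGroup V] [Module ℝ V] {N : 𝔤.Rep V}
    (hN : N.IsIrreducible) (h0 : ∀ x ∈ 𝔤.grading 0, ∃ c : ℝ, N.ρ x = c • 1)
    (b : 𝔤.grading 1 →ₗ[ℝ] 𝔤.grading 1 →ₗ[ℝ] ℝ)
    (hb : ∀ x y : 𝔤.grading 1, N.ρ x * N.ρ y + N.ρ y * N.ρ x = b x y • 1) {p q : ℕ}
    (e : Fin p ⊕ Fin q → 𝔤.grading 1)
    (he : ∀ i, b (e i) (e i) = Sum.elim (fun _ => 1) (fun _ => -1) i)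
    (he' : ∀ i j, i ≠ j → b (e i) (e j) = 0)
    (hspan : ∀ x : 𝔤.grading 1, ∃ c : Fin p ⊕ Fin q → ℝ, b (x - ∑ i, c i • e i) = 0) :
    N.enrichedEnd.IsIso
      (BrauerWall.real ((q : ZMod 8) - (p : ZMod 8))).divisionSuperalgebra := by
  obtain ⟨γ, hγ⟩ := N.exists_isParity
  refine Rep.enrichedEnd_isIso hγ ?_
  have hS := hN.isGradedSimple hγ
  have hodd : ∀ x : 𝔤.grading 1, γ * N.ρ x = -(N.ρ x * γ) := fun x => hγ.anticomm fun j v hv => by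
    rw [add_comm]; exact N.ρ_mem 1 j x v x.2 hv
  -- A radical vector anticommutes with every odd element, itself included, so its square is zero;
  -- it commutes with the even part, which acts by scalars.
  have hrad : ∀ x : 𝔤.grading 1, b x = 0 → N.ρ x = 0 := by
    intro x hx
    have hanti : ∀ y : 𝔤.grading 1, N.ρ x * N.ρ y = -(N.ρ y * N.ρ x) := fun y => by
      have := hb x y
      rwa [hx, LinearMap.zero_apply, zero_smul, add_eq_zero_iff_eq_neg] at this
    have : IsAddTorsionFree (End ℝ V) := IsAddTorsionFree.of_isTorsionFree ℝ _
    refine hN.eq_zero_of_sq_eq_zero hγ (hodd x) (self_eq_neg.1 (hanti x)) (fun y hy => ?_)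
      fun y hy => hanti ⟨y, hy⟩
    obtain ⟨c, hc⟩ := h0 y hy
    simp [hc]
  have h2 : Real.sqrt 2 * Real.sqrt 2 = 2 := Real.mul_self_sqrt zero_le_two
  -- The relation reads 2ρ(e)² = b(e, e); the factor √2 makes the squares exactly ±1.
  let E : Fin p ⊕ Fin q → End ℝ V := fun i => Real.sqrt 2 • N.ρ (e i)
  have hEodd : ∀ i, γ * E i = -(E i * γ) := fun i => by
    simp only [E, mul_smul_comm, smul_mul_assoc, hodd, smul_neg]
  have hEsq : ∀ i, E i * E i = (Sum.elim (fun _ => 1) (fun _ => -1) i : ℝ) • 1 := fun i => by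
    have := hb (e i) (e i)
    rw [← two_smul ℝ, he] at this
    simp only [E, mul_smul_comm, smul_mul_assoc, smul_smul, h2, this]
  have hEanti : ∀ i j, i ≠ j → E i * E j = -(E j * E i) := fun i j hij => by
    have := hb (e i) (e j)
    rw [he' i j hij, zero_smul, add_eq_zero_iff_eq_neg] at this
    simp only [E, mul_smul_comm, smul_mul_assoc, this, smul_neg]
  let P := (List.finRange p).map fun i => E (Sum.inl i)
  let Q := (List.finRange q).map fun i => E (Sum.inr i)
  have hmem : ∀ t, t ∈ P ++ Q ↔ ∃ i, E i = t := fun t => by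
    simp [P, Q]
  have hcl : IsClifford γ 1 P Q :=
    { sq_parity := hγ.1
      sq_sign := one_mul 1
      odd := fun t ht => by
        obtain ⟨i, rfl⟩ := (hmem t).1 ht
        exact hEodd i
      sq_left := fun t ht => by
        obtain ⟨i, -, rfl⟩ := List.mem_map.1 ht
        exact hEsq (Sum.inl i)
      sq_right := fun t ht => by
        obtain ⟨i, -, rfl⟩ := List.mem_map.1 ht
        exact hEsq (Sum.inr i)
      anticomm := by
        rw [List.pairwise_append]
        refine ⟨?_, ?_, ?_⟩
        · rw [List.pairwise_map]
          exact (List.nodup_finRange p).imp fun h => hEanti _ _ (by simpa using h)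
        · rw [List.pairwise_map]
          exact (List.nodup_finRange q).imp fun h => hEanti _ _ (by simpa using h)
        · intro s hs t ht
          obtain ⟨i, -, rfl⟩ := List.mem_map.1 hs
          obtain ⟨j, -, rfl⟩ := List.mem_map.1 ht
          exact hEanti _ _ (by simp) }
  have hs1 : ∀ s ∈ Set.range N.ρ, s ∈ Algebra.adjoin ℝ ({t | t ∈ P ++ Q} : Set (End ℝ V)) := by
    rintro _ ⟨x, rfl⟩
    obtain ⟨x₀, hx₀, x₁, hx₁, rfl⟩ :=
      Submodule.mem_sup.1 (𝔤.isCompl.sup_eq_top ▸ (Submodule.mem_top : x ∈ ⊤))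
    rw [map_add]
    refine add_mem ?_ ?_
    · obtain ⟨c, hc⟩ := h0 x₀ hx₀
      rw [hc]
      exact Subalgebra.smul_mem _ (one_mem _) c
    · obtain ⟨c, hc⟩ := hspan ⟨x₁, hx₁⟩
      have := hrad _ hc
      have hx : N.ρ x₁ = ∑ i, c i • N.ρ (e i) := by
        simpa [sub_eq_zero, Submodule.coe_sub] using this
      rw [hx]
      refine Subalgebra.sum_mem _ fun i _ => Subalgebra.smul_mem _ ?_ _
      have hi : N.ρ (e i) = (Real.sqrt 2)⁻¹ • E i := by
        rw [smul_smul, inv_mul_cancel₀ (by positivity), one_smul]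
      rw [hi]
      exact Subalgebra.smul_mem _ (Algebra.subset_adjoin (s := {t | t ∈ P ++ Q}) ((hmem _).2 ⟨i, rfl⟩)) _
  have hs2 : ∀ s ∈ ({t | t ∈ P ++ Q} : Set (End ℝ V)), s ∈ Algebra.adjoin ℝ (Set.range N.ρ) := by
    intro s hs
    obtain ⟨i, rfl⟩ := (hmem s).1 hs
    exact Subalgebra.smul_mem _ (Algebra.subset_adjoin (Set.mem_range_self _)) _
  have := (hcl.hasCommutant P Q (hS.of_subset_adjoin hs1)).congr_adjoin hs2 hs1
  simpa [P, Q] using this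

/-- A basis of a quotient which diagonalizes a quadratic form, lifted to the whole space. -/
theorem exists_lift_of_equivalent {X : Type*} [AddCommGroup X] [Module ℝ X] (R : Submodule ℝ X)
    (b : X →ₗ[ℝ] X →ₗ[ℝ] ℝ) (hb : ∀ x y, b x y = b y x) (B : LinearMap.BilinForm ℝ (X ⧸ R))
    (hB : ∀ x y, B (Submodule.Quotient.mk x) (Submodule.Quotient.mk y) = b x y)
    {ι : Type*} [Fintype ι] [DecidableEq ι] (w : ι → ℝ)
    (h : QuadraticMap.Equivalent B.toQuadraticMap (QuadraticMap.weightedSumSquares ℝ w)) :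
    ∃ e : ι → X, (∀ i, b (e i) (e i) = w i) ∧ (∀ i j, i ≠ j → b (e i) (e j) = 0) ∧
      ∀ x, ∃ c : ι → ℝ, x - ∑ i, c i • e i ∈ R := by
  obtain ⟨f⟩ := h
  -- Arbitrary lifts of the basis that diagonalizes the form on the quotient.
  choose e he using fun i => Submodule.Quotient.mk_surjective R (f.toLinearEquiv.symm (Pi.single i 1))
  have hf : ∀ i, f.toLinearEquiv (Submodule.Quotient.mk (e i)) = Pi.single i 1 := fun i => by
    rw [he, LinearEquiv.apply_symm_apply]
  have hQ : ∀ x, b x x = QuadraticMap.weightedSumSquares ℝ w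
      (f.toLinearEquiv (Submodule.Quotient.mk x)) := fun x => by
    rw [← hB]
    exact (f.map_app _).symm
  have h1 : ∀ i, b (e i) (e i) = w i := fun i => by
    rw [hQ, hf]
    simp [QuadraticMap.weightedSumSquares_apply, Pi.single_apply]
  refine ⟨e, h1, fun i j hij => ?_, fun x => ⟨f.toLinearEquiv (Submodule.Quotient.mk x), ?_⟩⟩
  -- Orthogonality by polarization, since only the quadratic form is given.
  · have h2 : b (e i + e j) (e i + e j) = w i + w j := by
      rw [hQ, Submodule.Quotient.mk_add, map_add, hf, hf, QuadraticMap.weightedSumSquares_apply]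
      have : ∀ k, w k * (((Pi.single i 1 : ι → ℝ) k + (Pi.single j 1 : ι → ℝ) k) *
          ((Pi.single i 1 : ι → ℝ) k + (Pi.single j 1 : ι → ℝ) k)) =
          (if k = i then w k else 0) + (if k = j then w k else 0) := fun k => by
        by_cases hi : k = i
        · subst hi
          simp [hij]
        · by_cases hj : k = j
          · subst hj
            simp [hi]
          · simp [hi, hj]
      simp [this, Finset.sum_add_distrib]
    simp only [map_add, LinearMap.add_apply] at h2
    rw [h1, h1, hb (e j) (e i)] at h2
    linarith
  · rw [← Submodule.Quotient.mk_eq_zero, ← LinearEquiv.map_eq_zero_iff f.toLinearEquiv]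
    rw [← Submodule.mkQ_apply, map_sub, map_sum, map_sub, map_sum, sub_eq_zero]
    simp only [map_smul, Submodule.mkQ_apply, hf]
    ext k
    simp [Finset.sum_apply, Pi.single_apply]

/-! ### Modules with a central character and their endotypes. -/

section CentralCharacter

variable {L : Type*} [AddCommGroup L] [Module ℂ L] {𝔥 : LieSuperalgebra ℂ L}
variable {W : Type*} [AddCommGroup W] [Module ℂ W] {M : 𝔥.Rep W} {lam : Dual ℂ (𝔥.grading 0)}

theorem HasCentralCharacter.anticommutator (hlam : HasCentralCharacter M lam)
    (x y : 𝔥.grading 1) : M.ρ x * M.ρ y + M.ρ y * M.ρ x = oddForm lam x y • 1 := by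
  have h := M.ρ_bracket 1 1 x y x.2 y.2
  have h' : (1 : ZMod 2).val = 1 := rfl
  simp only [h', mul_one, pow_one, neg_smul, one_smul, sub_neg_eq_add] at h
  rw [← h]
  exact hlam ⟨𝔥.bracket x y, 𝔥.bracket_mem 1 1 x y x.2 y.2⟩

theorem realOddForm_symm (τ : 𝔥.AntilinearInvolution) (x y : τ.realForm.grading 1) :
    realOddForm τ lam x y = realOddForm τ lam y x :=
  congrArg Complex.re (oddForm_symm lam _ _)

theorem realOddForm_eq_zero_of_mem (τ : 𝔥.AntilinearInvolution) {x : τ.realForm.grading 1}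
    (hx : x ∈ realRadical τ lam) : realOddForm τ lam x = 0 := by
  have hx' : oddForm lam (oddInclusion τ x) = 0 := hx
  ext y
  change (oddForm lam (oddInclusion τ x) (oddInclusion τ y)).re = 0
  simp [hx']

theorem im_eq_zero_of_eq_conjDual {τ : 𝔥.AntilinearInvolution} (h : lam = conjDual τ lam)
    (x : τ.fixed) (hx : (x : L) ∈ 𝔥.grading 0) : (lam ⟨x, hx⟩).im = 0 := by
  rw [← Complex.conj_eq_iff_im]
  conv_rhs => rw [h]
  change _ = starRingEnd ℂ (lam _)
  congr 2
  exact Subtype.ext x.2.symm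

/-- The two complex functionals agree on the even part of the real form, which spans the even part
over ℂ. -/
theorem eq_conjDual_of_im_eq_zero {τ : 𝔥.AntilinearInvolution}
    (h : ∀ (x : τ.fixed) (hx : (x : L) ∈ 𝔥.grading 0), (lam ⟨x, hx⟩).im = 0) :
    lam = conjDual τ lam := by
  ext ⟨z, hz⟩
  obtain ⟨x, y, e, hxy⟩ := τ.exists_add_smul z
  obtain ⟨hx, hy⟩ := hxy 0 hz
  have e1 : (⟨z, hz⟩ : 𝔥.grading 0) = ⟨x, hx⟩ + Complex.I • ⟨y, hy⟩ := Subtype.ext e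
  have hreal : ∀ (x : τ.fixed) (hx : (x : L) ∈ 𝔥.grading 0),
      lam ⟨x, hx⟩ = conjDual τ lam ⟨x, hx⟩ := fun x hx => by
    change _ = starRingEnd ℂ (lam _)
    rw [← Complex.conj_eq_iff_im.2 (h x hx)]
    congr 2
    exact Subtype.ext x.2.symm
  rw [e1, map_add, map_add, map_smul, map_smul, hreal x hx, hreal y hy]

universe v

/-- A real λ makes both the scalars of the even part and the values of the form real, so these
identities descend from `W` to `V` through the injective `j`. -/
theorem hasEndotype_real {τ : 𝔥.AntilinearInvolution} {W : Type v} [AddCommGroup W] [Module ℂ W]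
    {M : 𝔥.Rep W} (hirr : M.IsIrreducible) (hlam : HasCentralCharacter M lam)
    (h : lam = conjDual τ lam) (p q : ℕ)
    (hpq : QuadraticMap.Equivalent (inducedForm τ lam).toQuadraticMap
      (QuadraticMap.weightedSumSquares ℝ
        (Sum.elim (fun _ : Fin p => (1 : ℝ)) (fun _ : Fin q => (-1 : ℝ))))) :
    HasEndotype τ M (BrauerWall.real ((q : ZMod 8) - (p : ZMod 8))) := by
  refine ⟨exists_isPhi τ M hirr, fun V _ _ N hN => ?_⟩
  obtain ⟨j, hj, hinj⟩ := hN.exists_hom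
  have hjρ : ∀ x v, j (N.ρ x v) = M.ρ x (j v) := hj.2
  obtain ⟨e, he, he', hspan⟩ := exists_lift_of_equivalent _ (realOddForm τ lam)
    (realOddForm_symm τ) (inducedForm τ lam) (inducedForm_mk τ lam) _ hpq
  refine hN.1.enrichedEnd_isIso (fun x hx => ⟨(lam ⟨x, hx⟩).re, ?_⟩) (realOddForm τ lam)
    (fun x y => ?_) e he he' fun x => ?_
  · ext v
    apply hinj
    have e1 : M.ρ x (j v) = lam ⟨x, hx⟩ • j v := LinearMap.congr_fun (hlam ⟨x, hx⟩) (j v)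
    rw [hjρ, e1, complex_smul_eq, im_eq_zero_of_eq_conjDual h x hx]
    simp
  · ext v
    apply hinj
    have e1 := LinearMap.congr_fun (hlam.anticommutator (oddInclusion τ x) (oddInclusion τ y)) (j v)
    rw [← coe_realOddForm τ lam h] at e1
    simp only [LinearMap.add_apply, Module.End.mul_apply, LinearMap.smul_apply, map_add, hjρ,
      Module.End.one_apply, map_smul, Complex.coe_smul] at e1 ⊢
    exact e1
  · obtain ⟨c, hc⟩ := hspan x
    exact ⟨c, realOddForm_eq_zero_of_mem τ hc⟩

/-- An orthogonal basis computes the rank of the form `B_λ`. -/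
theorem oddRank_eq_card {n : ℕ} (b : Basis (Fin n) ℂ (𝔥.grading 1))
    (hb : ∀ i j, i ≠ j → oddForm lam (b i) (b j) = 0) :
    oddRank lam = ((List.finRange n).filter fun i => oddForm lam (b i) (b i) ≠ 0).length := by
  -- Viewed as a map to the dual space, the form is diagonal in `b` and its dual basis, and the rank
  -- counts the nonzero entries.
  have h1 : oddForm lam = Matrix.toLin b b.dualBasis
      (Matrix.diagonal fun i => oddForm lam (b i) (b i)) := by
    refine b.ext fun i => b.ext fun j => ?_
    rw [Matrix.toLin_self]
    simp only [Matrix.diagonal_apply, ite_smul, zero_smul, Finset.sum_ite_eq', Finset.mem_univ,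
      if_true, LinearMap.smul_apply, Basis.dualBasis_apply_self, smul_eq_mul]
    by_cases hij : i = j
    · subst hij
      simp
    · simp [hb i j hij, Ne.symm hij]
  have h2 : oddRank lam = finrank ℂ (LinearMap.range (Matrix.toLin b b.dualBasis
      (Matrix.diagonal fun i => oddForm lam (b i) (b i)))) :=
    congrArg (fun f => finrank ℂ (LinearMap.range f)) h1
  rw [h2, ← Matrix.rank_eq_finrank_range_toLin, Matrix.rank_diagonal, Fintype.card_subtype]
  rw [← List.toFinset_card_of_nodup ((List.nodup_finRange n).filter _)]
  congr 1
  ext i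
  simp

/-- Some even x of the real form has nonreal λ(x), and i = (λ(x) − Re λ(x)) / Im λ(x). -/
theorem imaginaryUnit_mem_adjoin {τ : 𝔥.AntilinearInvolution} (hlam : HasCentralCharacter M lam)
    (h : lam ≠ conjDual τ lam) :
    imaginaryUnit W ∈ Algebra.adjoin ℝ (Set.range (τ.restrict M).ρ) := by
  obtain ⟨x, hx, him⟩ : ∃ (x : τ.fixed) (hx : (x : L) ∈ 𝔥.grading 0), (lam ⟨x, hx⟩).im ≠ 0 := by
    by_contra hne
    push Not at hne
    exact h (eq_conjDual_of_im_eq_zero hne)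
  have : imaginaryUnit W =
      (lam ⟨x, hx⟩).im⁻¹ • ((τ.restrict M).ρ x - (lam ⟨x, hx⟩).re • 1) := by
    ext v
    have e1 : (τ.restrict M).ρ x v = lam ⟨x, hx⟩ • v := LinearMap.congr_fun (hlam ⟨x, hx⟩) v
    rw [LinearMap.smul_apply, LinearMap.sub_apply, e1, complex_smul_eq]
    simp [smul_smul, him]
  rw [this]
  exact Subalgebra.smul_mem _ (sub_mem (Algebra.subset_adjoin (Set.mem_range_self x))
    (Subalgebra.smul_mem _ (one_mem _) _)) _

theorem restrict_isIrreducible {τ : 𝔥.AntilinearInvolution} (hirr : M.IsIrreducible)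
    (hlam : HasCentralCharacter M lam) (h : lam ≠ conjDual τ lam) :
    (τ.restrict M).IsIrreducible :=
  ⟨hirr.1, fun _ hU => complexSubspace_dichotomy hirr hU
    (apply_mem_of_mem_adjoin (S := Set.range (τ.restrict M).ρ)
      (by rintro _ ⟨x, rfl⟩; exact hU.2 x) (imaginaryUnit_mem_adjoin hlam h))⟩

/-- The commutant of the restriction to the real form in the case of a central character which is
not real. -/
theorem hasCommutant_complex [FiniteDimensional ℂ L] {τ : 𝔥.AntilinearInvolution}
    (hirr : M.IsIrreducible) (hlam : HasCentralCharacter M lam) (h : lam ≠ conjDual τ lam)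
    {γ : End ℝ W} (hγ : (τ.restrict M).IsParity γ) :
    HasCommutant γ (Set.range (τ.restrict M).ρ)
      (BrauerWall.complex (oddRank lam : ZMod 2)).divisionSuperalgebra := by
  have hS := (restrict_isIrreducible hirr hlam h).isGradedSimple hγ
  have hI := imaginaryUnit_mem_adjoin hlam h
  have hγI : γ * imaginaryUnit W = imaginaryUnit W * γ :=
    hγ.comm fun j v hv => (M.grading j).smul_mem Complex.I hv
  -- The action of the whole complex superalgebra by real-linear operators. It stays inside the
  -- algebra generated by the real form because i does.
  let r : L → End ℝ W := fun z => (M.ρ z).restrictScalars ℝ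
  have hr : ∀ z v, r z v = M.ρ z v := fun _ _ => rfl
  have hr_smul : ∀ (c : ℂ) z, r (c • z) = c.re • r z + c.im • (imaginaryUnit W * r z) :=
    fun c z => by
      ext v
      rw [hr, map_smul, LinearMap.smul_apply, complex_smul_eq]
      rfl
  have hr_mem : ∀ z, r z ∈ Algebra.adjoin ℝ (Set.range (τ.restrict M).ρ) := fun z => by
    obtain ⟨x, y, rfl, -⟩ := τ.exists_add_smul z
    have : r (x + Complex.I • (y : L)) =
        (τ.restrict M).ρ x + imaginaryUnit W * (τ.restrict M).ρ y := by
      ext v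
      rw [hr, map_add, map_smul]
      rfl
    rw [this]
    exact add_mem (Algebra.subset_adjoin ⟨x, rfl⟩)
      (mul_mem hI (Algebra.subset_adjoin ⟨y, rfl⟩))
  have hr_comm : ∀ z, imaginaryUnit W * r z = r z * imaginaryUnit W := fun z => by
    ext v
    simp [hr]
  have hr_odd : ∀ z ∈ 𝔥.grading 1, γ * r z = -(r z * γ) := fun z hz => hγ.anticomm fun j v hv => by
    rw [add_comm]; exact M.ρ_mem 1 j z v hz hv
  have hr_anti : ∀ (x y : 𝔥.grading 1), oddForm lam x y = 0 → r x * r y = -(r y * r x) :=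
    fun x y hxy => by
      ext v
      have := LinearMap.congr_fun (hlam.anticommutator x y) v
      rw [hxy, zero_smul] at this
      exact eq_neg_of_add_eq_zero_left this
  have hr_sq : ∀ x : 𝔥.grading 1, oddForm lam x x = 2 → r x * r x = 1 := fun x hx => by
    ext v
    have := LinearMap.congr_fun (hlam.anticommutator x x) v
    rw [hx, ← two_smul ℂ, LinearMap.smul_apply, LinearMap.smul_apply] at this
    exact smul_right_injective W (two_ne_zero (α := ℂ)) this
  have hr_even : ∀ z (hz : z ∈ 𝔥.grading 0),
      r z = (lam ⟨z, hz⟩).re • 1 + (lam ⟨z, hz⟩).im • imaginaryUnit W := fun z hz => by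
    ext v
    have e1 : M.ρ z v = lam ⟨z, hz⟩ • v := LinearMap.congr_fun (hlam ⟨z, hz⟩) v
    rw [hr, e1, complex_smul_eq]
    rfl
  obtain ⟨b, hb⟩ := LinearMap.BilinForm.exists_orthogonal_basis (B := oddForm lam)
    ⟨fun x y => oddForm_symm lam x y⟩
  have hb' : ∀ i j, i ≠ j → oddForm lam (b i) (b j) = 0 := fun i j hij => hb hij
  -- An isotropic vector of an orthogonal basis is orthogonal to the whole basis, so it lies in the
  -- radical and acts by zero.
  have hrad : ∀ i, oddForm lam (b i) (b i) = 0 → r (b i) = 0 := by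
    intro i hi
    have hi' : oddForm lam (b i) = 0 := b.ext fun j => by
      by_cases hij : i = j
      · subst hij; simpa using hi
      · simpa using hb' i j hij
    have hanti : ∀ y, r (b i) * r (y : 𝔥.grading 1) = -(r y * r (b i)) := fun y =>
      hr_anti (b i) y (by rw [hi', LinearMap.zero_apply])
    have : IsAddTorsionFree (End ℝ W) := IsAddTorsionFree.of_isTorsionFree ℝ _
    refine (restrict_isIrreducible hirr hlam h).eq_zero_of_sq_eq_zero hγ (hr_odd _ (b i).2)
      (self_eq_neg.1 (hanti (b i))) (fun y hy => ?_) fun y hy => hanti ⟨y, hy⟩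
    change r (b i) * r y = r y * r (b i)
    rw [hr_even y hy, mul_add, add_mul]
    simp [hr_comm]
  -- Rescaling by `c i` makes the form take the value 2, so that the operator has square 1. For an
  -- isotropic basis vector the quotient is 0 by convention, and such indices are discarded in `I`.
  choose c hc using fun i => IsAlgClosed.exists_pow_nat_eq (2 / oddForm lam (b i) (b i)) two_pos
  let I := (List.finRange (finrank ℂ (𝔥.grading 1))).filter fun i => oddForm lam (b i) (b i) ≠ 0
  have hI_mem : ∀ i, i ∈ I ↔ oddForm lam (b i) (b i) ≠ 0 := fun i => by simp [I]
  let E := I.map fun i => r (c i • b i)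
  have hcl : IsComplexClifford γ (imaginaryUnit W) E :=
    { sq_parity := hγ.1
      sq_complex := imaginaryUnit_mul_self
      parity_complex := hγI
      complex_comm := fun t ht => by
        obtain ⟨i, -, rfl⟩ := List.mem_map.1 ht
        exact hr_comm _
      odd := fun t ht => by
        obtain ⟨i, -, rfl⟩ := List.mem_map.1 ht
        exact hr_odd _ (c i • b i).2
      sq := fun t ht => by
        obtain ⟨i, hi, rfl⟩ := List.mem_map.1 ht
        refine hr_sq (c i • b i) ?_
        rw [map_smul, map_smul, LinearMap.smul_apply, smul_eq_mul, smul_eq_mul, ← mul_assoc,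
          ← sq, hc, div_mul_cancel₀ _ ((hI_mem i).1 hi)]
      anticomm := by
        rw [List.pairwise_map]
        refine ((List.nodup_finRange _).filter _).imp fun {i j} hij => ?_
        refine hr_anti (c i • b i) (c j • b j) ?_
        rw [map_smul, map_smul, LinearMap.smul_apply, hb' i j hij, smul_zero, smul_zero] }
  have hs1 : ∀ s ∈ Set.range (τ.restrict M).ρ,
      s ∈ Algebra.adjoin ℝ (insert (imaginaryUnit W) {t | t ∈ E}) := by
    have hJ := Algebra.subset_adjoin (R := ℝ) (Set.mem_insert (imaginaryUnit W) {t | t ∈ E})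
    have hsmul : ∀ (z : ℂ) (x : L),
        r x ∈ Algebra.adjoin ℝ (insert (imaginaryUnit W) {t | t ∈ E}) →
        r (z • x) ∈ Algebra.adjoin ℝ (insert (imaginaryUnit W) {t | t ∈ E}) := fun z x hx => by
      rw [hr_smul]
      exact add_mem (Subalgebra.smul_mem _ hx _) (Subalgebra.smul_mem _ (mul_mem hJ hx) _)
    rintro _ ⟨x, rfl⟩
    obtain ⟨x₀, hx₀, x₁, hx₁, e⟩ :=
      Submodule.mem_sup.1 (𝔥.isCompl.sup_eq_top ▸ (Submodule.mem_top : (x : L) ∈ ⊤))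
    have e' : (τ.restrict M).ρ x = r x₀ + r x₁ := by
      ext v
      rw [restrict_apply, ← e, map_add]
      rfl
    rw [e']
    refine add_mem ?_ ?_
    · rw [hr_even x₀ hx₀]
      exact add_mem (Subalgebra.smul_mem _ (one_mem _) _) (Subalgebra.smul_mem _ hJ _)
    · have hx : r x₁ = ∑ i, r (b.repr ⟨x₁, hx₁⟩ i • b i) := by
        have : _ = x₁ := congrArg Subtype.val (b.sum_repr ⟨x₁, hx₁⟩)
        rw [AddSubmonoidClass.coe_finsetSum] at this
        ext v
        have hv : r x₁ v = M.ρ (∑ i, ((b.repr ⟨x₁, hx₁⟩ i • b i : 𝔥.grading 1) : L)) v := by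
          rw [this, hr]
        rw [hv, map_sum, LinearMap.sum_apply, LinearMap.sum_apply]
        rfl
      rw [hx]
      refine Subalgebra.sum_mem _ fun i _ => hsmul _ _ ?_
      by_cases hi : oddForm lam (b i) (b i) = 0
      · rw [hrad i hi]
        exact zero_mem _
      · have hci : c i ≠ 0 := fun h0 => by
          have := hc i
          rw [h0, zero_pow two_ne_zero, eq_comm, div_eq_zero_iff] at this
          exact this.elim two_ne_zero hi
        have : (b i : L) = (c i)⁻¹ • c i • (b i : L) := by
          rw [smul_smul, inv_mul_cancel₀ hci, one_smul]
        rw [this]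
        exact hsmul _ _ (Algebra.subset_adjoin
          (Or.inr (List.mem_map.2 ⟨i, (hI_mem i).2 hi, rfl⟩)))
  have hs2 : ∀ s ∈ insert (imaginaryUnit W) {t | t ∈ E},
      s ∈ Algebra.adjoin ℝ (Set.range (τ.restrict M).ρ) := by
    rintro s (rfl | hs)
    · exact hI
    · obtain ⟨i, -, rfl⟩ := List.mem_map.1 hs
      exact hr_mem _
  have := (hcl.hasCommutant E (hS.of_subset_adjoin hs1)).congr_adjoin hs2 hs1
  rw [oddRank_eq_card b hb']
  simpa only [E, List.length_map] using this

/-- As `W` remains irreducible over the real form, the nonzero image of `V` in it is everything; the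
commutant is computed on `W` and transported back along the resulting isomorphism. -/
theorem hasEndotype_complex [FiniteDimensional ℂ L] {τ : 𝔥.AntilinearInvolution} {W : Type v}
    [AddCommGroup W] [Module ℂ W] {M : 𝔥.Rep W} (hirr : M.IsIrreducible)
    (hlam : HasCentralCharacter M lam) (h : lam ≠ conjDual τ lam) :
    HasEndotype τ M (BrauerWall.complex (oddRank lam : ZMod 2)) := by
  refine ⟨exists_isPhi τ M hirr, fun V _ _ N hN => ?_⟩
  obtain ⟨j, hj, hinj⟩ := hN.exists_hom
  have hbij : Function.Bijective j := by
    refine ⟨hinj, LinearMap.range_eq_top.1 ?_⟩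
    refine ((restrict_isIrreducible hirr hlam h).2 _ (Rep.isSubmodule_range hj)).resolve_left
      fun e => ?_
    have := hN.1.1
    obtain ⟨v, hv⟩ := exists_ne (0 : V)
    rw [LinearMap.range_eq_bot] at e
    exact hv (hinj (by simp [e]))
  let e := LinearEquiv.ofBijective j hbij
  have he : e.symm.toLinearMap ∈ Rep.hom (τ.restrict M) N := Rep.isIso_of_bijective hj hbij
  obtain ⟨γ, hγ⟩ := (τ.restrict M).exists_isParity
  have hmem : ∀ i v, v ∈ N.grading i ↔ e v ∈ (τ.restrict M).grading i := fun i v =>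
    ⟨hj.1 i v, fun hv => by
      have : e.symm (e v) ∈ N.grading i := he.1 i _ hv
      rwa [e.symm_apply_apply] at this⟩
  have hγ' : N.IsParity (e.symm.conj γ) := by
    refine ⟨?_, fun v => ?_, fun v => ?_⟩
    · ext v
      have h1 : ∀ w, γ (γ w) = w := LinearMap.congr_fun hγ.1
      simp [LinearEquiv.conj_apply, h1]
    · rw [hmem, hγ.2.1, ← e.symm.injective.eq_iff, e.symm_apply_apply]
      simp [LinearEquiv.conj_apply]
    · rw [hmem, hγ.2.2, ← e.symm.injective.eq_iff, map_neg, e.symm_apply_apply]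
      simp [LinearEquiv.conj_apply]
  have hrange : e.symm.conj '' Set.range (τ.restrict M).ρ = Set.range N.ρ := by
    rw [← Set.range_comp]
    congr 1
    ext x v
    have h1 : e (N.ρ x v) = (τ.restrict M).ρ x (e v) := hj.2 x v
    simp [LinearEquiv.conj_apply, ← h1]
  have := (hasCommutant_complex hirr hlam h hγ).of_linearEquiv e.symm
  rw [hrange] at this
  exact Rep.enrichedEnd_isIso hγ' this

end CentralCharacter

end LieSuperalgebra

/-- Let `𝔥` be a finite-dimensional complex Lie superalgebra with `[𝔥₀, 𝔥] = 0`, let `τ` be an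
antilinear involution of `𝔥`, and let `W` be a finite-dimensional irreducible `𝔥`-module with
central character `λ`. -/
theorem proposition5p1 {L : Type*} [AddCommGroup L] [Module ℂ L] [FiniteDimensional ℂ L]
    (𝔥 : LieSuperalgebra ℂ L)
    (hcentral : ∀ x y : L, x ∈ 𝔥.grading 0 → 𝔥.bracket x y = 0)
    (τ : 𝔥.AntilinearInvolution)
    {W : Type*} [AddCommGroup W] [Module ℂ W] [FiniteDimensional ℂ W]
    (M : 𝔥.Rep W) (hirr : M.IsIrreducible)
    (lam : Module.Dual ℂ (𝔥.grading 0)) (hlam : LieSuperalgebra.HasCentralCharacter M lam) :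
    (lam ≠ LieSuperalgebra.conjDual τ lam →
      LieSuperalgebra.HasEndotype τ M
        (BrauerWall.complex (LieSuperalgebra.oddRank lam : ZMod 2))) ∧
    (lam = LieSuperalgebra.conjDual τ lam →
      ∀ p q : ℕ,
        QuadraticMap.Equivalent (LieSuperalgebra.inducedForm τ lam).toQuadraticMap
          (QuadraticMap.weightedSumSquares ℝ
            (Sum.elim (fun _ : Fin p => (1 : ℝ)) (fun _ : Fin q => (-1 : ℝ)))) →
        LieSuperalgebra.HasEndotype τ M
          (BrauerWall.real ((q : ZMod 8) - (p : ZMod 8)))) :=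
  ⟨LieSuperalgebra.hasEndotype_complex hirr hlam, LieSuperalgebra.hasEndotype_real hirr hlam⟩
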